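/- Let $N$ be a finite ground set with $n$ elements and let $f:2^N\to\mathbb R$ be monotone, submodular and non-negative. A probability distribution $\mathcal D$ on $\mathbb R$, not depending on $n$, has a *generalized exponential tail* if either (i) for some $x_0\ge 0$ it has on $(x_0,\infty)$ the density $e^{-g(x)}$ with $g(x)=\sum_i a_i x^{\alpha_i}$, $\alpha_0\ge\alpha_1\ge\dots$, where the leading exponent satisfies $\alpha_0\ge 1$ (terms of equal exponent being collected, and $a_0>0$); or (ii) it has bounded support and, at the supremum of the support, either an atom or a density that is continuous and non-zero there. Assume moreover that all moments of $\mathcal D$ are finite and that its mean is positive. The noisy oracle is $\widetilde f(S)=\xi_S f(S)$, where the multipliers $\xi_S$, $S\subseteq N$, are drawn independently from $\mathcal D$. For $S\subseteq N$ and a bundle $A\subseteq N\setminus S$ put $A_{ij}=(A\setminus\{i\})\cup\{j\}$ for $i\in A$, $j\notin S\cup A$, and let $\widetilde F(S\cup A)$ be the average of $\widetilde f(S\cup A_{ij})$ over all such $i,j$. The algorithm SM-Greedy with bundle size $c$ starts from $S=\emptyset$ and repeats $\lfloor k/c\rfloor$ times: choose $A\in\arg\max\{\widetilde F(S\cup B):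 B\subseteq N\setminus S,\ |B|=c\}$, and then replace $S$ by $S\cup\hat A$, where $\hat A\in\arg\max_{i\in A,\,j\notin S\cup A}\widetilde f(S\cup A_{ij})$; ties are broken by an arbitrary fixed deterministic rule. It returns the final $S$. Given $\epsilon>0$, it is run with $c=\lceil 80/\epsilon\rceil$ if $k>400/\epsilon^2$, and with $c=k$ (a single iteration) if $k\le 400/\epsilon^2$. **Theorem.** There is an absolute constant $C_1>0$ such that for every $\epsilon>0$ there is an integer $d$ (depending only on $\epsilon$) such that for every constant $C_2$ and every distribution $\mathcal D$ as above there is $n_0$ with the following property. For all $n\ge n_0$, all $k$ with $C_1/\epsilon\le k\le C_2\log\log n$, and every tie-breaking rule, SM-Greedy makes at most $n^d$ oracle evaluations and returns a set $S$ with $|S|\le k$, and for every monotone submodular non-negative $f$ on $N$, with probability at least $1-4/\log_2 n$ over the noise, $$f(S)\ \ge\ \Bigl(1-\tfrac1e-\epsilon\Bigr)\max_{T\subseteq N,\ |T|\le k}f(T).$$ -/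

import Mathlib

open MeasureTheory Set

noncomputable section

/-- A set function `f : 2^N → ℝ` is submodular if `f (S ∪ T) ≤ f S + f T - f (S ∩ T)`. -/
def Submodular {n : ℕ} (f : Finset (Fin n) → ℝ) : Prop :=
  ∀ S T : Finset (Fin n), f (S ∪ T) ≤ f S + f T - f (S ∩ T)

/-- The optimal value `max {f T : |T| ≤ k}`. -/
def optValue {n : ℕ} (f : Finset (Fin n) → ℝ) (k : ℕ) : ℝ :=
  (Finset.univ.filter fun T : Finset (Fin n) => T.card ≤ k).sup' ⟨∅, by simp⟩ f

/-- Generalized exponential tail.  Either, beyond some point `x₀`, the law `D` has the density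
`exp (-g x)` with `g x = ∑ i, a i * x ^ α i` (finitely many nonzero terms or a convergent series),
`α 0 ≥ α 1 ≥ …` and `α 0 ≥ 1`; or `D` has bounded support with supremum `χ`, and has an atom at `χ`
or, near `χ`, a density which is continuous and nonzero at `χ`.

Terms of equal exponent are collected, so that `α 0` is the exponent of the leading term of `g`;
its coefficient is positive because `exp (-g)` is integrable at infinity. -/
def HasGeneralizedExponentialTail (D : Measure ℝ) : Prop :=
  (∃ (x₀ : ℝ) (a α : ℕ → ℝ) (g : ℝ → ℝ), 0 ≤ x₀ ∧ Antitone α ∧ 1 ≤ α 0 ∧ 0 < a 0 ∧ α 1 < α 0 ∧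
    (∀ x > x₀, HasSum (fun i => a i * x ^ α i) (g x)) ∧
    D.restrict (Ioi x₀) =
      (volume.restrict (Ioi x₀)).withDensity fun x => ENNReal.ofReal (Real.exp (-g x))) ∨
  (∃ b χ : ℝ, D (Icc b χ)ᶜ = 0 ∧ (∀ y < χ, 0 < D (Ioc y χ)) ∧
    (0 < D {χ} ∨
      ∃ y < χ, ∃ p : ℝ → ℝ, Measurable p ∧
        D.restrict (Ioc y χ) =
          (volume.restrict (Ioc y χ)).withDensity (fun x => ENNReal.ofReal (p x)) ∧
        ContinuousWithinAt p (Iic χ) χ ∧ 0 < p χ))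

/-- The joint law of the noise multipliers `(ξ_S)`, `S ⊆ N`: independent draws from `D`. -/
def noiseLaw (D : Measure ℝ) (n : ℕ) : Measure (Finset (Fin n) → ℝ) :=
  Measure.pi fun _ => D

/-- The (consistent) noisy oracle `S ↦ ξ_S * f S`. -/
def noisyOracle {n : ℕ} (f ξ : Finset (Fin n) → ℝ) : Finset (Fin n) → ℝ :=
  fun S => ξ S * f S

/-- A deterministic rule which selects one member of every nonempty family of sets.  It is used to
break ties between maximizers. -/
structure TieBreak (n : ℕ) where
  pick : Finset (Finset (Fin n)) → Finset (Fin n)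
  pick_mem : ∀ C : Finset (Finset (Fin n)), C.Nonempty → pick C ∈ C

/-- The maximizer of `h` over the family `C` which is selected by `τ`. -/
def argmaxOver {n : ℕ} (τ : TieBreak n) (C : Finset (Finset (Fin n)))
    (h : Finset (Fin n) → ℝ) : Finset (Fin n) :=
  τ.pick (C.filter fun B => ∀ B' ∈ C, h B' ≤ h B)

/-- The bundles of size `c` that may be added to `S`. -/
def bundles {n : ℕ} (c : ℕ) (S : Finset (Fin n)) : Finset (Finset (Fin n)) :=
  Finset.powersetCard c Sᶜ

/-- The bundle `A_ij = (A \ {i}) ∪ {j}`. -/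
def swap {n : ℕ} (A : Finset (Fin n)) (i j : Fin n) : Finset (Fin n) :=
  insert j (A.erase i)

/-- All bundles `A_ij` with `i ∈ A` and `j ∉ S ∪ A`. -/
def swaps {n : ℕ} (S A : Finset (Fin n)) : Finset (Finset (Fin n)) :=
  (A ×ˢ (S ∪ A)ᶜ).image fun p => swap A p.1 p.2

/-- The mean value of `A` given `S`: the average of `g (S ∪ A_ij)` over all `i ∈ A`, `j ∉ S ∪ A`.
For `g` the noisy oracle this is the noisy mean value. -/
def meanValue {n : ℕ} (g : Finset (Fin n) → ℝ) (S A : Finset (Fin n)) : ℝ :=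
  (∑ i ∈ A, ∑ j ∈ (S ∪ A)ᶜ, g (S ∪ swap A i j)) / ((A.card * (S ∪ A)ᶜ.card : ℕ) : ℝ)

/-- State of the algorithm: the current solution, and the number of oracle evaluations made so far
(each evaluation comes with a bounded number of additions and comparisons). -/
structure GreedyState (n : ℕ) where
  sol : Finset (Fin n)
  evals : ℕ

/-- One iteration of SM-Greedy with oracle `g` and bundle size `c`: find the bundle `A` of largest
mean value (evaluating all `g (S ∪ B_ij)`, for every bundle `B`), then add to the solution the
bundle `A_ij` which maximizes `g (S ∪ A_ij)`. -/
def smStep {n : ℕ} (τ : TieBreak n) (g : Finset (Fin n) → ℝ) (c : ℕ) (s : GreedyState n) :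
    GreedyState n :=
  let A := argmaxOver τ (bundles c s.sol) (meanValue g s.sol)
  { sol := s.sol ∪ argmaxOver τ (swaps s.sol A) (fun B => g (s.sol ∪ B))
    evals := s.evals + ∑ B ∈ bundles c s.sol, B.card * (s.sol ∪ B)ᶜ.card
      + A.card * (s.sol ∪ A)ᶜ.card }

/-- SM-Greedy with oracle `g`, bundle size `c` and budget `k`: `⌊k / c⌋` iterations, starting from
the empty solution. -/
def smGreedy {n : ℕ} (τ : TieBreak n) (g : Finset (Fin n) → ℝ) (c k : ℕ) : GreedyState n :=
  (smStep τ g c)^[k / c] ⟨∅, 0⟩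

/-- The bundle size.  With `δ = ε / 5`, it is `16 / δ = 80 / ε` (rounded up) if
`k > 16 / δ ^ 2 = 400 / ε ^ 2`; for smaller `k` a single bundle of size `k` is used. -/
def bundleSize (ε : ℝ) (k : ℕ) : ℕ :=
  if (k : ℝ) ≤ 400 / ε ^ 2 then k else ⌈80 / ε⌉₊

end

/-!
Fix the current solution `S` and let `W` be the largest `f (S ∪ A)` over bundles `A` of size `c`. By
submodularity the swaps `A_ij` of the best bundle have average value at least
`W - (W - f S) / c`, so it suffices that an iteration chooses a swap of almost that value.

Truncating the multipliers at a small power of `n` and applying Hoeffding's inequality to all (at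
most `n ^ c`) bundles shows that noisy and true mean values are close, so that most swaps of the
selected bundle are nearly as good as the average swap of the best one. The tail hypothesis yields
thresholds `M ≤ M'` with `M / M' → 1` such that, with high probability, every large family of swaps
of a bundle contains a multiplier above `M`, while a fixed bundle has a swap with multiplier above
`M'` only with small probability. If the selected bundle has the former and not the latter, the
noisy maximum over its swaps is nearly a true maximum.

The selected bundle is not a fixed one, and a union bound over all bundles is far too expensive. The
selection bias is however bounded by a constant factor: independently raising a few multipliers of
the swaps of `A` turns `A` from a near maximizer into the strict maximizer, so that up to a constant
and a tiny error the probability that `A` is nearly maximal is at most the probability that it is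
the strict maximizer. The latter events are disjoint, hence these probabilities sum to at most `1`.

The solution after `t` iterations depends only on the multipliers of sets of size at most `t * c`,
while the next iteration uses those of sets of size `(t + 1) * c`; so the estimate for a fixed `S`
applies to every iteration. The gap to the optimum then shrinks by the factor `1 - (c - 2) / k`, up
to a vanishing error, in each iteration.
-/

namespace Submodular

variable {n : ℕ} {f : Finset (Fin n) → ℝ}

theorem sub_erase_le_sub_erase (hf : Submodular f) {Y Z : Finset (Fin n)} (hYZ : Y ⊆ Z)
    {i : Fin n} (hi : i ∈ Y) : f Z - f (Z.erase i) ≤ f Y - f (Y.erase i) := by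
  have hunion : Y ∪ Z.erase i = Z := by
    rw [← Finset.insert_eq_of_mem hi, Finset.insert_union, ← Finset.union_insert,
      Finset.insert_erase (hYZ hi), Finset.union_eq_right.2 hYZ]
  have hinter : Y ∩ Z.erase i = Y.erase i := by
    rw [Finset.inter_erase, Finset.inter_eq_left.2 hYZ]
  have := hf Y (Z.erase i)
  rw [hunion, hinter] at this
  linarith

theorem sum_sub_erase_le_sub_sdiff (hf : Submodular f) {X Z : Finset (Fin n)} (hXZ : X ⊆ Z) :
    ∑ i ∈ X, (f Z - f (Z.erase i)) ≤ f Z - f (Z \ X) := by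
  induction X using Finset.induction_on with
  | empty => simp
  | insert a Y ha ih =>
    have ⟨haZ, hYZ⟩ := Finset.insert_subset_iff.1 hXZ
    have hfirst := hf.sub_erase_le_sub_erase Finset.sdiff_subset (Finset.mem_sdiff.2 ⟨haZ, ha⟩)
    rw [Finset.sum_insert ha, Finset.sdiff_insert]
    linarith [ih hYZ]

theorem sum_sub_union_erase_le (hf : Submodular f) {S X : Finset (Fin n)} (hSX : Disjoint S X) :
    ∑ i ∈ X, (f (S ∪ X) - f (S ∪ X.erase i)) ≤ f (S ∪ X) - f S := by
  have hsum := hf.sum_sub_erase_le_sub_sdiff (Finset.subset_union_right (s₁ := S) (s₂ := X))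
  rw [Finset.union_sdiff_cancel_right hSX] at hsum
  refine (Finset.sum_congr rfl fun i hi => ?_).le.trans hsum
  rw [Finset.erase_union_distrib, Finset.erase_eq_of_notMem (Finset.disjoint_right.1 hSX hi)]

theorem exists_card_mul_sub_erase_le (hf : Submodular f) {S X : Finset (Fin n)}
    (hSX : Disjoint S X) (hX : X.Nonempty) :
    ∃ i ∈ X, (X.card : ℝ) * (f (S ∪ X) - f (S ∪ X.erase i)) ≤ f (S ∪ X) - f S := by
  have hcard : (0 : ℝ) < X.card := by exact_mod_cast hX.card_pos
  obtain ⟨i, hi, hle⟩ : ∃ i ∈ X, f (S ∪ X) - f (S ∪ X.erase i) ≤ (f (S ∪ X) - f S) / X.card := by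
    refine Finset.exists_le_of_sum_le hX ((hf.sum_sub_union_erase_le hSX).trans ?_)
    rw [Finset.sum_const, nsmul_eq_mul, mul_div_cancel₀ _ hcard.ne']
  exact ⟨i, hi, by rwa [← le_div_iff₀' hcard]⟩

theorem exists_subset_card_eq_mul_le (hf : Submodular f) {S X : Finset (Fin n)} {c : ℕ}
    (hc : 0 < c) (hSX : Disjoint S X) (hX : c ≤ X.card) :
    ∃ B ⊆ X, B.card = c ∧ (c : ℝ) * (f (S ∪ X) - f S) ≤ (X.card : ℝ) * (f (S ∪ B) - f S) := by
  induction X using Finset.strongInduction with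
  | H X ih =>
    rcases hX.eq_or_lt with rfl | hlt
    · exact ⟨X, subset_rfl, rfl, le_rfl⟩
    obtain ⟨i, hi, hle⟩ := hf.exists_card_mul_sub_erase_le hSX (Finset.card_pos.1 (by omega))
    have hcard : (X.erase i).card = X.card - 1 := Finset.card_erase_of_mem hi
    obtain ⟨B, hBX, hBc, hB⟩ := ih (X.erase i) (Finset.erase_ssubset hi)
      (hSX.mono_right (Finset.erase_subset _ _)) (by omega)
    refine ⟨B, hBX.trans (Finset.erase_subset _ _), hBc, ?_⟩
    have hx : (2 : ℝ) ≤ X.card := by exact_mod_cast (by omega : 2 ≤ X.card)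
    rw [hcard, Nat.cast_sub (by omega), Nat.cast_one] at hB
    refine le_of_mul_le_mul_left (a := (X.card : ℝ) - 1) ?_ (by linarith)
    calc ((X.card : ℝ) - 1) * (c * (f (S ∪ X) - f S))
        = c * ((X.card - 1) * (f (S ∪ X) - f S)) := by ring
      _ ≤ c * (X.card * (f (S ∪ X.erase i) - f S)) :=
        mul_le_mul_of_nonneg_left (by linarith) (Nat.cast_nonneg c)
      _ = X.card * (c * (f (S ∪ X.erase i) - f S)) := by ring
      _ ≤ X.card * ((X.card - 1) * (f (S ∪ B) - f S)) := by gcongr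
      _ = (X.card - 1) * (X.card * (f (S ∪ B) - f S)) := by ring

end Submodular

section Swaps

variable {n c : ℕ} {S A B T : Finset (Fin n)}

theorem mem_bundles : A ∈ bundles c S ↔ Disjoint S A ∧ A.card = c := by
  rw [bundles, Finset.mem_powersetCard, Finset.subset_compl_iff_disjoint_left]

theorem card_bundles_le_pow (c : ℕ) (S : Finset (Fin n)) : (bundles c S).card ≤ n ^ c := by
  rw [bundles, Finset.card_powersetCard]
  exact (Nat.choose_le_pow _ _).trans
    (Nat.pow_le_pow_left ((Finset.card_le_univ _).trans_eq (Fintype.card_fin n)) c)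

/-- The sets `S ∪ A_ij` over which `meanValue` averages. -/
def neighbors (S A : Finset (Fin n)) : Finset (Finset (Fin n)) :=
  (swaps S A).image (S ∪ ·)

theorem swaps_subset_bundles (hA : A ∈ bundles c S) : swaps S A ⊆ bundles c S := by
  refine Finset.image_subset_iff.2 fun p hp => ?_
  obtain ⟨hi, hj⟩ := Finset.mem_product.1 hp
  rw [Finset.mem_compl, Finset.mem_union, not_or] at hj
  rw [mem_bundles] at hA ⊢
  rw [swap, Finset.disjoint_insert_right,
    Finset.card_insert_of_notMem (fun h => hj.2 (Finset.mem_of_mem_erase h)),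
    Finset.card_erase_add_one hi]
  exact ⟨⟨hj.1, hA.1.mono_right (Finset.erase_subset _ _)⟩, hA.2⟩

theorem card_union_of_mem_bundles (hA : A ∈ bundles c S) : (S ∪ A).card = S.card + c := by
  rw [mem_bundles] at hA
  rw [Finset.card_union_of_disjoint hA.1, hA.2]

theorem card_compl_union_of_mem_bundles (hA : A ∈ bundles c S) :
    (S ∪ A)ᶜ.card = n - (S.card + c) := by
  rw [Finset.card_compl, Fintype.card_fin, card_union_of_mem_bundles hA]

theorem neighbors_subset_image_bundles (hA : A ∈ bundles c S) :
    neighbors S A ⊆ (bundles c S).image (S ∪ ·) :=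
  Finset.image_subset_image (swaps_subset_bundles hA)

theorem card_of_mem_neighbors (hA : A ∈ bundles c S) (hT : T ∈ neighbors S A) :
    T.card = S.card + c := by
  obtain ⟨B, hB, rfl⟩ := Finset.mem_image.1 (neighbors_subset_image_bundles hA hT)
  exact card_union_of_mem_bundles hB

theorem injOn_union_bundles (c : ℕ) (S : Finset (Fin n)) :
    InjOn (S ∪ ·) (bundles c S : Set (Finset (Fin n))) := by
  intro B hB B' hB' (h : S ∪ B = S ∪ B')
  rw [Finset.mem_coe, mem_bundles] at hB hB'
  rw [← Finset.union_sdiff_cancel_left hB.1, h, Finset.union_sdiff_cancel_left hB'.1]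

theorem injOn_union_swaps (hA : A ∈ bundles c S) :
    InjOn (S ∪ ·) (swaps S A : Set (Finset (Fin n))) :=
  (injOn_union_bundles c S).mono (Finset.coe_subset.2 (swaps_subset_bundles hA))

theorem injOn_swap (S A : Finset (Fin n)) :
    InjOn (fun p : Fin n × Fin n => swap A p.1 p.2) (A ×ˢ (S ∪ A)ᶜ : Finset _) := by
  rintro ⟨i, j⟩ h ⟨i', j'⟩ h' heq
  simp only [Finset.coe_product, mem_prod, Finset.mem_coe, Finset.mem_compl, Finset.mem_union,
    not_or] at h h'
  simp only [swap] at heq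
  have hj : j = j' := by
    have : j ∈ insert j' (A.erase i') := heq ▸ Finset.mem_insert_self _ _
    exact (Finset.mem_insert.1 this).resolve_right fun hmem =>
      h.2.2 (Finset.mem_of_mem_erase hmem)
  subst hj
  have herase : A.erase i = A.erase i' := by
    rw [← Finset.erase_insert (fun hmem => h.2.2 (Finset.mem_of_mem_erase hmem) : j ∉ A.erase i),
      heq, Finset.erase_insert fun hmem => h.2.2 (Finset.mem_of_mem_erase hmem)]
  rw [Finset.erase_injOn A h.1 h'.1 herase]

theorem sum_neighbors (hA : A ∈ bundles c S) (g : Finset (Fin n) → ℝ) :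
    ∑ T ∈ neighbors S A, g T = ∑ i ∈ A, ∑ j ∈ (S ∪ A)ᶜ, g (S ∪ swap A i j) := by
  rw [neighbors, Finset.sum_image (injOn_union_swaps hA), swaps, Finset.sum_image (injOn_swap S A),
    Finset.sum_product]

theorem card_neighbors (hA : A ∈ bundles c S) :
    (neighbors S A).card = c * (n - (S.card + c)) := by
  rw [neighbors, Finset.card_image_of_injOn (injOn_union_swaps hA), swaps,
    Finset.card_image_of_injOn (injOn_swap S A), Finset.card_product,
    card_compl_union_of_mem_bundles hA, (mem_bundles.1 hA).2]

theorem meanValue_eq (hA : A ∈ bundles c S) (g : Finset (Fin n) → ℝ) :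
    meanValue g S A = (∑ T ∈ neighbors S A, g T) / ((c * (n - (S.card + c)) : ℕ) : ℝ) := by
  rw [meanValue, sum_neighbors hA, card_compl_union_of_mem_bundles hA, (mem_bundles.1 hA).2]

theorem neighbors_inter_subset (hA : A ∈ bundles c S) (hB : B ∈ bundles c S) {a : Fin n}
    (haA : a ∈ A) (haB : a ∉ B) :
    neighbors S A ∩ neighbors S B ⊆
      ((S ∪ A)ᶜ.image fun j => S ∪ swap A a j) ∪ (B.image fun i => S ∪ swap B i a) := by
  intro T hT
  obtain ⟨hTA, hTB⟩ := Finset.mem_inter.1 hT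
  obtain ⟨T₁, hT₁, rfl⟩ := Finset.mem_image.1 hTA
  obtain ⟨T₂, hT₂, heq⟩ := Finset.mem_image.1 hTB
  obtain rfl : T₂ = T₁ :=
    injOn_union_bundles c S (swaps_subset_bundles hB hT₂) (swaps_subset_bundles hA hT₁) heq
  obtain ⟨⟨i, j⟩, hij, hswapA⟩ := Finset.mem_image.1 hT₁
  obtain ⟨⟨i', j'⟩, hij', hswapB⟩ := Finset.mem_image.1 hT₂
  rw [Finset.mem_product] at hij hij'
  simp only at hij hij' hswapA hswapB
  rw [Finset.mem_union]
  -- `T₂` must arise from `B` by adding `a` if it contains `a`, and from `A` by removing `a` if not.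
  by_cases ha : a ∈ T₂
  · right
    obtain rfl : a = j' := by
      rw [← hswapB, swap, Finset.mem_insert] at ha
      exact ha.resolve_right fun h => haB (Finset.mem_of_mem_erase h)
    exact Finset.mem_image.2 ⟨i', hij'.1, by rw [hswapB]⟩
  · left
    obtain rfl : a = i := by
      by_contra hne
      exact ha (hswapA ▸ Finset.mem_insert_of_mem (Finset.mem_erase.2 ⟨hne, haA⟩))
    exact Finset.mem_image.2 ⟨j, hij.2, by rw [hswapA]⟩

theorem card_neighbors_inter_le (hA : A ∈ bundles c S) (hB : B ∈ bundles c S) (hAB : A ≠ B) :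
    (neighbors S A ∩ neighbors S B).card ≤ (n - (S.card + c)) + c := by
  have hAc := (mem_bundles.1 hA).2
  have hBc := (mem_bundles.1 hB).2
  obtain ⟨a, haA, haB⟩ : ∃ a ∈ A, a ∉ B := by
    by_contra! h
    exact hAB (Finset.eq_of_subset_of_card_le h (by rw [hAc, hBc]))
  calc (neighbors S A ∩ neighbors S B).card
      ≤ _ := Finset.card_le_card (neighbors_inter_subset hA hB haA haB)
    _ ≤ _ := Finset.card_union_le _ _
    _ ≤ (S ∪ A)ᶜ.card + B.card := Nat.add_le_add Finset.card_image_le Finset.card_image_le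
    _ = (n - (S.card + c)) + c := by rw [card_compl_union_of_mem_bundles hA, hBc]

theorem Submodular.le_sum_neighbors {f : Finset (Fin n) → ℝ} (hf : Submodular f)
    (hm : Monotone f) (hA : A ∈ bundles c S) :
    ((n - (S.card + c) : ℕ) : ℝ) * (c * f (S ∪ A) - (f (S ∪ A) - f S)) ≤
      ∑ T ∈ neighbors S A, f T := by
  have hmarginals := hf.sum_sub_union_erase_le (mem_bundles.1 hA).1
  rw [Finset.sum_sub_distrib, Finset.sum_const, (mem_bundles.1 hA).2, nsmul_eq_mul] at hmarginals
  calc ((n - (S.card + c) : ℕ) : ℝ) * (c * f (S ∪ A) - (f (S ∪ A) - f S))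
      ≤ ((n - (S.card + c) : ℕ) : ℝ) * ∑ i ∈ A, f (S ∪ A.erase i) :=
        mul_le_mul_of_nonneg_left (by linarith) (Nat.cast_nonneg _)
    _ = ∑ i ∈ A, ∑ _j ∈ (S ∪ A)ᶜ, f (S ∪ A.erase i) := by
        simp only [Finset.sum_const, nsmul_eq_mul, card_compl_union_of_mem_bundles hA,
          Finset.mul_sum]
    _ ≤ ∑ i ∈ A, ∑ j ∈ (S ∪ A)ᶜ, f (S ∪ swap A i j) :=
        Finset.sum_le_sum fun i _ => Finset.sum_le_sum fun j _ =>
          hm (Finset.union_subset_union_right (Finset.subset_insert _ _))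
    _ = ∑ T ∈ neighbors S A, f T := (sum_neighbors hA f).symm

end Swaps

noncomputable section

section Argmax

variable {n : ℕ} (τ : TieBreak n) {C : Finset (Finset (Fin n))}

theorem argmaxOver_spec (hC : C.Nonempty) (h : Finset (Fin n) → ℝ) :
    argmaxOver τ C h ∈ C ∧ ∀ B ∈ C, h B ≤ h (argmaxOver τ C h) := by
  obtain ⟨B, hB, hmax⟩ := C.exists_max_image h hC
  exact Finset.mem_filter.1 (τ.pick_mem _ ⟨B, Finset.mem_filter.2 ⟨hB, hmax⟩⟩)

theorem argmaxOver_congr {h h' : Finset (Fin n) → ℝ} (hh : ∀ B ∈ C, h B = h' B) :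
    argmaxOver τ C h = argmaxOver τ C h' := by
  unfold argmaxOver
  congr 1
  refine Finset.filter_congr fun B hB => forall₂_congr fun B' hB' => ?_
  rw [hh B hB, hh B' hB']

theorem measurableSet_argmaxOver_eq {Ω : Type*} [MeasurableSpace Ω]
    (C : Finset (Finset (Fin n))) {h : Ω → Finset (Fin n) → ℝ}
    (hh : ∀ B, Measurable fun ω => h ω B) (A : Finset (Fin n)) :
    MeasurableSet {ω | argmaxOver τ C (h ω) = A} := by
  have hunion : {ω | argmaxOver τ C (h ω) = A} = ⋃ C' : Finset (Finset (Fin n)),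
      {ω | τ.pick C' = A ∧ ∀ B, B ∈ C' ↔ (B ∈ C ∧ ∀ B' ∈ C, h ω B' ≤ h ω B)} := by
    ext ω
    simp only [mem_ofPred_eq, mem_iUnion, argmaxOver]
    constructor
    · intro hA
      exact ⟨_, hA, fun B => Finset.mem_filter⟩
    · rintro ⟨C', hA, hC'⟩
      rw [← hA]
      congr 1
      ext B
      rw [hC', Finset.mem_filter]
  rw [hunion]
  refine MeasurableSet.iUnion fun C' => measurableSet_setOfPred.2 ?_
  refine Measurable.and measurable_const (Measurable.forall fun B => Measurable.iff
    measurable_const (Measurable.and measurable_const (Measurable.forall fun B' =>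
      Measurable.imp measurable_const ?_)))
  exact measurableSet_setOfPred.1 (measurableSet_le (hh B') (hh B))

end Argmax

section Algorithm

variable {n c : ℕ} (τ : TieBreak n) (g : Finset (Fin n) → ℝ) {S A : Finset (Fin n)}

/-- The solution after one iteration of SM-Greedy which starts from the solution `S`. -/
def stepSol (τ : TieBreak n) (g : Finset (Fin n) → ℝ) (c : ℕ) (S : Finset (Fin n)) :
    Finset (Fin n) :=
  S ∪ argmaxOver τ (swaps S (argmaxOver τ (bundles c S) (meanValue g S))) (fun B => g (S ∪ B))

theorem sol_smGreedy (c k : ℕ) : (smGreedy τ g c k).sol = (stepSol τ g c)^[k / c] ∅ := by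
  have hsemi : Function.Semiconj GreedyState.sol (smStep τ g c) (stepSol τ g c) := fun _ => rfl
  rw [smGreedy]
  exact hsemi.iterate_right (k / c) _

theorem bundles_nonempty (h : S.card + c ≤ n) : (bundles c S).Nonempty := by
  rw [bundles, Finset.powersetCard_nonempty, Finset.card_compl, Fintype.card_fin]
  omega

theorem swaps_nonempty (hc : 0 < c) (h : S.card + c < n) (hA : A ∈ bundles c S) :
    (swaps S A).Nonempty := by
  refine Finset.Nonempty.image (Finset.Nonempty.product ?_ ?_) _
  · rwa [← Finset.card_pos, (mem_bundles.1 hA).2]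
  · rw [← Finset.card_pos, card_compl_union_of_mem_bundles hA]
    omega

theorem stepSol_spec (hc : 0 < c) (h : S.card + c < n) :
    ∃ A ∈ bundles c S, (∀ B ∈ bundles c S, meanValue g S B ≤ meanValue g S A) ∧
      stepSol τ g c S ∈ neighbors S A ∧ ∀ T ∈ neighbors S A, g T ≤ g (stepSol τ g c S) := by
  obtain ⟨hA, hAmax⟩ := argmaxOver_spec τ (bundles_nonempty h.le) (meanValue g S)
  obtain ⟨hB, hBmax⟩ := argmaxOver_spec τ (swaps_nonempty hc h hA) (fun B => g (S ∪ B))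
  exact ⟨_, hA, hAmax, Finset.mem_image_of_mem _ hB, Finset.forall_mem_image.2 hBmax⟩

theorem card_stepSol (hc : 0 < c) (h : S.card + c < n) : (stepSol τ g c S).card = S.card + c := by
  obtain ⟨A, hA, -, hT, -⟩ := stepSol_spec τ g hc h
  exact card_of_mem_neighbors hA hT

theorem card_iterate_stepSol (hc : 0 < c) {t : ℕ} (h : t * c < n) :
    ((stepSol τ g c)^[t] ∅).card = t * c := by
  induction t with
  | zero => simp
  | succ t ih =>
    rw [Nat.succ_mul] at h ⊢
    rw [Function.iterate_succ_apply', card_stepSol τ g hc] <;> rw [ih (by omega)]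
    exact h

variable {g} in
theorem stepSol_congr {g' : Finset (Fin n) → ℝ} (h : S.card + c ≤ n)
    (hg : ∀ T, T.card = S.card + c → g T = g' T) : stepSol τ g c S = stepSol τ g' c S := by
  have hbundle : argmaxOver τ (bundles c S) (meanValue g S) =
      argmaxOver τ (bundles c S) (meanValue g' S) := by
    refine argmaxOver_congr τ fun B hB => ?_
    rw [meanValue_eq hB, meanValue_eq hB]
    congr 1
    exact Finset.sum_congr rfl fun T hT => hg T (card_of_mem_neighbors hB hT)
  have hA := (argmaxOver_spec τ (bundles_nonempty h) (meanValue g' S)).1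
  rw [stepSol, stepSol, hbundle]
  congr 1
  exact argmaxOver_congr τ fun B hB =>
    hg _ (card_union_of_mem_bundles (swaps_subset_bundles hA hB))

variable {g} in
theorem iterate_stepSol_congr {g' : Finset (Fin n) → ℝ} (hc : 0 < c) {t : ℕ} (h : t * c < n)
    (hg : ∀ T, T.card ≤ t * c → g T = g' T) :
    (stepSol τ g c)^[t] ∅ = (stepSol τ g' c)^[t] ∅ := by
  induction t with
  | zero => simp only [Function.iterate_zero, id]
  | succ t ih =>
    have hsucc := add_one_mul t c
    have hcard := card_iterate_stepSol τ g' hc (t := t) (by omega)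
    rw [Function.iterate_succ_apply', Function.iterate_succ_apply',
      ih (by omega) fun T hT => hg T (by omega)]
    refine stepSol_congr τ (by omega) fun T hT => hg T ?_
    omega

theorem measurable_meanValue {Ω : Type*} [MeasurableSpace Ω] {g : Ω → Finset (Fin n) → ℝ}
    (hg : ∀ T, Measurable fun ω => g ω T) (S A : Finset (Fin n)) :
    Measurable fun ω => meanValue (g ω) S A :=
  (Finset.measurable_sum _ fun _ _ => Finset.measurable_sum _ fun _ _ => hg _).div_const _

theorem measurableSet_stepSol_eq {Ω : Type*} [MeasurableSpace Ω] {g : Ω → Finset (Fin n) → ℝ}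
    (hg : ∀ T, Measurable fun ω => g ω T) (c : ℕ) (S S' : Finset (Fin n)) :
    MeasurableSet {ω | stepSol τ (g ω) c S = S'} := by
  have hunion : {ω | stepSol τ (g ω) c S = S'} =
      ⋃ (A : Finset (Fin n)) (B : Finset (Fin n)) (_ : S ∪ B = S'),
        {ω | argmaxOver τ (bundles c S) (meanValue (g ω) S) = A} ∩
        {ω | argmaxOver τ (swaps S A) (fun B => g ω (S ∪ B)) = B} := by
    ext ω
    simp [stepSol]
  rw [hunion]
  exact .iUnion fun A => .iUnion fun B => .iUnion fun _ =>
    (measurableSet_argmaxOver_eq τ _ (measurable_meanValue hg S) A).inter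
      (measurableSet_argmaxOver_eq τ _ (fun _ => hg _) B)

theorem measurableSet_iterate_stepSol_eq {Ω : Type*} [MeasurableSpace Ω]
    {g : Ω → Finset (Fin n) → ℝ} (hg : ∀ T, Measurable fun ω => g ω T) (c t : ℕ)
    (S : Finset (Fin n)) : MeasurableSet {ω | (stepSol τ (g ω) c)^[t] ∅ = S} := by
  induction t generalizing S with
  | zero => exact .const (∅ = S)
  | succ t ih =>
    have hunion : {ω | (stepSol τ (g ω) c)^[t + 1] ∅ = S} =
        ⋃ S₀, {ω | (stepSol τ (g ω) c)^[t] ∅ = S₀} ∩ {ω | stepSol τ (g ω) c S₀ = S} := by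
      ext ω
      simp [Function.iterate_succ_apply']
    rw [hunion]
    exact .iUnion fun S₀ => (ih S₀).inter (measurableSet_stepSol_eq τ hg c S₀ S)

theorem evals_smStep_le (c : ℕ) (s : GreedyState n) (hn : 0 < n) :
    (smStep τ g c s).evals ≤ s.evals + 2 * n ^ (c + 2) := by
  have hquery : ∀ A B : Finset (Fin n), A.card * B.card ≤ n ^ 2 := fun A B => by
    rw [pow_two]
    exact Nat.mul_le_mul (card_finset_fin_le A) (card_finset_fin_le B)
  have hmean : ∑ B ∈ bundles c s.sol, B.card * (s.sol ∪ B)ᶜ.card ≤ n ^ (c + 2) := by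
    calc ∑ B ∈ bundles c s.sol, B.card * (s.sol ∪ B)ᶜ.card
        ≤ (bundles c s.sol).card • n ^ 2 := Finset.sum_le_card_nsmul _ _ _ fun B _ => hquery _ _
      _ ≤ n ^ c * n ^ 2 := Nat.mul_le_mul_right _ (card_bundles_le_pow c s.sol)
      _ = n ^ (c + 2) := (pow_add _ _ _).symm
  have hswap := hquery (argmaxOver τ (bundles c s.sol) (meanValue g s.sol))
    (s.sol ∪ argmaxOver τ (bundles c s.sol) (meanValue g s.sol))ᶜ
  have hpow : n ^ 2 ≤ n ^ (c + 2) := Nat.pow_le_pow_right hn (by omega)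
  simp only [smStep]
  omega

theorem evals_iterate_smStep_le (c t : ℕ) (hn : 0 < n) :
    ((smStep τ g c)^[t] ⟨∅, 0⟩).evals ≤ t * (2 * n ^ (c + 2)) := by
  induction t with
  | zero => simp
  | succ t ih =>
    rw [Function.iterate_succ_apply', Nat.succ_mul]
    exact (evals_smStep_le τ g c _ hn).trans (Nat.add_le_add_right ih _)

theorem card_sol_smGreedy_le (hc : 0 < c) {k : ℕ} (hk : k < n) :
    (smGreedy τ g c k).sol.card ≤ k := by
  have hkc : k / c * c ≤ k := Nat.div_mul_le_self k c
  rwa [sol_smGreedy, card_iterate_stepSol τ g hc (by omega)]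

theorem evals_smGreedy_le (c : ℕ) {k : ℕ} (hn : 2 ≤ n) (hk : k ≤ n) :
    (smGreedy τ g c k).evals ≤ n ^ (c + 4) := by
  calc (smGreedy τ g c k).evals
      ≤ k / c * (2 * n ^ (c + 2)) := evals_iterate_smStep_le τ g c _ (by omega)
    _ ≤ n * (n * n ^ (c + 2)) := by
        gcongr
        exact (Nat.div_le_self k c).trans hk
    _ = n ^ (c + 4) := by ring

end Algorithm

section BadSelection

variable {ι β : Type*} {𝒜 : Finset β} {Nb : β → Finset ι} {w : ι → ℝ} {θ : ℝ}

/-- Noise vectors for which some maximizer `A` of the noisy total weight of its neighbors `Nb A`,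
followed by a maximizer of the noisy weight over `Nb A`, leads to a true weight below `θ`.  All
maximizers are considered, so that the event does not depend on a tie-breaking rule. -/
def badSelection (𝒜 : Finset β) (Nb : β → Finset ι) (w : ι → ℝ) (θ : ℝ) : Set (ι → ℝ) :=
  {ξ | ∃ A ∈ 𝒜, (∀ B ∈ 𝒜, ∑ T ∈ Nb B, ξ T * w T ≤ ∑ T ∈ Nb A, ξ T * w T) ∧
    ∃ T ∈ Nb A, (∀ T' ∈ Nb A, ξ T' * w T' ≤ ξ T * w T) ∧ w T < θ}

theorem badSelection_congr {ξ ξ' : ι → ℝ} (h : ∀ A ∈ 𝒜, ∀ T ∈ Nb A, ξ T = ξ' T)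
    (hξ : ξ ∈ badSelection 𝒜 Nb w θ) : ξ' ∈ badSelection 𝒜 Nb w θ := by
  obtain ⟨A, hA, hmax, T, hT, hTmax, hlt⟩ := hξ
  have hsum : ∀ B ∈ 𝒜, ∑ T ∈ Nb B, ξ' T * w T = ∑ T ∈ Nb B, ξ T * w T := fun B hB =>
    Finset.sum_congr rfl fun T hT => by rw [h B hB T hT]
  refine ⟨A, hA, fun B hB => ?_, T, hT, fun T' hT' => ?_, hlt⟩
  · rw [hsum B hB, hsum A hA]
    exact hmax B hB
  · rw [← h A hA T hT, ← h A hA T' hT']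
    exact hTmax T' hT'

theorem measurableSet_badSelection (𝒜 : Finset β) (Nb : β → Finset ι) (w : ι → ℝ) (θ : ℝ) :
    MeasurableSet (badSelection 𝒜 Nb w θ) := by
  have hunion : badSelection 𝒜 Nb w θ = ⋃ A ∈ 𝒜,
      (⋂ B ∈ 𝒜, {ξ | ∑ T ∈ Nb B, ξ T * w T ≤ ∑ T ∈ Nb A, ξ T * w T}) ∩
      ⋃ T ∈ Nb A, (⋂ T' ∈ Nb A, {ξ | ξ T' * w T' ≤ ξ T * w T}) ∩ {_ξ | w T < θ} := by
    ext ξ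
    simp only [badSelection, mem_ofPred_eq, mem_iUnion, mem_inter_iff, mem_iInter, exists_prop]
  rw [hunion]
  refine Finset.measurableSet_biUnion _ fun A _ => MeasurableSet.inter ?_ ?_
  · exact Finset.measurableSet_biInter _ fun B _ => measurableSet_le (by fun_prop) (by fun_prop)
  · refine Finset.measurableSet_biUnion _ fun T _ => MeasurableSet.inter ?_ (.const _)
    exact Finset.measurableSet_biInter _ fun T' _ => measurableSet_le (by fun_prop) (by fun_prop)

theorem le_stepSol_of_notMem_badSelection {n c : ℕ} (τ : TieBreak n)
    {f ξ : Finset (Fin n) → ℝ} (hc : 0 < c) {S : Finset (Fin n)} (h : S.card + c < n)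
    (hξ : ξ ∉ badSelection (bundles c S) (neighbors S) f θ) :
    θ ≤ f (stepSol τ (noisyOracle f ξ) c S) := by
  by_contra! hlt
  obtain ⟨A, hA, hAmax, hT, hTmax⟩ := stepSol_spec τ (noisyOracle f ξ) hc h
  refine hξ ⟨A, hA, fun B hB => ?_, _, hT, hTmax, hlt⟩
  have hcard : (0 : ℝ) < (c * (n - (S.card + c)) : ℕ) := by
    exact_mod_cast Nat.mul_pos hc (by omega)
  have hmean := hAmax B hB
  rwa [meanValue_eq hB, meanValue_eq hA, div_le_div_iff_of_pos_right hcard] at hmean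

end BadSelection

end

noncomputable section

section Greedy

variable {n c k : ℕ} {f : Finset (Fin n) → ℝ} {S : Finset (Fin n)}

/-- The largest value of `f (S ∪ B)` over the bundles `B` of size `c`, with value `0` if there is
no such bundle. -/
def bundleMax (f : Finset (Fin n) → ℝ) (c : ℕ) (S : Finset (Fin n)) : ℝ :=
  if h : (bundles c S).Nonempty then (bundles c S).sup' h fun B => f (S ∪ B) else 0

theorem exists_bundleMax_eq (f : Finset (Fin n) → ℝ) (h : S.card + c ≤ n) :
    ∃ A ∈ bundles c S, bundleMax f c S = f (S ∪ A) := by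
  rw [bundleMax, dif_pos (bundles_nonempty h)]
  exact Finset.exists_mem_eq_sup' _ _

theorem le_bundleMax (f : Finset (Fin n) → ℝ) {B : Finset (Fin n)} (hB : B ∈ bundles c S) :
    f (S ∪ B) ≤ bundleMax f c S := by
  rw [bundleMax, dif_pos ⟨B, hB⟩]
  exact Finset.le_sup' (fun B => f (S ∪ B)) hB

theorem le_optValue (f : Finset (Fin n) → ℝ) {T : Finset (Fin n)} (hT : T.card ≤ k) :
    f T ≤ optValue f k :=
  Finset.le_sup' f (Finset.mem_filter.2 ⟨Finset.mem_univ _, hT⟩)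

theorem optValue_nonneg (h0 : 0 ≤ f ∅) (k : ℕ) : 0 ≤ optValue f k :=
  h0.trans (le_optValue f (Nat.zero_le k))

theorem exists_optValue_eq (f : Finset (Fin n) → ℝ) (k : ℕ) :
    ∃ T : Finset (Fin n), T.card ≤ k ∧ optValue f k = f T := by
  obtain ⟨T, hT, h⟩ := Finset.exists_mem_eq_sup'
    (⟨∅, by simp⟩ : (Finset.univ.filter fun T : Finset (Fin n) => T.card ≤ k).Nonempty) f
  exact ⟨T, (Finset.mem_filter.1 hT).2, h⟩

theorem bundleMax_le_optValue (f : Finset (Fin n) → ℝ) (hS : S.card + c ≤ k)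
    (hn : S.card + c ≤ n) : bundleMax f c S ≤ optValue f k := by
  obtain ⟨A, hA, h⟩ := exists_bundleMax_eq f hn
  exact h ▸ le_optValue f ((card_union_of_mem_bundles hA).trans_le hS)

theorem Submodular.mul_sub_le_mul_bundleMax_sub (hf : Submodular f) (hm : Monotone f)
    (hc : 0 < c) {O : Finset (Fin n)} (hO : O.card ≤ k) (hck : c ≤ k) (hn : S.card + c ≤ n) :
    (c : ℝ) * (f (S ∪ O) - f S) ≤ k * (bundleMax f c S - f S) := by
  have hdisj : Disjoint S (O \ S) := Finset.disjoint_sdiff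
  have hX : (O \ S).card ≤ k := (Finset.card_le_card Finset.sdiff_subset).trans hO
  rw [← Finset.union_sdiff_self_eq_union]
  rcases le_total (O \ S).card c with hle | hle
  · obtain ⟨B, hXB, hBS, hBc⟩ := Finset.exists_subsuperset_card_eq
      (Finset.subset_compl_iff_disjoint_left.2 hdisj) hle
      (by rw [Finset.card_compl, Fintype.card_fin]; omega)
    have hB := le_bundleMax f (Finset.mem_powersetCard.2 ⟨hBS, hBc⟩)
    have hXB' : f (S ∪ O \ S) ≤ f (S ∪ B) := hm (Finset.union_subset_union_right hXB)
    have hpos : f S ≤ f (S ∪ O \ S) := hm Finset.subset_union_left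
    exact mul_le_mul (by exact_mod_cast hck) (by linarith) (sub_nonneg.2 hpos) (Nat.cast_nonneg k)
  · obtain ⟨B, hBX, hBc, hB⟩ := hf.exists_subset_card_eq_mul_le hc hdisj hle
    have hmax := le_bundleMax f (mem_bundles.2 ⟨hdisj.mono_right hBX, hBc⟩)
    have hpos : f S ≤ f (S ∪ B) := hm Finset.subset_union_left
    exact hB.trans
      (mul_le_mul (by exact_mod_cast hX) (by linarith) (sub_nonneg.2 hpos) (Nat.cast_nonneg k))

theorem Submodular.mul_optValue_sub_le (hf : Submodular f) (hm : Monotone f) (hc : 0 < c)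
    (hck : c ≤ k) (hn : S.card + c ≤ n) :
    (c : ℝ) * (optValue f k - f S) ≤ k * (bundleMax f c S - f S) := by
  obtain ⟨O, hO, hopt⟩ := exists_optValue_eq f k
  have hle : optValue f k ≤ f (S ∪ O) := hopt ▸ hm Finset.subset_union_right
  exact (mul_le_mul_of_nonneg_left (by linarith) (Nat.cast_nonneg c)).trans
    (hf.mul_sub_le_mul_bundleMax_sub hm hc hO hck hn)

/-- The value that one iteration of SM-Greedy from `S` reaches with high probability.  Exchanging
an element of the best bundle costs up to `2 / c` of its marginal value, and the noise distorts
the comparison by a relative error of order `η`. -/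
def stepValue (f : Finset (Fin n) → ℝ) (c : ℕ) (η : ℝ) (S : Finset (Fin n)) : ℝ :=
  bundleMax f c S - 2 * ((bundleMax f c S - f S) / c) - 6 * η * bundleMax f c S

theorem Submodular.optValue_sub_le_of_stepValue_le (hf : Submodular f) (hm : Monotone f)
    (hc : 2 ≤ c) {η : ℝ} (hη : 0 ≤ η) {S' : Finset (Fin n)} (hS : S.card + c ≤ k)
    (hn : S.card + c ≤ n) (h : stepValue f c η S ≤ f S') :
    optValue f k - f S' ≤
      (1 - ((c : ℝ) - 2) / k) * (optValue f k - f S) + 6 * η * optValue f k := by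
  have hc' : (2 : ℝ) ≤ c := by exact_mod_cast hc
  have hk : (0 : ℝ) < k := by exact_mod_cast (by omega : 0 < k)
  have hgain : (c : ℝ) / k * (optValue f k - f S) ≤ bundleMax f c S - f S := by
    rw [div_mul_eq_mul_div, div_le_iff₀' hk]
    exact hf.mul_optValue_sub_le hm (by omega) (by omega) hn
  have hnoise : 6 * η * bundleMax f c S ≤ 6 * η * optValue f k :=
    mul_le_mul_of_nonneg_left (bundleMax_le_optValue f hS hn) (by linarith)
  have hswap : ((c : ℝ) - 2) / k * (optValue f k - f S) ≤
      bundleMax f c S - f S - 2 * ((bundleMax f c S - f S) / c) := by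
    calc ((c : ℝ) - 2) / k * (optValue f k - f S)
        = (1 - 2 / (c : ℝ)) * (c / k * (optValue f k - f S)) := by field_simp
      _ ≤ (1 - 2 / (c : ℝ)) * (bundleMax f c S - f S) :=
          mul_le_mul_of_nonneg_left hgain (sub_nonneg.2 ((div_le_one (by linarith)).2 hc'))
      _ = _ := by ring
  rw [stepValue] at h
  linarith

theorem le_pow_mul_add_of_le_mul_add {x : ℕ → ℝ} {q b : ℝ} (hq0 : 0 ≤ q) (hq1 : q ≤ 1)
    (hb : 0 ≤ b) {r : ℕ} (hx : ∀ t < r, x (t + 1) ≤ q * x t + b) : x r ≤ q ^ r * x 0 + r * b := by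
  induction r with
  | zero => simp
  | succ r ih =>
    have hr := ih fun t ht => hx t (by omega)
    calc x (r + 1) ≤ q * x r + b := hx r (by omega)
      _ ≤ q * (q ^ r * x 0 + r * b) + b := by gcongr
      _ = q ^ (r + 1) * x 0 + q * (r * b) + b := by ring
      _ ≤ q ^ (r + 1) * x 0 + 1 * (r * b) + b := by gcongr
      _ = q ^ (r + 1) * x 0 + (r + 1 : ℕ) * b := by push_cast; ring

theorem Submodular.optValue_sub_le_of_forall_stepValue_le (hf : Submodular f) (hm : Monotone f)
    (h0 : 0 ≤ f ∅) {r : ℕ} (hc : 2 ≤ c) (hr : r * c ≤ k) (hk : k ≤ n) {η : ℝ} (hη : 0 ≤ η)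
    {s : ℕ → Finset (Fin n)} (hcard : ∀ t ≤ r, (s t).card = t * c)
    (hs : ∀ t < r, stepValue f c η (s t) ≤ f (s (t + 1))) :
    optValue f k - f (s r) ≤ ((1 - ((c : ℝ) - 2) / k) ^ r + 6 * η * r) * optValue f k := by
  have hO : 0 ≤ optValue f k := optValue_nonneg h0 k
  rcases Nat.eq_zero_or_pos r with rfl | hr0
  · simpa [Finset.card_eq_zero.1 ((hcard 0 le_rfl).trans (zero_mul c))] using h0
  have hck : (c : ℝ) ≤ k := by exact_mod_cast (Nat.le_mul_of_pos_left c hr0).trans hr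
  have hc' : (2 : ℝ) ≤ c := by exact_mod_cast hc
  have hk0 : (0 : ℝ) < k := by linarith
  have hq0 : 0 ≤ 1 - ((c : ℝ) - 2) / k := sub_nonneg.2 ((div_le_one hk0).2 (by linarith))
  have hq1 : 1 - ((c : ℝ) - 2) / k ≤ 1 := sub_le_self _ (div_nonneg (by linarith) hk0.le)
  have hgap : ∀ t < r, optValue f k - f (s (t + 1)) ≤
      (1 - ((c : ℝ) - 2) / k) * (optValue f k - f (s t)) + 6 * η * optValue f k := fun t ht => by
    have hct : t * c + c ≤ r * c := by
      rw [← Nat.succ_mul]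
      exact Nat.mul_le_mul_right c ht
    have hcard' := hcard t ht.le
    exact hf.optValue_sub_le_of_stepValue_le hm hc hη (by omega) (by omega) (hs t ht)
  have hstart : optValue f k - f (s 0) ≤ optValue f k :=
    sub_le_self _ (h0.trans (hm (Finset.empty_subset _)))
  have hrec := le_pow_mul_add_of_le_mul_add (x := fun t => optValue f k - f (s t)) hq0 hq1
    (by positivity) hgap
  have := mul_le_mul_of_nonneg_left hstart (pow_nonneg hq0 r)
  linarith

end Greedy

section BundleSize

variable {ε : ℝ} {c k : ℕ}

theorem one_sub_le_div_mul_sub_two_div (hc : 2 ≤ c) (hk : 0 < k) :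
    1 - ((c : ℝ) / k + 2 / c) ≤ (k / c : ℕ) * (((c : ℝ) - 2) / k) := by
  have hk0 : (0 : ℝ) < k := by exact_mod_cast hk
  have hc2 : (2 : ℝ) ≤ c := by exact_mod_cast hc
  have hc0 : (0 : ℝ) < c := by linarith
  have hdiv : (k : ℝ) - c ≤ (k / c : ℕ) * c := by
    have : (k : ℝ) < (k / c : ℕ) * c + c := by
      exact_mod_cast Nat.lt_div_mul_add (a := k) (by omega : 0 < c)
    linarith
  calc 1 - ((c : ℝ) / k + 2 / c)
      ≤ (1 - c / k) * (1 - 2 / c) := by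
        have : 0 ≤ (c : ℝ) / k * (2 / c) := by positivity
        linarith
    _ ≤ ((k / c : ℕ) * c / k) * (1 - 2 / c) := by
        refine mul_le_mul_of_nonneg_right ?_ (sub_nonneg.2 ((div_le_one hc0).2 hc2))
        rwa [le_div_iff₀ hk0, sub_mul, div_mul_cancel₀ _ hk0.ne', one_mul]
    _ = (k / c : ℕ) * (((c : ℝ) - 2) / k) := by field_simp

theorem one_sub_sub_two_div_pow_le_exp (hc : 2 ≤ c) (hck : c ≤ k) :
    (1 - ((c : ℝ) - 2) / k) ^ (k / c) ≤ Real.exp (-1 + ((c : ℝ) / k + 2 / c)) := by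
  have hk0 : (0 : ℝ) < k := by exact_mod_cast (by omega : 0 < k)
  have hck' : (c : ℝ) ≤ k := by exact_mod_cast hck
  have hq : ((c : ℝ) - 2) / k ≤ 1 := (div_le_one hk0).2 (by linarith)
  calc (1 - ((c : ℝ) - 2) / k) ^ (k / c)
      ≤ Real.exp (-(((c : ℝ) - 2) / k)) ^ (k / c) :=
        pow_le_pow_left₀ (by linarith) (Real.one_sub_le_exp_neg _) _
    _ = Real.exp (-((k / c : ℕ) * (((c : ℝ) - 2) / k))) := by rw [← Real.exp_nat_mul, mul_neg]
    _ ≤ Real.exp (-1 + ((c : ℝ) / k + 2 / c)) := by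
        have := one_sub_le_div_mul_sub_two_div hc (by omega : 0 < k)
        exact Real.exp_le_exp.2 (by linarith)

theorem exp_neg_one_add_le {x : ℝ} (h0 : 0 ≤ x) (h1 : x ≤ 1) :
    Real.exp (-1 + x) ≤ 1 / Real.exp 1 + 2 * x := by
  have hx : Real.exp x ≤ 1 + 2 * x := by
    have := Real.abs_exp_sub_one_le (x := x) (by rwa [abs_of_nonneg h0])
    rw [abs_of_nonneg h0] at this
    linarith [le_abs_self (Real.exp x - 1)]
  have hexp : 1 / Real.exp 1 ≤ 1 :=
    (div_le_one (Real.exp_pos 1)).2 (Real.one_le_exp zero_le_one)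
  calc Real.exp (-1 + x) = 1 / Real.exp 1 * Real.exp x := by
        rw [Real.exp_add, Real.exp_neg, one_div]
    _ ≤ 1 / Real.exp 1 * (1 + 2 * x) := by gcongr
    _ ≤ 1 / Real.exp 1 + 2 * x := by nlinarith

theorem bundleSize_pos (hε : 0 < ε) (hk : 0 < k) : 0 < bundleSize ε k := by
  unfold bundleSize
  split_ifs
  · exact hk
  · exact Nat.ceil_pos.2 (by positivity)

theorem bundleSize_le (ε : ℝ) (k : ℕ) :
    bundleSize ε k ≤ ⌈400 / ε ^ 2⌉₊ + ⌈80 / ε⌉₊ := by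
  unfold bundleSize
  split_ifs with h
  · have : k ≤ ⌈400 / ε ^ 2⌉₊ := by exact_mod_cast h.trans (Nat.le_ceil _)
    omega
  · omega

theorem sixteen_le_bundleSize (hε : 0 < ε) (hε1 : ε ≤ 1) (hk : 16 / ε ≤ k) :
    16 ≤ bundleSize ε k := by
  have hdiv : ∀ {y : ℝ}, 16 ≤ y → 16 ≤ y / ε := fun hy => by
    rw [le_div_iff₀ hε]
    linarith
  unfold bundleSize
  split_ifs
  · exact_mod_cast (hdiv le_rfl).trans hk
  · exact_mod_cast (hdiv (by norm_num)).trans (Nat.le_ceil (80 / ε))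

theorem ceil_div_add_two_div_ceil_le (hε : 0 < ε) (hε1 : ε ≤ 1) (hk : 400 / ε ^ 2 < k) :
    ((⌈80 / ε⌉₊ : ℝ) / k + 2 / (⌈80 / ε⌉₊ : ℝ)) ≤ ε / 4 := by
  have hk0 : (0 : ℝ) < k := lt_trans (by positivity) hk
  have hceil : 80 / ε ≤ (⌈80 / ε⌉₊ : ℝ) := Nat.le_ceil _
  have hfirst : (⌈80 / ε⌉₊ : ℝ) / k ≤ ε / 5 + ε / 400 := by
    rw [div_le_iff₀ hk0]
    calc (⌈80 / ε⌉₊ : ℝ) ≤ 80 / ε + 1 := (Nat.ceil_lt_add_one (by positivity)).le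
      _ = (ε / 5 + ε ^ 2 / 400) * (400 / ε ^ 2) := by field_simp; ring
      _ ≤ (ε / 5 + ε / 400) * k :=
        mul_le_mul (by nlinarith) hk.le (by positivity) (by positivity)
  have hsecond : 2 / (⌈80 / ε⌉₊ : ℝ) ≤ ε / 40 := by
    rw [div_le_iff₀ hε] at hceil
    rw [div_le_div_iff₀ (by exact_mod_cast Nat.ceil_pos.2 (by positivity)) (by norm_num)]
    linarith
  linarith

theorem one_sub_bundleSize_pow_le (hε : 0 < ε) (hε1 : ε ≤ 1) (hk : 16 / ε ≤ k) :
    (1 - ((bundleSize ε k : ℝ) - 2) / k) ^ (k / bundleSize ε k) ≤ 1 / Real.exp 1 + ε / 2 := by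
  have hk16 : (16 : ℝ) ≤ k := hk.trans' (by rw [le_div_iff₀ hε]; linarith)
  have h16 := sixteen_le_bundleSize hε hε1 hk
  unfold bundleSize at h16 ⊢
  split_ifs at h16 ⊢ with h
  · rw [Nat.div_self (by omega), pow_one]
    have hexp : (1 : ℝ) / 3 ≤ 1 / Real.exp 1 :=
      one_div_le_one_div_of_le (Real.exp_pos 1) (by linarith [Real.exp_one_lt_d9])
    have hsmall : (2 : ℝ) / k ≤ 1 / 3 := by
      rw [div_le_div_iff₀ (by linarith) (by norm_num)]
      linarith
    rw [sub_div, div_self (by linarith), sub_sub_cancel]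
    linarith
  · have hsum := ceil_div_add_two_div_ceil_le hε hε1 (not_le.1 h)
    have hck : ⌈80 / ε⌉₊ ≤ k := by
      have hnonneg : (0 : ℝ) ≤ 2 / (⌈80 / ε⌉₊ : ℝ) := by positivity
      have hle : (⌈80 / ε⌉₊ : ℝ) ≤ k := (div_le_one (by linarith)).1 (by linarith)
      exact_mod_cast hle
    linarith [one_sub_sub_two_div_pow_le_exp (by omega) hck,
      exp_neg_one_add_le (by positivity) (hsum.trans (by linarith))]

end BundleSize

end

section ProductMeasures

open ProbabilityTheory
open scoped ENNReal

variable {ι : Type*} [Fintype ι] {α : ι → Type*} [∀ i, MeasurableSpace (α i)]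
  (μ : ∀ i, Measure (α i)) [∀ i, IsProbabilityMeasure (μ i)]

theorem lintegral_pi_prod (s : Finset ι) {F : ∀ i, α i → ℝ≥0∞} (hF : ∀ i, Measurable (F i)) :
    ∫⁻ ω, ∏ i ∈ s, F i (ω i) ∂Measure.pi μ = ∏ i ∈ s, ∫⁻ x, F i x ∂μ i := by
  rw [lintegral_prod_eq_prod_lintegral_of_indepFun s (fun i (ω : ∀ i, α i) => F i (ω i))
    (iIndepFun_pi fun i => (hF i).aemeasurable) fun i => (hF i).comp (measurable_pi_apply i)]
  exact Finset.prod_congr rfl fun i _ => (measurePreserving_eval μ i).lintegral_comp (hF i)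

theorem pi_withDensity {r : ∀ i, α i → ℝ≥0∞} (hr : ∀ i, Measurable (r i))
    [∀ i, SigmaFinite ((μ i).withDensity (r i))] :
    Measure.pi (fun i => (μ i).withDensity (r i)) =
      (Measure.pi μ).withDensity fun ω => ∏ i, r i (ω i) := by
  refine Measure.pi_eq fun s hs => ?_
  have hindicator : ∀ ω, (univ.pi s).indicator (fun ω => ∏ i, r i (ω i)) ω =
      ∏ i, (s i).indicator (r i) (ω i) := by
    intro ω
    by_cases hω : ω ∈ univ.pi s
    · rw [indicator_of_mem hω]
      exact Finset.prod_congr rfl fun i _ => (indicator_of_mem (hω i (mem_univ i)) _).symm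
    · rw [indicator_of_notMem hω]
      obtain ⟨i, hi⟩ : ∃ i, ω i ∉ s i := by simpa [Set.mem_pi] using hω
      exact (Finset.prod_eq_zero (Finset.mem_univ i) (indicator_of_notMem hi _)).symm
  rw [withDensity_apply _ (MeasurableSet.univ_pi hs),
    ← lintegral_indicator (MeasurableSet.univ_pi hs)]
  simp_rw [hindicator]
  rw [lintegral_pi_prod μ Finset.univ fun i => (hr i).indicator (hs i)]
  exact Finset.prod_congr rfl fun i _ => by
    rw [lintegral_indicator (hs i), withDensity_apply _ (hs i)]

theorem pi_real_inter_eq_mul [DecidableEq ι] (U : Finset ι) {X Y : Set (∀ i, α i)}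
    (hX : MeasurableSet X) (hY : MeasurableSet Y) (hXU : DependsOn (· ∈ X) (U : Set ι))
    (hYU : DependsOn (· ∈ Y) ((Uᶜ : Finset ι) : Set ι)) :
    (Measure.pi μ).real (X ∩ Y) = (Measure.pi μ).real X * (Measure.pi μ).real Y := by
  have hind : iIndepFun (fun i (ω : ∀ i, α i) => ω i) (Measure.pi μ) :=
    iIndepFun_pi (X := fun _ x => x) fun _ => aemeasurable_id
  obtain ⟨ω₀⟩ : Nonempty (∀ i, α i) := nonempty_of_isProbabilityMeasure (Measure.pi μ)
  have hpreimage : ∀ (V : Finset ι) {Z : Set (∀ i, α i)}, DependsOn (· ∈ Z) (V : Set ι) →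
      (fun ω (i : V) => ω i) ⁻¹' (Function.updateFinset ω₀ V ⁻¹' Z) = Z := fun V Z hZ => by
    ext ω
    refine iff_of_eq (hZ fun i hi => ?_)
    simp [Function.updateFinset, Finset.mem_coe.1 hi]
  have hmul := (hind.indepFun_finset U Uᶜ disjoint_compl_right
    fun i => measurable_pi_apply i).measure_inter_preimage_eq_mul _ _
      (measurable_updateFinset (x := ω₀) hX) (measurable_updateFinset (x := ω₀) hY)
  rw [hpreimage U hXU, hpreimage Uᶜ hYU] at hmul
  simp only [Measure.real, hmul, ENNReal.toReal_mul]

theorem pi_real_eval_preimage (i : ι) {s : Set (α i)} (hs : MeasurableSet s) :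
    (Measure.pi μ).real {ω | ω i ∈ s} = (μ i).real s :=
  (measurePreserving_eval μ i).measureReal_preimage hs.nullMeasurableSet

theorem pi_real_abs_sum_sub_integral_ge_le {φ : ∀ i, α i → ℝ} (hφ : ∀ i, Measurable (φ i))
    (G : Finset ι) {b t : ℝ} (hb : ∀ i ∈ G, ∀ x, |φ i x| ≤ b) (ht : 0 ≤ t) :
    (Measure.pi μ).real {ω | t ≤ |∑ i ∈ G, (φ i (ω i) - ∫ x, φ i x ∂μ i)|} ≤
      2 * Real.exp (-t ^ 2 / (2 * (G.card * b ^ 2))) := by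
  have hsubgaussian : ∀ i ∈ G, HasSubgaussianMGF
      (fun ω : ∀ i, α i => φ i (ω i) - ∫ x, φ i x ∂μ i) ((‖b - -b‖₊ / 2) ^ 2) (Measure.pi μ) := by
    intro i hi
    refine HasSubgaussianMGF.of_map (Y := fun ω : ∀ i, α i => ω i)
      (X := fun x => φ i x - ∫ x, φ i x ∂μ i) (measurable_pi_apply i).aemeasurable ?_
    rw [(measurePreserving_eval μ i).map_eq]
    exact hasSubgaussianMGF_of_mem_Icc (hφ i).aemeasurable
      (ae_of_all _ fun x => abs_le.1 (hb i hi x))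
  have hind : iIndepFun (fun i (ω : ∀ i, α i) => φ i (ω i) - ∫ x, φ i x ∂μ i) (Measure.pi μ) :=
    iIndepFun_pi (X := fun i x => φ i x - ∫ x, φ i x ∂μ i)
      fun i => ((hφ i).sub_const _).aemeasurable
  have hsum := HasSubgaussianMGF.sum_of_iIndepFun hind hsubgaussian
  have hparam : ((∑ _i ∈ G, (‖b - -b‖₊ / 2) ^ 2 : NNReal) : ℝ) = G.card * b ^ 2 := by
    rw [Finset.sum_const, nsmul_eq_mul]
    push_cast
    rw [Real.norm_eq_abs, div_pow, sq_abs]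
    ring
  have hupper := hsum.measure_ge_le ht
  have hlower := hsum.neg.measure_ge_le ht
  rw [hparam] at hupper hlower
  simp only [Pi.neg_apply] at hlower
  simp only [le_abs, ofPred_or]
  linarith [measureReal_union_le (μ := Measure.pi μ)
    {ω | t ≤ ∑ i ∈ G, (φ i (ω i) - ∫ x, φ i x ∂μ i)}
    {ω | t ≤ -∑ i ∈ G, (φ i (ω i) - ∫ x, φ i x ∂μ i)}]

variable {β : Type*} [MeasurableSpace β] (ν : Measure β) [IsProbabilityMeasure ν] {s : Set β}

theorem pi_real_forall_notMem_le (hs : MeasurableSet s) (G : Finset ι) :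
    (Measure.pi fun _ : ι => ν).real {ω | ∀ i ∈ G, ω i ∉ s} ≤
      Real.exp (-(ν.real s * G.card)) := by
  have hinter : {ω : ι → β | ∀ i ∈ G, ω i ∉ s} = ⋂ i ∈ G, (fun ω => ω i) ⁻¹' sᶜ := by
    ext ω
    simp
  have hind : iIndepFun (fun i (ω : ι → β) => ω i) (Measure.pi fun _ => ν) :=
    iIndepFun_pi (X := fun _ x => x) fun _ => aemeasurable_id
  have hpow : (Measure.pi fun _ : ι => ν).real {ω | ∀ i ∈ G, ω i ∉ s} =
      (1 - ν.real s) ^ G.card := by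
    rw [hinter, Measure.real, hind.measure_inter_preimage_eq_mul G (fun _ _ => hs.compl),
      ENNReal.toReal_prod, ← Finset.prod_const, ← probReal_compl_eq_one_sub hs]
    exact Finset.prod_congr rfl fun i _ => pi_real_eval_preimage (fun _ => ν) i hs.compl
  calc (Measure.pi fun _ : ι => ν).real {ω | ∀ i ∈ G, ω i ∉ s}
      = (1 - ν.real s) ^ G.card := hpow
    _ ≤ Real.exp (-ν.real s) ^ G.card :=
        pow_le_pow_left₀ (sub_nonneg.2 measureReal_le_one) (Real.one_sub_le_exp_neg _) _
    _ = Real.exp (-(ν.real s * G.card)) := by rw [← Real.exp_nat_mul, mul_neg, mul_comm]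

theorem pi_real_exists_mem_le (hs : MeasurableSet s) (G : Finset ι) :
    (Measure.pi fun _ : ι => ν).real {ω | ∃ i ∈ G, ω i ∈ s} ≤ G.card * ν.real s := by
  have hunion : {ω : ι → β | ∃ i ∈ G, ω i ∈ s} = ⋃ i ∈ G, {ω | ω i ∈ s} := by
    ext ω
    simp
  rw [hunion, ← nsmul_eq_mul, ← Finset.sum_const]
  refine (measureReal_biUnion_finset_le _ _).trans_eq (Finset.sum_congr rfl fun i _ => ?_)
  exact pi_real_eval_preimage (fun _ => ν) i hs

theorem abs_setIntegral_Icc_sub_integral_le {D : Measure ℝ} {R : ℝ} (hR : 0 < R)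
    (hint : Integrable (fun x : ℝ => x) D) (hint2 : Integrable (fun x : ℝ => x ^ 2) D) :
    |∫ x in Icc (-R) R, x ∂D - ∫ x, x ∂D| ≤ (∫ x, x ^ 2 ∂D) / R := by
  have hcompl : ∫ x in Icc (-R) R, x ∂D - ∫ x, x ∂D = -∫ x in (Icc (-R) R)ᶜ, x ∂D := by
    rw [← integral_add_compl measurableSet_Icc hint]
    ring
  have hlarge : ∀ x ∈ (Icc (-R) R)ᶜ, |x| ≤ x ^ 2 / R := fun x hx => by
    rw [mem_compl_iff, mem_Icc, ← abs_le, not_le] at hx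
    rw [le_div_iff₀ hR, ← sq_abs, sq]
    exact mul_le_mul_of_nonneg_left hx.le (abs_nonneg x)
  calc |∫ x in Icc (-R) R, x ∂D - ∫ x, x ∂D|
      ≤ ∫ x in (Icc (-R) R)ᶜ, |x| ∂D := by
        rw [hcompl, abs_neg]
        exact abs_integral_le_integral_abs
    _ ≤ ∫ x in (Icc (-R) R)ᶜ, x ^ 2 / R ∂D :=
        setIntegral_mono_on hint.abs.integrableOn (hint2.div_const R).integrableOn
          measurableSet_Icc.compl hlarge
    _ ≤ ∫ x, x ^ 2 / R ∂D :=
        setIntegral_le_integral (hint2.div_const R) (ae_of_all _ fun x => by positivity)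
    _ = (∫ x, x ^ 2 ∂D) / R := integral_div R _

end ProductMeasures

section Coupling

open ProbabilityTheory
open scoped ENNReal NNReal

/-- Replace the first coordinate, if it is at most `a`, by the second one, if that is at least
`a + 1`; the original first coordinate is kept for comparison. -/
noncomputable def raise (a : ℝ) (p : ℝ × ℝ) : ℝ × ℝ :=
  (p.1, if p.1 ≤ a ∧ a + 1 ≤ p.2 then p.2 else p.1)

/-- The law of a pair `(x, x')`, where `x` has law `D` and `x'` arises from `x` by an independent
attempt, made with probability `ρ`, to raise a value below `a` to a value above `a + 1`. -/
noncomputable def raiseCoupling (D : Measure ℝ) (a ρ : ℝ) : Measure (ℝ × ℝ) :=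
  ENNReal.ofReal (1 - ρ) • D.map (fun x => (x, x)) +
    ENNReal.ofReal ρ • (D.prod D).map (raise a)

/-- The first order term of the density of a raised variable. -/
noncomputable def raiseScore (D : Measure ℝ) (a x : ℝ) : ℝ :=
  (Ici (a + 1)).indicator (fun _ => D.real (Iic a)) x -
    (Iic a).indicator (fun _ => D.real (Ici (a + 1))) x

variable (D : Measure ℝ) (a : ℝ) {ρ : ℝ}

theorem measurable_raise : Measurable (raise a) := by
  unfold raise
  refine measurable_fst.prodMk (Measurable.ite ?_ measurable_snd measurable_fst)
  exact (measurableSet_le measurable_fst measurable_const).inter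
    (measurableSet_le measurable_const measurable_snd)

theorem lintegral_raiseCoupling {F : ℝ × ℝ → ℝ≥0∞} (hF : Measurable F) :
    ∫⁻ p, F p ∂raiseCoupling D a ρ = ENNReal.ofReal (1 - ρ) * ∫⁻ x, F (x, x) ∂D +
      ENNReal.ofReal ρ * ∫⁻ p, F (raise a p) ∂D.prod D := by
  rw [raiseCoupling, lintegral_add_measure, lintegral_smul_measure, lintegral_smul_measure,
    lintegral_map hF (by fun_prop), lintegral_map hF (measurable_raise a), smul_eq_mul, smul_eq_mul]

theorem raiseCoupling_apply {s : Set (ℝ × ℝ)} (hs : MeasurableSet s) :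
    raiseCoupling D a ρ s = ENNReal.ofReal (1 - ρ) * D {x | (x, x) ∈ s} +
      ENNReal.ofReal ρ * (D.prod D) {p | raise a p ∈ s} := by
  rw [raiseCoupling, Measure.add_apply, Measure.smul_apply, Measure.smul_apply,
    Measure.map_apply (by fun_prop) hs, Measure.map_apply (measurable_raise a) hs]
  rfl

theorem measurable_raiseScore : Measurable (raiseScore D a) := by
  unfold raiseScore
  exact (measurable_const.indicator measurableSet_Ici).sub
    (measurable_const.indicator measurableSet_Iic)

theorem ofReal_one_sub_add_ofReal (h0 : 0 ≤ ρ) (h1 : ρ ≤ 1) :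
    ENNReal.ofReal (1 - ρ) + ENNReal.ofReal ρ = 1 := by
  rw [← ENNReal.ofReal_add (sub_nonneg.2 h1) h0, sub_add_cancel, ENNReal.ofReal_one]

theorem raise_fst_le_snd (p : ℝ × ℝ) : (raise a p).1 ≤ (raise a p).2 := by
  unfold raise
  dsimp only
  split_ifs with h
  · linarith [h.1, h.2]
  · exact le_rfl

theorem ae_fst_le_snd_raiseCoupling : ∀ᵐ p ∂raiseCoupling D a ρ, p.1 ≤ p.2 := by
  have hmeas : MeasurableSet {p : ℝ × ℝ | ¬ p.1 ≤ p.2} :=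
    (measurableSet_le measurable_fst measurable_snd).compl
  rw [ae_iff, raiseCoupling_apply D a hmeas]
  simp [not_lt.2 (raise_fst_le_snd a _)]

variable [IsProbabilityMeasure D]

theorem isProbabilityMeasure_raiseCoupling (h0 : 0 ≤ ρ) (h1 : ρ ≤ 1) :
    IsProbabilityMeasure (raiseCoupling D a ρ) := by
  constructor
  rw [raiseCoupling_apply D a MeasurableSet.univ]
  simp only [mem_univ, ofPred_true, measure_univ, mul_one]
  exact ofReal_one_sub_add_ofReal h0 h1

theorem map_fst_raiseCoupling (h0 : 0 ≤ ρ) (h1 : ρ ≤ 1) :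
    (raiseCoupling D a ρ).map Prod.fst = D := by
  ext s hs
  have hprod : {p : ℝ × ℝ | raise a p ∈ Prod.fst ⁻¹' s} = s ×ˢ univ := by
    ext p
    simp [raise]
  rw [Measure.map_apply measurable_fst hs, raiseCoupling_apply D a (measurable_fst hs), hprod,
    Measure.prod_prod, measure_univ, mul_one]
  change ENNReal.ofReal (1 - ρ) * D s + ENNReal.ofReal ρ * D s = D s
  rw [← add_mul, ofReal_one_sub_add_ofReal h0 h1, one_mul]

theorem exp_sub_raise_le (p : ℝ × ℝ) : Real.exp (-((raise a p).2 - (raise a p).1)) ≤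
    1 - (Iic a ×ˢ Ici (a + 1)).indicator (fun _ => (1 / 2 : ℝ)) p := by
  by_cases hp : p.1 ≤ a ∧ a + 1 ≤ p.2
  · rw [indicator_of_mem (show p ∈ Iic a ×ˢ Ici (a + 1) from hp)]
    simp only [raise, hp, and_self, if_true]
    calc Real.exp (-(p.2 - p.1)) ≤ Real.exp (-1) := Real.exp_le_exp.2 (by linarith [hp.1, hp.2])
      _ ≤ 1 - 1 / 2 := by linarith [Real.exp_neg_one_lt_half]
  · rw [indicator_of_notMem (show p ∉ Iic a ×ˢ Ici (a + 1) from hp), sub_zero,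
      Real.exp_le_one_iff, neg_nonpos, sub_nonneg]
    exact raise_fst_le_snd a p

theorem lintegral_exp_sub_raise_le :
    ∫⁻ p, ENNReal.ofReal (Real.exp (-((raise a p).2 - (raise a p).1))) ∂D.prod D ≤
      ENNReal.ofReal (1 - D.real (Iic a) * D.real (Ici (a + 1)) / 2) := by
  have hraised : MeasurableSet (Iic a ×ˢ Ici (a + 1) : Set (ℝ × ℝ)) :=
    measurableSet_Iic.prod measurableSet_Ici
  have hint : Integrable ((Iic a ×ˢ Ici (a + 1)).indicator fun _ : ℝ × ℝ => (1 / 2 : ℝ))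
      (D.prod D) := (integrable_const _).indicator hraised
  have hintegral : ∫ p, (1 - (Iic a ×ˢ Ici (a + 1)).indicator (fun _ => (1 / 2 : ℝ)) p)
      ∂D.prod D = 1 - D.real (Iic a) * D.real (Ici (a + 1)) / 2 := by
    rw [integral_sub (integrable_const _) hint, integral_indicator hraised, setIntegral_const,
      measureReal_prod_prod, integral_const, probReal_univ, smul_eq_mul, smul_eq_mul]
    ring
  rw [← hintegral, ofReal_integral_eq_lintegral_ofReal
    (f := fun p => 1 - (Iic a ×ˢ Ici (a + 1)).indicator (fun _ => (1 / 2 : ℝ)) p)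
    ((integrable_const _).sub hint)
    (ae_of_all _ fun p => (Real.exp_pos _).le.trans (exp_sub_raise_le a p))]
  exact lintegral_mono fun p => ENNReal.ofReal_le_ofReal (exp_sub_raise_le a p)

theorem lintegral_exp_sub_raiseCoupling_le (h0 : 0 ≤ ρ) (h1 : ρ ≤ 1) :
    ∫⁻ p, ENNReal.ofReal (Real.exp (-(p.2 - p.1))) ∂raiseCoupling D a ρ ≤
      ENNReal.ofReal (Real.exp (-(ρ * (D.real (Iic a) * D.real (Ici (a + 1)))) / 2)) := by
  set q := D.real (Iic a) * D.real (Ici (a + 1))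
  have hq1 : q ≤ 1 := mul_le_one₀ measureReal_le_one measureReal_nonneg measureReal_le_one
  calc ∫⁻ p, ENNReal.ofReal (Real.exp (-(p.2 - p.1))) ∂raiseCoupling D a ρ
      = ENNReal.ofReal (1 - ρ) + ENNReal.ofReal ρ *
          ∫⁻ p, ENNReal.ofReal (Real.exp (-((raise a p).2 - (raise a p).1))) ∂D.prod D := by
        rw [lintegral_raiseCoupling D a (by fun_prop)]
        simp only [sub_self, neg_zero, Real.exp_zero, ENNReal.ofReal_one, lintegral_one,
          measure_univ, mul_one]
    _ ≤ ENNReal.ofReal (1 - ρ) + ENNReal.ofReal ρ * ENNReal.ofReal (1 - q / 2) := by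
        gcongr
        exact lintegral_exp_sub_raise_le D a
    _ = ENNReal.ofReal (1 - ρ * q / 2) := by
        rw [← ENNReal.ofReal_mul h0, ← ENNReal.ofReal_add (by linarith)
          (mul_nonneg h0 (by linarith))]
        congr 1
        ring
    _ ≤ ENNReal.ofReal (Real.exp (-(ρ * q) / 2)) :=
        ENNReal.ofReal_le_ofReal (neg_div 2 (ρ * q) ▸ Real.one_sub_le_exp_neg (ρ * q / 2))

theorem raiseScore_mem_Icc (x : ℝ) : raiseScore D a x ∈ Icc (-1) 1 := by
  have hindicator : ∀ s t : Set ℝ, s.indicator (fun _ => D.real t) x ∈ Icc 0 1 := fun s t =>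
    ⟨indicator_nonneg (fun _ _ => measureReal_nonneg) x,
      indicator_le' (fun _ _ => measureReal_le_one) (fun _ _ => zero_le_one) x⟩
  have hhigh := hindicator (Ici (a + 1)) (Iic a)
  have hlow := hindicator (Iic a) (Ici (a + 1))
  exact ⟨by unfold raiseScore; linarith [hhigh.1, hlow.2],
    by unfold raiseScore; linarith [hhigh.2, hlow.1]⟩

theorem setIntegral_raiseScore (s : Set ℝ) :
    ∫ x in s, raiseScore D a x ∂D = D.real (s ∩ Ici (a + 1)) * D.real (Iic a) -
      D.real (s ∩ Iic a) * D.real (Ici (a + 1)) := by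
  unfold raiseScore
  rw [integral_sub ((integrable_const _).indicator measurableSet_Ici)
    ((integrable_const _).indicator measurableSet_Iic), setIntegral_indicator measurableSet_Ici,
    setIntegral_indicator measurableSet_Iic, setIntegral_const, setIntegral_const, smul_eq_mul,
    smul_eq_mul]

theorem integrable_raiseScore : Integrable (raiseScore D a) D :=
  Integrable.of_mem_Icc (-1) 1 (measurable_raiseScore D a).aemeasurable
    (ae_of_all _ (raiseScore_mem_Icc D a))

theorem prod_real_raise_snd {s : Set ℝ} (hs : MeasurableSet s) :
    (D.prod D).real {p | (raise a p).2 ∈ s} = D.real s + ∫ x in s, raiseScore D a x ∂D := by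
  have hdecomp : {p : ℝ × ℝ | (raise a p).2 ∈ s} =
      ((s ×ˢ univ) \ ((s ∩ Iic a) ×ˢ Ici (a + 1))) ∪ (Iic a ×ˢ (s ∩ Ici (a + 1))) := by
    ext p
    by_cases h : p.1 ≤ a ∧ a + 1 ≤ p.2
    · simp [raise, h]
    · simp only [raise, h, if_false, mem_ofPred_eq, mem_union, mem_sdiff, mem_prod, mem_univ,
        and_true, mem_inter_iff, mem_Iic, mem_Ici]
      tauto
  rw [hdecomp, measureReal_union, measureReal_sdiff, measureReal_prod_prod,
    measureReal_prod_prod, measureReal_prod_prod, setIntegral_raiseScore D a s]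
  · rw [probReal_univ]
    ring
  · exact prod_mono inter_subset_left (subset_univ _)
  · exact (hs.inter measurableSet_Iic).prod measurableSet_Ici
  · rw [Set.disjoint_left]
    rintro p ⟨⟨hps, -⟩, hnot⟩ ⟨hlow, -, hhigh⟩
    exact hnot ⟨⟨hps, hlow⟩, hhigh⟩
  · exact measurableSet_Iic.prod (hs.inter measurableSet_Ici)

theorem map_snd_raiseCoupling (h0 : 0 ≤ ρ) (h1 : ρ ≤ 1) :
    (raiseCoupling D a ρ).map Prod.snd =
      D.withDensity fun x => ENNReal.ofReal (1 + ρ * raiseScore D a x) := by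
  have hscore := (integrable_raiseScore D a).const_mul ρ
  have hnonneg : ∀ x, 0 ≤ 1 + ρ * raiseScore D a x := fun x => by
    nlinarith [(raiseScore_mem_Icc D a x).1]
  ext s hs
  have hintegral : ∫ x in s, (1 + ρ * raiseScore D a x) ∂D =
      (1 - ρ) * D.real s + ρ * (D.prod D).real {p | (raise a p).2 ∈ s} := by
    rw [prod_real_raise_snd D a hs, integral_add (integrable_const _) hscore.integrableOn,
      setIntegral_const, integral_const_mul, smul_eq_mul]
    ring
  rw [Measure.map_apply measurable_snd hs, raiseCoupling_apply D a (measurable_snd hs),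
    withDensity_apply _ hs, ← ofReal_integral_eq_lintegral_ofReal
      (f := fun x => 1 + ρ * raiseScore D a x) ((integrable_const _).add hscore.integrableOn)
      (ae_of_all _ hnonneg), hintegral,
    ENNReal.ofReal_add (mul_nonneg (sub_nonneg.2 h1) measureReal_nonneg)
      (mul_nonneg h0 measureReal_nonneg),
    ENNReal.ofReal_mul (sub_nonneg.2 h1), ENNReal.ofReal_mul h0, ofReal_measureReal,
    ofReal_measureReal]
  rfl

theorem lintegral_exp_raiseScore_le (t : ℝ) :
    ∫⁻ x, ENNReal.ofReal (Real.exp (t * raiseScore D a x)) ∂D ≤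
      ENNReal.ofReal (Real.exp (t ^ 2 / 2)) := by
  have hsub := hasSubgaussianMGF_of_mem_Icc_of_integral_eq_zero (μ := D)
    (measurable_raiseScore D a).aemeasurable (ae_of_all _ (raiseScore_mem_Icc D a)) (by
      rw [← setIntegral_univ, setIntegral_raiseScore D a univ]
      simp [mul_comm])
  rw [← ofReal_integral_eq_lintegral_ofReal (hsub.integrable_exp_mul t)
    (ae_of_all _ fun x => (Real.exp_pos _).le)]
  refine ENNReal.ofReal_le_ofReal ((hsub.mgf_le t).trans (Real.exp_le_exp.2 ?_))
  have hparam : (((‖(1 : ℝ) - -1‖₊ / 2) ^ 2 : ℝ≥0) : ℝ) = 1 := by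
    push_cast
    norm_num
  rw [hparam, one_mul]

end Coupling

section CouplingComparison

open scoped ENNReal

variable {ι : Type*}

theorem exp_le_exp_one_add {l : ℝ} (hl : 0 ≤ l) (y : ℝ) :
    Real.exp y ≤ Real.exp 1 + Real.exp (-l) * Real.exp ((1 + l) * y) := by
  rcases le_total y 1 with hy | hy
  · exact (Real.exp_le_exp.2 hy).trans (le_add_of_nonneg_right (by positivity))
  · rw [← Real.exp_add]
    exact (Real.exp_le_exp.2 (by nlinarith)).trans
      (le_add_of_nonneg_left (Real.exp_pos 1).le)

theorem prod_ofReal_one_add_le {l : ℝ} (hl : 0 ≤ l) (G : Finset ι) (u : ι → ℝ) :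
    ∏ i ∈ G, ENNReal.ofReal (1 + u i) ≤ ENNReal.ofReal (Real.exp 1) +
      ENNReal.ofReal (Real.exp (-l)) * ∏ i ∈ G, ENNReal.ofReal (Real.exp ((1 + l) * u i)) := by
  have hexp : ∀ v : ι → ℝ,
      ∏ i ∈ G, ENNReal.ofReal (Real.exp (v i)) = ENNReal.ofReal (Real.exp (∑ i ∈ G, v i)) :=
    fun v => by rw [← ENNReal.ofReal_prod_of_nonneg fun i _ => (Real.exp_pos _).le, Real.exp_sum]
  calc ∏ i ∈ G, ENNReal.ofReal (1 + u i) ≤ ∏ i ∈ G, ENNReal.ofReal (Real.exp (u i)) :=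
        Finset.prod_le_prod' fun i _ =>
          ENNReal.ofReal_le_ofReal (add_comm 1 (u i) ▸ Real.add_one_le_exp (u i))
    _ ≤ ENNReal.ofReal (Real.exp 1 +
          Real.exp (-l) * Real.exp ((1 + l) * ∑ i ∈ G, u i)) := by
        rw [hexp]
        exact ENNReal.ofReal_le_ofReal (exp_le_exp_one_add hl _)
    _ = _ := by
        rw [hexp, ENNReal.ofReal_add (Real.exp_pos _).le (by positivity),
          ENNReal.ofReal_mul (Real.exp_pos _).le, Finset.mul_sum]

open Classical in
/-- For a family of pairs (the original and the raised value of every coordinate), the point which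
takes the raised values on `G` and the original values elsewhere. -/
noncomputable def raisedOn (G : Finset ι) (ω : ι → ℝ × ℝ) : ι → ℝ :=
  fun i => if i ∈ G then (ω i).2 else (ω i).1

theorem measurable_raisedOn (G : Finset ι) : Measurable (raisedOn G) :=
  measurable_pi_lambda _ fun i => by
    by_cases hi : i ∈ G <;> simp only [raisedOn, hi, if_true, if_false] <;> fun_prop

variable [Fintype ι] {D : Measure ℝ} [IsProbabilityMeasure D]

theorem lintegral_pi_prod_exp_raiseScore_le (a t : ℝ) (G : Finset ι) :
    ∫⁻ ξ, ∏ i ∈ G, ENNReal.ofReal (Real.exp (t * raiseScore D a (ξ i)))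
      ∂Measure.pi (fun _ : ι => D) ≤ ENNReal.ofReal (Real.exp (t ^ 2 / 2 * G.card)) := by
  have hmeas : Measurable fun x => ENNReal.ofReal (Real.exp (t * raiseScore D a x)) := by
    have := measurable_raiseScore D a
    fun_prop
  rw [lintegral_pi_prod (fun _ => D) G fun _ => hmeas, Finset.prod_const, mul_comm (t ^ 2 / 2),
    Real.exp_nat_mul, ENNReal.ofReal_pow (Real.exp_pos _).le]
  exact pow_le_pow_left₀ zero_le (lintegral_exp_raiseScore_le D a t) _

theorem pi_withDensity_raiseScore_le (a : ℝ) {ρ l : ℝ} (hl : 0 ≤ l) (G : Finset ι)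
    {Y : Set (ι → ℝ)} (hY : MeasurableSet Y) :
    ((Measure.pi fun _ : ι => D).withDensity fun ξ =>
      ∏ i ∈ G, ENNReal.ofReal (1 + ρ * raiseScore D a (ξ i))) Y ≤
    ENNReal.ofReal (Real.exp 1 * (Measure.pi fun _ : ι => D).real Y +
      Real.exp (((1 + l) * ρ) ^ 2 / 2 * G.card - l)) := by
  set P := Measure.pi fun _ : ι => D
  set tilt : (ι → ℝ) → ℝ≥0∞ := fun ξ =>
    ∏ i ∈ G, ENNReal.ofReal (Real.exp ((1 + l) * ρ * raiseScore D a (ξ i)))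
  rw [withDensity_apply _ hY]
  calc ∫⁻ ξ in Y, ∏ i ∈ G, ENNReal.ofReal (1 + ρ * raiseScore D a (ξ i)) ∂P
      ≤ ∫⁻ ξ in Y, (ENNReal.ofReal (Real.exp 1) + ENNReal.ofReal (Real.exp (-l)) * tilt ξ) ∂P :=
        lintegral_mono fun ξ => by
          simpa only [tilt, mul_assoc] using
            prod_ofReal_one_add_le hl G fun i => ρ * raiseScore D a (ξ i)
    _ = ENNReal.ofReal (Real.exp 1) * P Y +
          ENNReal.ofReal (Real.exp (-l)) * ∫⁻ ξ in Y, tilt ξ ∂P := by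
        rw [lintegral_add_left measurable_const, setLIntegral_const,
          lintegral_const_mul' _ _ ENNReal.ofReal_ne_top]
    _ ≤ ENNReal.ofReal (Real.exp 1) * ENNReal.ofReal (P.real Y) + ENNReal.ofReal (Real.exp (-l)) *
          ENNReal.ofReal (Real.exp (((1 + l) * ρ) ^ 2 / 2 * G.card)) := by
        rw [ofReal_measureReal]
        gcongr
        exact (setLIntegral_le_lintegral _ _).trans (lintegral_pi_prod_exp_raiseScore_le a _ G)
    _ = _ := by
        rw [← ENNReal.ofReal_mul (Real.exp_pos _).le, ← ENNReal.ofReal_mul (Real.exp_pos _).le,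
          ← ENNReal.ofReal_add (by positivity) (by positivity), ← Real.exp_add, neg_add_eq_sub]

theorem map_fst_pi_raiseCoupling (a : ℝ) {ρ : ℝ} (hρ0 : 0 ≤ ρ) (hρ1 : ρ ≤ 1) :
    (Measure.pi fun _ : ι => raiseCoupling D a ρ).map (fun ω i => (ω i).1) =
      Measure.pi fun _ => D := by
  have := isProbabilityMeasure_raiseCoupling D a hρ0 hρ1
  have hfst := map_fst_raiseCoupling D a hρ0 hρ1
  have : ∀ _ : ι, SigmaFinite ((raiseCoupling D a ρ).map Prod.fst) :=
    fun _ => by rw [hfst]; infer_instance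
  have hmap := Measure.pi_map_pi (μ := fun _ : ι => raiseCoupling D a ρ) (f := fun _ => Prod.fst)
    fun _ => measurable_fst.aemeasurable
  simpa only [hfst] using hmap

theorem map_raisedOn_pi_raiseCoupling (a : ℝ) {ρ : ℝ} (hρ0 : 0 ≤ ρ) (hρ1 : ρ ≤ 1)
    (G : Finset ι) :
    (Measure.pi fun _ : ι => raiseCoupling D a ρ).map (raisedOn G) =
      (Measure.pi fun _ : ι => D).withDensity fun ξ =>
        ∏ i ∈ G, ENNReal.ofReal (1 + ρ * raiseScore D a (ξ i)) := by
  classical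
  set κ := raiseCoupling D a ρ
  have : IsProbabilityMeasure κ := isProbabilityMeasure_raiseCoupling D a hρ0 hρ1
  let proj : ι → ℝ × ℝ → ℝ := fun i => if i ∈ G then Prod.snd else Prod.fst
  let density : ι → ℝ → ℝ≥0∞ := fun i x =>
    if i ∈ G then ENNReal.ofReal (1 + ρ * raiseScore D a x) else 1
  have hproj : ∀ i, Measurable (proj i) := fun i => by
    by_cases hi : i ∈ G <;> simp only [proj, hi, if_true, if_false] <;> fun_prop
  have hdensity : ∀ i, Measurable (density i) := fun i => by
    have := measurable_raiseScore D a
    by_cases hi : i ∈ G <;> simp only [density, hi, if_true, if_false] <;> fun_prop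
  have hmap : ∀ i, κ.map (proj i) = D.withDensity (density i) := fun i => by
    by_cases hi : i ∈ G
    · simp only [proj, density, hi, if_true]
      exact map_snd_raiseCoupling D a hρ0 hρ1
    · simp only [proj, density, hi, if_false]
      exact (map_fst_raiseCoupling D a hρ0 hρ1).trans withDensity_one.symm
  have hprob : ∀ i, IsProbabilityMeasure (κ.map (proj i)) := fun i =>
    Measure.isProbabilityMeasure_map (hproj i).aemeasurable
  have hprob' : ∀ i, IsProbabilityMeasure (D.withDensity (density i)) := fun i => hmap i ▸ hprob i
  have hpi := Measure.pi_map_pi (μ := fun _ : ι => κ) fun i => (hproj i).aemeasurable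
  simp only [hmap, pi_withDensity (fun _ : ι => D) hdensity] at hpi
  simp only [density, Finset.prod_ite_mem, Finset.univ_inter] at hpi
  rw [← hpi]
  congr 1
  ext ω i
  by_cases hi : i ∈ G <;> simp only [raisedOn, proj, hi, if_true, if_false]

theorem ae_fst_le_snd_pi_raiseCoupling (a : ℝ) {ρ : ℝ} (hρ0 : 0 ≤ ρ) (hρ1 : ρ ≤ 1) :
    ∀ᵐ ω ∂Measure.pi (fun _ : ι => raiseCoupling D a ρ), ∀ i, (ω i).1 ≤ (ω i).2 := by
  have := isProbabilityMeasure_raiseCoupling D a hρ0 hρ1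
  exact ae_all_iff.2 fun i =>
    (Measure.quasiMeasurePreserving_eval (fun _ : ι => raiseCoupling D a ρ) i).ae
      (ae_fst_le_snd_raiseCoupling D a)

theorem pi_raiseCoupling_sum_sub_le (a t : ℝ) {ρ : ℝ} (hρ0 : 0 ≤ ρ) (hρ1 : ρ ≤ 1)
    (H : Finset ι) :
    (Measure.pi fun _ : ι => raiseCoupling D a ρ) {ω | ∑ i ∈ H, ((ω i).2 - (ω i).1) ≤ t} ≤
      ENNReal.ofReal
        (Real.exp (t - ρ * (D.real (Iic a) * D.real (Ici (a + 1))) / 2 * H.card)) := by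
  set κ := raiseCoupling D a ρ
  set q := ρ * (D.real (Iic a) * D.real (Ici (a + 1)))
  have : IsProbabilityMeasure κ := isProbabilityMeasure_raiseCoupling D a hρ0 hρ1
  set Q := Measure.pi fun _ : ι => κ
  set Φ : ℝ × ℝ → ℝ≥0∞ := fun p => ENNReal.ofReal (Real.exp (-(p.2 - p.1)))
  have hΦ : Measurable Φ := by fun_prop
  have hprod : ∀ ω : ι → ℝ × ℝ, ENNReal.ofReal (Real.exp t) * ∏ i ∈ H, Φ (ω i) =
      ENNReal.ofReal (Real.exp (t - ∑ i ∈ H, ((ω i).2 - (ω i).1))) := fun ω => by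
    rw [← ENNReal.ofReal_prod_of_nonneg fun i _ => (Real.exp_pos _).le, ← Real.exp_sum,
      ← ENNReal.ofReal_mul (Real.exp_pos _).le, ← Real.exp_add, Finset.sum_neg_distrib,
      sub_eq_add_neg]
  calc Q {ω | ∑ i ∈ H, ((ω i).2 - (ω i).1) ≤ t}
      = Q {ω | 1 ≤ ENNReal.ofReal (Real.exp t) * ∏ i ∈ H, Φ (ω i)} := by
        simp only [hprod, ENNReal.one_le_ofReal, Real.one_le_exp_iff, sub_nonneg]
    _ ≤ ∫⁻ ω, ENNReal.ofReal (Real.exp t) * ∏ i ∈ H, Φ (ω i) ∂Q := by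
        refine le_trans (le_of_eq (one_mul _).symm) (mul_meas_ge_le_lintegral ?_ 1)
        exact (Finset.measurable_prod _ fun i _ => hΦ.comp (measurable_pi_apply i)).const_mul _
    _ = ENNReal.ofReal (Real.exp t) * (∫⁻ p, Φ p ∂κ) ^ H.card := by
        rw [lintegral_const_mul' _ _ ENNReal.ofReal_ne_top, lintegral_pi_prod (fun _ => κ) H
          fun _ => hΦ, Finset.prod_const]
    _ ≤ ENNReal.ofReal (Real.exp t) * ENNReal.ofReal (Real.exp (-q / 2)) ^ H.card := by
        gcongr
        exact lintegral_exp_sub_raiseCoupling_le D a hρ0 hρ1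
    _ = ENNReal.ofReal (Real.exp (t - q / 2 * H.card)) := by
        rw [← ENNReal.ofReal_pow (Real.exp_pos _).le, ← Real.exp_nat_mul,
          ← ENNReal.ofReal_mul (Real.exp_pos _).le, ← Real.exp_add]
        congr 2
        ring

theorem pi_real_le_of_raise {β : Type*} (a : ℝ) {ρ l t h : ℝ} (hρ0 : 0 ≤ ρ) (hρ1 : ρ ≤ 1)
    (hl : 0 ≤ l) (G : Finset ι) (ℬ : Finset β) (H : β → Finset ι)
    (hH : ∀ B ∈ ℬ, h ≤ (H B).card) (hHG : ∀ B ∈ ℬ, H B ⊆ G)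
    {X Y : Set (ι → ℝ)} (hX : MeasurableSet X) (hY : MeasurableSet Y)
    (hXY : ∀ ξ ξ' : ι → ℝ, (∀ i, ξ i ≤ ξ' i) → (∀ i ∉ G, ξ' i = ξ i) → ξ ∈ X →
      (∀ B ∈ ℬ, t < ∑ i ∈ H B, (ξ' i - ξ i)) → ξ' ∈ Y) :
    (Measure.pi fun _ : ι => D).real X ≤
      Real.exp 1 * (Measure.pi fun _ : ι => D).real Y +
      Real.exp (((1 + l) * ρ) ^ 2 / 2 * G.card - l) +
      ℬ.card * Real.exp (t - ρ * (D.real (Iic a) * D.real (Ici (a + 1))) / 2 * h) := by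
  set P := Measure.pi fun _ : ι => D
  set q := ρ * (D.real (Iic a) * D.real (Ici (a + 1)))
  set Q := Measure.pi fun _ : ι => raiseCoupling D a ρ
  set stuck : β → Set (ι → ℝ × ℝ) := fun B => {ω | ∑ i ∈ H B, ((ω i).2 - (ω i).1) ≤ t}
  have hq : 0 ≤ q := by positivity
  have hstuck : ∀ B ∈ ℬ, Q (stuck B) ≤ ENNReal.ofReal (Real.exp (t - q / 2 * h)) := fun B hB =>
    (pi_raiseCoupling_sum_sub_le a t hρ0 hρ1 (H B)).trans
      (ENNReal.ofReal_le_ofReal (Real.exp_le_exp.2 (by gcongr; exact hH B hB)))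
  have hcover : Q ((fun ω i => (ω i).1) ⁻¹' X) ≤ Q (raisedOn G ⁻¹' Y ∪ ⋃ B ∈ ℬ, stuck B) := by
    refine measure_mono_ae ?_
    filter_upwards [ae_fst_le_snd_pi_raiseCoupling a hρ0 hρ1] with ω hω hωX
    by_cases hB : ∃ B ∈ ℬ, ω ∈ stuck B
    · exact Or.inr (by simpa using hB)
    · push Not at hB
      refine Or.inl (hXY _ _ (fun i => ?_) (fun i hi => if_neg hi) hωX fun B hBℬ => ?_)
      · by_cases hi : i ∈ G <;> simp only [raisedOn, hi, if_true, if_false, le_refl, hω i]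
      · refine (not_le.1 (hB B hBℬ)).trans_eq (Finset.sum_congr rfl fun i hi => ?_)
        simp only [raisedOn, hHG B hBℬ hi, if_true]
  refine ENNReal.toReal_le_of_le_ofReal (by positivity) ?_
  calc P X = Q ((fun ω i => (ω i).1) ⁻¹' X) := by
        rw [← Measure.map_apply (by fun_prop) hX, map_fst_pi_raiseCoupling a hρ0 hρ1]
    _ ≤ Q (raisedOn G ⁻¹' Y) + ∑ B ∈ ℬ, Q (stuck B) :=
        hcover.trans ((measure_union_le _ _).trans
          (by gcongr; exact measure_biUnion_finset_le _ _))
    _ ≤ ENNReal.ofReal (Real.exp 1 * P.real Y +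
          Real.exp (((1 + l) * ρ) ^ 2 / 2 * G.card - l)) +
        ℬ.card • ENNReal.ofReal (Real.exp (t - q / 2 * h)) := by
        refine add_le_add ?_ (Finset.sum_le_card_nsmul _ _ _ hstuck)
        rw [← Measure.map_apply (measurable_raisedOn G) hY,
          map_raisedOn_pi_raiseCoupling a hρ0 hρ1]
        exact pi_withDensity_raiseScore_le a hl G hY
    _ = _ := by
        rw [nsmul_eq_mul, ← ENNReal.ofReal_natCast, ← ENNReal.ofReal_mul (Nat.cast_nonneg _),
          ← ENNReal.ofReal_add (by positivity) (by positivity)]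

end CouplingComparison

section Selection

theorem mul_one_sub_lt_of_mul_lt_mul {θ η M M' w : ℝ} (hθ : 0 < θ) (hM : 0 < M)
    (hw : 0 ≤ w) (hMM' : (1 - η) * M' ≤ M) (h : θ * M < w * M') : θ * (1 - η) < w := by
  have hM' : 0 < M' := pos_of_mul_pos_right ((mul_pos hθ hM).trans h) hw
  refine lt_of_mul_lt_mul_right (lt_of_le_of_lt ?_ h) hM'.le
  rw [mul_assoc]
  exact mul_le_mul_of_nonneg_left hMM' hθ.le

theorem dependsOn_update {ι α : Type*} [DecidableEq ι] (T : ι) (a : α) :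
    DependsOn (fun ξ : ι → α => Function.update ξ T a) {T}ᶜ := fun ξ ξ' h => by
  ext T'
  by_cases hT' : T' = T
  · simp only [hT', Function.update_self]
  · simp only [Function.update_of_ne hT', h T' hT']

/-- Candidates `A ∈ 𝒜`, each with a set `Nb A` of `m` weighted neighbors (all contained in `𝒯`),
such that distinct candidates share few neighbors, the weights are at most `W`, and some candidate
has average weight at least `W - v`. -/
structure SelectionSystem (ι β : Type*) [DecidableEq ι] where
  𝒜 : Finset β
  Nb : β → Finset ι
  w : ι → ℝ
  m : ℕ
  W : ℝ
  v : ℝ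
  𝒯 : Finset ι
  card_Nb : ∀ A ∈ 𝒜, (Nb A).card = m
  card_inter : ∀ A ∈ 𝒜, ∀ B ∈ 𝒜, A ≠ B → 4 * (Nb A ∩ Nb B).card ≤ m
  Nb_subset : ∀ A ∈ 𝒜, Nb A ⊆ 𝒯
  m_pos : 0 < m
  w_nonneg : ∀ T, 0 ≤ w T
  w_le : ∀ A ∈ 𝒜, ∀ T ∈ Nb A, w T ≤ W
  W_pos : 0 < W
  v_nonneg : 0 ≤ v
  v_le : v ≤ W / 8
  exists_le_sum : ∃ A ∈ 𝒜, m * (W - v) ≤ ∑ T ∈ Nb A, w T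

namespace SelectionSystem

variable {ι β : Type*} [DecidableEq ι] (s : SelectionSystem ι β)

/-- The noisy total weight of the neighbors of `A`. -/
def total (A : β) (ξ : ι → ℝ) : ℝ := ∑ T ∈ s.Nb A, ξ T * s.w T

/-- Noise vectors for which `A` maximizes the noisy total up to `Δ`. -/
def nearMax (A : β) (Δ : ℝ) : Set (ι → ℝ) := {ξ | ∀ B ∈ s.𝒜, s.total B ξ ≤ s.total A ξ + Δ}

/-- Noise vectors for which `A` is the unique maximizer of the noisy total. -/
def strictMax (A : β) : Set (ι → ℝ) := {ξ | ∀ B ∈ s.𝒜, B ≠ A → s.total B ξ < s.total A ξ}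

/-- Noise vectors for which some noisy total is far from its mean, `μ` being the mean of the
multipliers. -/
def deviation (μ η : ℝ) : Set (ι → ℝ) :=
  {ξ | ∃ B ∈ s.𝒜, η * μ * s.m * s.W < |s.total B ξ - μ * ∑ T ∈ s.Nb B, s.w T|}

/-- Noise vectors for which some relevant multiplier exceeds `R` in absolute value. -/
def large (R : ℝ) : Set (ι → ℝ) := {ξ | ∃ T ∈ s.𝒯, R < |ξ T|}

/-- Noise vectors for which a maximizer of the noisy total has a neighbor whose multiplier exceeds
`M`. -/
def spike (M : ℝ) : Set (ι → ℝ) :=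
  {ξ | ∃ A ∈ s.𝒜, ξ ∈ s.nearMax A 0 ∧ ∃ T ∈ s.Nb A, M < ξ T}

/-- The bound on the probability of `deviation` obtained by truncating the multipliers at `R`;
`t` is the relative deviation times the mean of the multipliers. -/
noncomputable def deviationBound (D : Measure ℝ) (t R : ℝ) : ℝ :=
  s.𝒯.card * D.real {x | R < |x|} +
    s.𝒜.card * (2 * Real.exp (-(t ^ 2 * s.m / (8 * R ^ 2))))

theorem measurable_total (A : β) : Measurable (s.total A) := by
  unfold total
  fun_prop

theorem measurableSet_nearMax (A : β) (Δ : ℝ) : MeasurableSet (s.nearMax A Δ) := by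
  have hinter : s.nearMax A Δ = ⋂ B ∈ s.𝒜, {ξ | s.total B ξ ≤ s.total A ξ + Δ} := by
    ext
    simp [nearMax]
  rw [hinter]
  exact Finset.measurableSet_biInter _ fun B _ =>
    measurableSet_le (s.measurable_total B) ((s.measurable_total A).add_const _)

theorem measurableSet_strictMax (A : β) : MeasurableSet (s.strictMax A) := by
  have hinter : s.strictMax A = ⋂ B ∈ s.𝒜, ⋂ (_ : B ≠ A), {ξ | s.total B ξ < s.total A ξ} := by
    ext
    simp [strictMax]
  rw [hinter]
  exact Finset.measurableSet_biInter _ fun B _ => MeasurableSet.iInter fun _ =>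
    measurableSet_lt (s.measurable_total B) (s.measurable_total A)

theorem sum_w_nonneg (B : β) : 0 ≤ ∑ T ∈ s.Nb B, s.w T :=
  Finset.sum_nonneg fun T _ => s.w_nonneg T

theorem sum_w_le {B : β} (hB : B ∈ s.𝒜) : ∑ T ∈ s.Nb B, s.w T ≤ s.m * s.W := by
  simpa only [s.card_Nb B hB, nsmul_eq_mul] using
    Finset.sum_le_card_nsmul (s.Nb B) s.w s.W (s.w_le B hB)

theorem le_sum_of_mem_nearMax {μ η Δ : ℝ} (hμ : 0 < μ) {A : β} (hA : A ∈ s.𝒜) {ξ : ι → ℝ}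
    (hdev : ξ ∉ s.deviation μ η) (hξ : ξ ∈ s.nearMax A Δ) :
    s.m * (s.W - s.v - 2 * η * s.W) - Δ / μ ≤ ∑ T ∈ s.Nb A, s.w T := by
  obtain ⟨B, hB, hsum⟩ := s.exists_le_sum
  have hclose : ∀ C ∈ s.𝒜, |s.total C ξ - μ * ∑ T ∈ s.Nb C, s.w T| ≤ η * μ * s.m * s.W :=
    fun C hC => not_lt.1 fun hfar => hdev ⟨C, hC, hfar⟩
  refine le_of_mul_le_mul_left ?_ hμ
  calc μ * (s.m * (s.W - s.v - 2 * η * s.W) - Δ / μ)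
      = μ * (s.m * (s.W - s.v)) - 2 * (η * μ * s.m * s.W) - Δ := by
        field_simp
    _ ≤ s.total B ξ - η * μ * s.m * s.W - Δ := by
        linarith [mul_le_mul_of_nonneg_left hsum hμ.le, (abs_le.1 (hclose B hB)).1]
    _ ≤ s.total A ξ - η * μ * s.m * s.W := by linarith [hξ B hB]
    _ ≤ μ * ∑ T ∈ s.Nb A, s.w T := by linarith [(abs_le.1 (hclose A hA)).2]

/-- Neighbors of `A` with weight at least `θ`. -/
noncomputable def heavy (A : β) (θ : ℝ) : Finset ι := (s.Nb A).filter fun T => θ ≤ s.w T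

theorem mem_heavy {A : β} {θ : ℝ} {T : ι} : T ∈ s.heavy A θ ↔ T ∈ s.Nb A ∧ θ ≤ s.w T :=
  Finset.mem_filter

theorem heavy_subset (A : β) (θ : ℝ) : s.heavy A θ ⊆ s.Nb A := Finset.filter_subset _ _

theorem le_two_mul_card_heavy {A : β} (hA : A ∈ s.𝒜) {x : ℝ} (hx : 0 < x)
    (hsum : s.m * (s.W - x) ≤ ∑ T ∈ s.Nb A, s.w T) :
    (s.m : ℝ) ≤ 2 * (s.heavy A (s.W - 2 * x)).card := by
  have hupper : ∑ T ∈ s.Nb A, s.w T ≤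
      s.m * (s.W - 2 * x) + 2 * x * (s.heavy A (s.W - 2 * x)).card := by
    calc ∑ T ∈ s.Nb A, s.w T
        ≤ ∑ T ∈ s.Nb A, ((s.W - 2 * x) + 2 * x * if s.W - 2 * x ≤ s.w T then 1 else 0) := by
          refine Finset.sum_le_sum fun T hT => ?_
          have := s.w_le A hA T hT
          split_ifs <;> linarith
      _ = s.m * (s.W - 2 * x) + 2 * x * (s.heavy A (s.W - 2 * x)).card := by
          rw [Finset.sum_add_distrib, Finset.sum_const, s.card_Nb A hA, nsmul_eq_mul,
            ← Finset.mul_sum, Finset.sum_boole, heavy]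
  exact le_of_mul_le_mul_left (by linarith) hx

theorem le_card_heavy_sdiff {A B : β} {θ : ℝ} (hA : A ∈ s.𝒜) (hB : B ∈ s.𝒜) (hAB : A ≠ B)
    (hheavy : (s.m : ℝ) ≤ 2 * (s.heavy A θ).card) :
    (s.m / 4 : ℝ) ≤ (s.heavy A θ \ s.Nb B).card := by
  have hinter : 4 * (s.heavy A θ ∩ s.Nb B).card ≤ s.m :=
    (Nat.mul_le_mul_left 4 (Finset.card_le_card
      (Finset.inter_subset_inter_right (s.heavy_subset A θ)))).trans (s.card_inter A hA B hB hAB)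
  have hsplit := Finset.card_sdiff_add_card_inter (s.heavy A θ) (s.Nb B)
  have hinter' : (4 : ℝ) * (s.heavy A θ ∩ s.Nb B).card ≤ s.m := by exact_mod_cast hinter
  have hsplit' : ((s.heavy A θ \ s.Nb B).card : ℝ) + (s.heavy A θ ∩ s.Nb B).card =
      (s.heavy A θ).card := by exact_mod_cast hsplit
  linarith

theorem badSelection_subset {μ η M M' : ℝ} (hμ : 0 < μ) (hη : 0 < η) (hη1 : η ≤ 1 / 16)
    (hM : 0 < M) (hMM' : (1 - η) * M' ≤ M) :
    badSelection s.𝒜 s.Nb s.w (s.W - 2 * s.v - 6 * η * s.W) ⊆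
      s.deviation μ η ∪ s.spike M' ∪ ⋃ A ∈ s.𝒜.filter fun A =>
        (s.m : ℝ) ≤ 2 * (s.heavy A (s.W - 2 * (s.v + 2 * η * s.W))).card,
        {ξ | ∀ T ∈ s.heavy A (s.W - 2 * (s.v + 2 * η * s.W)), ξ T ∉ Ioi M} := by
  rintro ξ ⟨A, hA, hmax, T, hT, hTmax, hlt⟩
  by_cases hdev : ξ ∈ s.deviation μ η
  · exact Or.inl (Or.inl hdev)
  by_cases hspike : ξ ∈ s.spike M'
  · exact Or.inl (Or.inr hspike)
  right
  have hW := s.W_pos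
  have hv := s.v_le
  have hv0 := s.v_nonneg
  have hηW : 0 < η * s.W := mul_pos hη hW
  have hηW1 : η * s.W ≤ 1 / 16 * s.W := mul_le_mul_of_nonneg_right hη1 hW.le
  set θ := s.W - 2 * (s.v + 2 * η * s.W)
  have hθ0 : 0 < θ := by linarith
  have hnear : ξ ∈ s.nearMax A 0 := fun B hB => (add_zero (s.total A ξ)).symm ▸ hmax B hB
  have hsum := s.le_sum_of_mem_nearMax hμ hA hdev hnear
  rw [zero_div, sub_zero] at hsum
  have hheavy := s.le_two_mul_card_heavy hA (x := s.v + 2 * η * s.W) (by linarith)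
    (le_of_eq_of_le (by ring) hsum)
  simp only [mem_iUnion, exists_prop]
  refine ⟨A, Finset.mem_filter.2 ⟨hA, hheavy⟩, fun T' hT' (hgt : M < ξ T') => ?_⟩
  obtain ⟨hT'Nb, hT'w⟩ := s.mem_heavy.1 hT'
  have hTM : ξ T ≤ M' := not_lt.1 fun h => hspike ⟨A, hA, hnear, T, hT, h⟩
  have hproduct : θ * M < s.w T * M' := by
    calc θ * M < θ * ξ T' := mul_lt_mul_of_pos_left hgt hθ0
      _ ≤ s.w T' * ξ T' := mul_le_mul_of_nonneg_right hT'w (hM.trans hgt).le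
      _ ≤ s.w T * ξ T := by linarith [hTmax T' hT'Nb]
      _ ≤ s.w T * M' := mul_le_mul_of_nonneg_left hTM (s.w_nonneg T)
  have hwT := mul_one_sub_lt_of_mul_lt_mul hθ0 hM (s.w_nonneg T) hMM' hproduct
  have hθη : θ * η ≤ s.W * η := mul_le_mul_of_nonneg_right (by linarith) hη.le
  linarith

theorem deviation_subset {μ η R μR : ℝ} (hμ : 0 < μ) (hη : 0 < η)
    (hμR : |μR - μ| ≤ η * μ / 2) :
    s.deviation μ η ⊆ s.large R ∪ ⋃ B ∈ s.𝒜, {ξ | η * μ * s.m * s.W / 2 ≤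
      |∑ T ∈ s.Nb B, (s.w T * (Icc (-R) R).indicator id (ξ T) - s.w T * μR)|} := by
  rintro ξ ⟨B, hB, hfar⟩
  by_cases hlarge : ξ ∈ s.large R
  · exact Or.inl hlarge
  right
  simp only [mem_iUnion, exists_prop]
  refine ⟨B, hB, ?_⟩
  have hsmall : ∀ T ∈ s.Nb B, (Icc (-R) R).indicator id (ξ T) = ξ T := fun T hT =>
    indicator_of_mem (show ξ T ∈ Icc (-R) R from
      abs_le.1 (not_lt.1 fun h => hlarge ⟨T, s.Nb_subset B hB hT, h⟩)) id
  have hcenter : ∑ T ∈ s.Nb B, (s.w T * (Icc (-R) R).indicator id (ξ T) - s.w T * μR) =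
      (s.total B ξ - μ * ∑ T ∈ s.Nb B, s.w T) - (μR - μ) * ∑ T ∈ s.Nb B, s.w T := by
    rw [Finset.sum_sub_distrib, ← Finset.sum_mul, total,
      Finset.sum_congr rfl fun T hT => by rw [hsmall T hT, mul_comm]]
    ring
  have hbias : |(μR - μ) * ∑ T ∈ s.Nb B, s.w T| ≤ η * μ * s.m * s.W / 2 := by
    rw [abs_mul, abs_of_nonneg (s.sum_w_nonneg B)]
    calc |μR - μ| * ∑ T ∈ s.Nb B, s.w T ≤ η * μ / 2 * (s.m * s.W) :=
          mul_le_mul hμR (s.sum_w_le hB) (s.sum_w_nonneg B) (by positivity)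
      _ = η * μ * s.m * s.W / 2 := by ring
  rw [mem_ofPred_eq, hcenter]
  linarith [abs_sub_abs_le_abs_sub (s.total B ξ - μ * ∑ T ∈ s.Nb B, s.w T)
    ((μR - μ) * ∑ T ∈ s.Nb B, s.w T)]

theorem mem_strictMax_of_raise {A : β} {R : ℝ} {ξ ξ' : ι → ℝ} (hle : ∀ T, ξ T ≤ ξ' T)
    (hoff : ∀ T ∉ s.Nb A, ξ' T = ξ T) (hξ : ξ ∈ s.nearMax A (2 * s.W * R))
    (hsum : ∀ B ∈ s.𝒜, B ≠ A → 4 * R < ∑ T ∈ s.heavy A (s.W / 2) \ s.Nb B, (ξ' T - ξ T)) :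
    ξ' ∈ s.strictMax A := by
  intro B hB hBA
  set gain : ι → ℝ := fun T => (ξ' T - ξ T) * s.w T with hgain
  have hgain0 : ∀ T, 0 ≤ gain T := fun T => mul_nonneg (sub_nonneg.2 (hle T)) (s.w_nonneg T)
  have htotal : ∀ C, s.total C ξ' = s.total C ξ + ∑ T ∈ s.Nb C, gain T := fun C => by
    simp only [total, hgain, sub_mul, Finset.sum_sub_distrib]
    ring
  have hgainB : ∑ T ∈ s.Nb B, gain T = ∑ T ∈ s.Nb A ∩ s.Nb B, gain T := by
    refine (Finset.sum_subset Finset.inter_subset_right fun T hTB hT => ?_).symm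
    have hTA : T ∉ s.Nb A := fun hTA => hT (Finset.mem_inter.2 ⟨hTA, hTB⟩)
    simp only [hgain, hoff T hTA, sub_self, zero_mul]
  have hgainA : ∑ T ∈ s.Nb A \ s.Nb B, gain T + ∑ T ∈ s.Nb A ∩ s.Nb B, gain T =
      ∑ T ∈ s.Nb A, gain T := by
    rw [add_comm, Finset.sum_inter_add_sum_sdiff]
  have hraise : 2 * s.W * R < ∑ T ∈ s.Nb A \ s.Nb B, gain T := by
    calc 2 * s.W * R < (∑ T ∈ s.heavy A (s.W / 2) \ s.Nb B, (ξ' T - ξ T)) * (s.W / 2) := by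
          nlinarith [hsum B hB hBA, s.W_pos]
      _ ≤ ∑ T ∈ s.heavy A (s.W / 2) \ s.Nb B, gain T := by
          rw [Finset.sum_mul]
          exact Finset.sum_le_sum fun T hT => mul_le_mul_of_nonneg_left
            (s.mem_heavy.1 (Finset.mem_sdiff.1 hT).1).2 (sub_nonneg.2 (hle T))
      _ ≤ ∑ T ∈ s.Nb A \ s.Nb B, gain T :=
          Finset.sum_le_sum_of_subset_of_nonneg
            (Finset.sdiff_subset_sdiff (s.heavy_subset A _) subset_rfl) fun T _ _ => hgain0 T
  rw [htotal, htotal]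
  linarith [hξ B hB]

theorem nearMax_subset_deviation {μ η R : ℝ} (hμ : 0 < μ) (hη1 : η ≤ 1 / 32)
    (hRm : 32 * R ≤ μ * s.m) {A : β} (hA : A ∈ s.𝒜)
    (hheavy : 2 * (s.heavy A (s.W / 2)).card < (s.m : ℝ)) :
    s.nearMax A (2 * s.W * R) ⊆ s.deviation μ η := by
  intro ξ hξ
  by_contra hdev
  have hW := s.W_pos
  have hm : (0 : ℝ) ≤ s.m := s.m.cast_nonneg
  have hslack : 2 * s.W * R / μ ≤ s.m * (s.W / 16) := by
    rw [div_le_iff₀ hμ]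
    linarith [mul_le_mul_of_nonneg_left hRm (by positivity : 0 ≤ s.W / 16)]
  have hηW : s.m * (η * s.W) ≤ s.m * (1 / 32 * s.W) := by gcongr
  have hv : s.m * s.v ≤ s.m * (s.W / 8) := mul_le_mul_of_nonneg_left s.v_le hm
  have hsum : s.m * (s.W - s.W / 4) ≤ ∑ T ∈ s.Nb A, s.w T := by
    linarith [s.le_sum_of_mem_nearMax hμ hA hdev hξ]
  have hcard := s.le_two_mul_card_heavy hA (by positivity : 0 < s.W / 4) hsum
  rw [show s.W - 2 * (s.W / 4) = s.W / 2 by ring] at hcard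
  exact hheavy.not_ge hcard

theorem total_eq_total_update_add (B : β) (T : ι) (ξ : ι → ℝ) :
    s.total B ξ = s.total B (Function.update ξ T 0) + if T ∈ s.Nb B then ξ T * s.w T else 0 := by
  have hterm : ∀ T' ∈ s.Nb B, ξ T' * s.w T' =
      Function.update ξ T 0 T' * s.w T' + if T = T' then ξ T * s.w T else 0 := by
    intro T' _
    by_cases h : T = T'
    · subst h
      simp
    · rw [Function.update_of_ne (Ne.symm h), if_neg h, add_zero]
  rw [total, total, Finset.sum_congr rfl hterm, Finset.sum_add_distrib, Finset.sum_ite_eq]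

theorem update_mem_nearMax {A : β} (hA : A ∈ s.𝒜) {T : ι} (hT : T ∈ s.Nb A) {R : ℝ}
    {ξ : ι → ℝ} (hξ : ξ ∈ s.nearMax A 0) (hξ0 : 0 ≤ ξ T) (hξR : ξ T ≤ R) :
    Function.update ξ T 0 ∈ s.nearMax A (s.W * R) := by
  intro B hB
  have hmax := hξ B hB
  rw [s.total_eq_total_update_add B T, s.total_eq_total_update_add A T, if_pos hT] at hmax
  have hterm : ξ T * s.w T ≤ R * s.W :=
    mul_le_mul hξR (s.w_le A hA T hT) (s.w_nonneg T) (hξ0.trans hξR)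
  have hterm0 : 0 ≤ if T ∈ s.Nb B then ξ T * s.w T else 0 := by
    have := mul_nonneg hξ0 (s.w_nonneg T)
    split_ifs <;> simp [this]
  linarith

theorem mem_nearMax_of_update_mem {A : β} (hA : A ∈ s.𝒜) {T : ι} (hT : T ∈ s.Nb A) {R : ℝ}
    {ξ : ι → ℝ} (hξR : |ξ T| ≤ R) (hξ : Function.update ξ T 0 ∈ s.nearMax A (s.W * R)) :
    ξ ∈ s.nearMax A (2 * s.W * R) := by
  intro B hB
  have hterm : |ξ T * s.w T| ≤ R * s.W := by
    rw [abs_mul, abs_of_nonneg (s.w_nonneg T)]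
    exact mul_le_mul hξR (s.w_le A hA T hT) (s.w_nonneg T) ((abs_nonneg _).trans hξR)
  have hbounds := abs_le.1 hterm
  rw [s.total_eq_total_update_add B T, s.total_eq_total_update_add A T, if_pos hT]
  have := hξ B hB
  split_ifs <;> linarith [abs_nonneg (ξ T * s.w T)]

theorem spike_subset (R M : ℝ) : s.spike M ⊆ s.large R ∪
    ⋃ A ∈ s.𝒜, ⋃ T ∈ s.Nb A, s.nearMax A 0 ∩ {ξ | M < ξ T ∧ |ξ T| ≤ R} := by
  rintro ξ ⟨A, hA, hmax, T, hT, hMT⟩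
  by_cases hlarge : ξ ∈ s.large R
  · exact Or.inl hlarge
  · have hTR : |ξ T| ≤ R := not_lt.1 fun h => hlarge ⟨T, s.Nb_subset A hA hT, h⟩
    exact Or.inr (mem_biUnion hA (mem_biUnion hT ⟨hmax, hMT, hTR⟩))

variable [Fintype ι] {D : Measure ℝ} [IsProbabilityMeasure D]

theorem real_large_le (R : ℝ) : (Measure.pi fun _ : ι => D).real (s.large R) ≤
    s.𝒯.card * D.real {x | R < |x|} :=
  pi_real_exists_mem_le D (measurableSet_lt measurable_const measurable_id.abs) s.𝒯

theorem real_deviation_le {μ η R : ℝ} (hμ : 0 < μ) (hη : 0 < η) (hR : 0 < R)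
    (hμR : |∫ x in Icc (-R) R, x ∂D - μ| ≤ η * μ / 2) :
    (Measure.pi fun _ : ι => D).real (s.deviation μ η) ≤ s.deviationBound D (η * μ) R := by
  set P := Measure.pi fun _ : ι => D
  set t := η * μ * s.m * s.W / 2 with ht
  have hW := s.W_pos
  have hm : (0 : ℝ) < s.m := by exact_mod_cast s.m_pos
  set truncated : ι → ℝ → ℝ := fun T x => s.w T * (Icc (-R) R).indicator id x
  have hmeas : ∀ T, Measurable (truncated T) := fun T =>
    (measurable_id.indicator measurableSet_Icc).const_mul _
  have hmean : ∀ T, ∫ x, truncated T x ∂D = s.w T * ∫ x in Icc (-R) R, x ∂D := fun T => by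
    rw [integral_const_mul, integral_indicator measurableSet_Icc]
    rfl
  have hbound : ∀ B ∈ s.𝒜, ∀ T ∈ s.Nb B, ∀ x, |truncated T x| ≤ s.W * R := fun B hB T hT x => by
    rw [abs_mul, abs_of_nonneg (s.w_nonneg T)]
    refine mul_le_mul (s.w_le B hB T hT) ?_ (abs_nonneg _) hW.le
    by_cases hx : x ∈ Icc (-R) R
    · rw [indicator_of_mem hx]
      exact abs_le.2 hx
    · rw [indicator_of_notMem hx, abs_zero]
      exact hR.le
  have hhoeffding : ∀ B ∈ s.𝒜,
      P.real {ξ | t ≤ |∑ T ∈ s.Nb B, (truncated T (ξ T) - s.w T * ∫ x in Icc (-R) R, x ∂D)|} ≤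
        2 * Real.exp (-((η * μ) ^ 2 * s.m / (8 * R ^ 2))) := fun B hB => by
    simp only [← hmean]
    refine (pi_real_abs_sum_sub_integral_ge_le (fun _ => D) hmeas (s.Nb B) (hbound B hB)
      (by positivity)).trans_eq ?_
    rw [s.card_Nb B hB, ht]
    congr 2
    field_simp
    ring
  refine (measureReal_mono (s.deviation_subset hμ hη hμR)).trans
    ((measureReal_union_le _ _).trans (add_le_add (s.real_large_le R) ?_))
  rw [← nsmul_eq_mul]
  exact (measureReal_biUnion_finset_le _ _).trans (Finset.sum_le_card_nsmul _ _ _ hhoeffding)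

theorem real_nearMax_le_of_heavy {R a ρ l : ℝ} (hρ0 : 0 ≤ ρ) (hρ1 : ρ ≤ 1) (hl : 0 ≤ l) {A : β}
    (hA : A ∈ s.𝒜) (hheavy : (s.m : ℝ) ≤ 2 * (s.heavy A (s.W / 2)).card) :
    (Measure.pi fun _ : ι => D).real (s.nearMax A (2 * s.W * R)) ≤
      Real.exp 1 * (Measure.pi fun _ : ι => D).real (s.strictMax A) +
      Real.exp (((1 + l) * ρ) ^ 2 / 2 * s.m - l) +
      s.𝒜.card *
        Real.exp (4 * R - ρ * (D.real (Iic a) * D.real (Ici (a + 1))) / 2 * (s.m / 4)) := by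
  classical
  have hraise := pi_real_le_of_raise (D := D) a hρ0 hρ1 hl (s.Nb A) (s.𝒜.erase A)
    (fun B => s.heavy A (s.W / 2) \ s.Nb B) (h := s.m / 4) (t := 4 * R)
    (fun B hB => s.le_card_heavy_sdiff hA (Finset.mem_of_mem_erase hB)
      (Finset.ne_of_mem_erase hB).symm hheavy)
    (fun B _ => Finset.sdiff_subset.trans (s.heavy_subset A _))
    (s.measurableSet_nearMax A (2 * s.W * R)) (s.measurableSet_strictMax A)
    (fun ξ ξ' hle hoff hξ hsum => s.mem_strictMax_of_raise hle hoff hξ fun B hB hBA =>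
      hsum B (Finset.mem_erase.2 ⟨hBA, hB⟩))
  rw [s.card_Nb A hA] at hraise
  refine hraise.trans (add_le_add le_rfl (mul_le_mul_of_nonneg_right ?_ (Real.exp_pos _).le))
  exact_mod_cast Finset.card_le_card (Finset.erase_subset A s.𝒜)

theorem real_nearMax_le {μ η R a ρ l : ℝ} (hμ : 0 < μ) (hη : 0 < η) (hη1 : η ≤ 1 / 32)
    (hR : 0 < R) (hμR : |∫ x in Icc (-R) R, x ∂D - μ| ≤ η * μ / 2) (hRm : 32 * R ≤ μ * s.m)
    (hρ0 : 0 ≤ ρ) (hρ1 : ρ ≤ 1) (hl : 0 ≤ l) {A : β} (hA : A ∈ s.𝒜) :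
    (Measure.pi fun _ : ι => D).real (s.nearMax A (2 * s.W * R)) ≤
      Real.exp 1 * (Measure.pi fun _ : ι => D).real (s.strictMax A) +
      (Real.exp (((1 + l) * ρ) ^ 2 / 2 * s.m - l) +
      s.𝒜.card *
        Real.exp (4 * R - ρ * (D.real (Iic a) * D.real (Ici (a + 1))) / 2 * (s.m / 4)) +
      s.deviationBound D (η * μ) R) := by
  have hdev := s.real_deviation_le (D := D) hμ hη hR hμR
  have hdev0 : 0 ≤ (Measure.pi fun _ : ι => D).real (s.deviation μ η) := measureReal_nonneg
  rcases le_or_gt (s.m : ℝ) (2 * (s.heavy A (s.W / 2)).card) with hheavy | hheavy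
  · linarith [s.real_nearMax_le_of_heavy (D := D) (R := R) (a := a) hρ0 hρ1 hl hA hheavy]
  · have hnear := measureReal_mono (μ := Measure.pi fun _ : ι => D)
      (s.nearMax_subset_deviation hμ hη1 hRm hA hheavy)
    refine (hnear.trans hdev).trans (le_add_of_nonneg_of_le (by positivity) ?_)
    exact le_add_of_nonneg_left (by positivity)

theorem sum_real_strictMax_le :
    ∑ A ∈ s.𝒜, (Measure.pi fun _ : ι => D).real (s.strictMax A) ≤ 1 := by
  rw [← measureReal_biUnion_finset]
  · exact measureReal_le_one
  · intro A hA B hB hAB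
    exact Set.disjoint_left.2 fun ξ hξA hξB => lt_asymm (hξA B hB hAB.symm) (hξB A hA hAB)
  · exact fun A _ => s.measurableSet_strictMax A

theorem real_nearMax_inter_le {R M : ℝ} (hM : 0 ≤ M) {A : β} (hA : A ∈ s.𝒜) {T : ι}
    (hT : T ∈ s.Nb A) :
    (Measure.pi fun _ : ι => D).real (s.nearMax A 0 ∩ {ξ | M < ξ T ∧ |ξ T| ≤ R}) ≤
    D.real (Ioi M) * ((Measure.pi fun _ : ι => D).real (s.nearMax A (2 * s.W * R)) +
      D.real {x | R < |x|}) := by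
  set P := Measure.pi fun _ : ι => D
  -- Resetting `ξ T` to `0` decouples the two events at the cost of a slack in the maximality.
  set X : Set (ι → ℝ) := {ξ | ξ T ∈ Ioi M}
  set Y : Set (ι → ℝ) := {ξ | Function.update ξ T 0 ∈ s.nearMax A (s.W * R)}
  have hsub : s.nearMax A 0 ∩ {ξ | M < ξ T ∧ |ξ T| ≤ R} ⊆ X ∩ Y :=
    fun ξ ⟨hmax, hMξ, hR⟩ => ⟨hMξ, s.update_mem_nearMax hA hT hmax (hM.trans hMξ.le)
      ((le_abs_self _).trans hR)⟩
  have hYsub : Y ⊆ s.nearMax A (2 * s.W * R) ∪ {ξ | ξ T ∈ {x | R < |x|}} := fun ξ hξ =>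
    (le_or_gt |ξ T| R).imp (fun hR => s.mem_nearMax_of_update_mem hA hT hR hξ) id
  have hX : DependsOn (· ∈ X) (({T} : Finset ι) : Set ι) := fun ξ ξ' h => by
    simp only [X, mem_ofPred_eq, h T (by simp)]
  have hY : DependsOn (· ∈ Y) ((({T} : Finset ι)ᶜ : Finset ι) : Set ι) := fun ξ ξ' h => by
    simp only [Y, mem_ofPred_eq, dependsOn_update T (0 : ℝ) (by simpa using h)]
  have hXmeas : MeasurableSet X := measurable_pi_apply T measurableSet_Ioi
  have hYmeas : MeasurableSet Y := measurable_update_left (s.measurableSet_nearMax A _)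
  have htail : MeasurableSet {x : ℝ | R < |x|} :=
    measurableSet_lt measurable_const measurable_id.abs
  calc P.real (s.nearMax A 0 ∩ {ξ | M < ξ T ∧ |ξ T| ≤ R}) ≤ P.real (X ∩ Y) :=
        measureReal_mono hsub
    _ = D.real (Ioi M) * P.real Y := by
        rw [pi_real_inter_eq_mul (fun _ => D) {T} hXmeas hYmeas hX hY,
          pi_real_eval_preimage (fun _ => D) T measurableSet_Ioi]
    _ ≤ D.real (Ioi M) * (P.real (s.nearMax A (2 * s.W * R)) + D.real {x | R < |x|}) := by
        gcongr
        refine (measureReal_mono hYsub).trans ((measureReal_union_le _ _).trans_eq ?_)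
        rw [pi_real_eval_preimage (fun _ => D) T htail]

theorem real_spike_le {R M E : ℝ} (hM : 0 ≤ M)
    (hE : ∀ A ∈ s.𝒜, (Measure.pi fun _ : ι => D).real (s.nearMax A (2 * s.W * R)) ≤
      Real.exp 1 * (Measure.pi fun _ : ι => D).real (s.strictMax A) + E) :
    (Measure.pi fun _ : ι => D).real (s.spike M) ≤ s.𝒯.card * D.real {x | R < |x|} +
      s.m * D.real (Ioi M) * (Real.exp 1 + s.𝒜.card * (E + D.real {x | R < |x|})) := by
  set P := Measure.pi fun _ : ι => D
  set tail := D.real {x | R < |x|}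
  have hcandidate : ∀ A ∈ s.𝒜,
      P.real (⋃ T ∈ s.Nb A, s.nearMax A 0 ∩ {ξ | M < ξ T ∧ |ξ T| ≤ R}) ≤
        s.m * D.real (Ioi M) * (Real.exp 1 * P.real (s.strictMax A) + (E + tail)) := by
    intro A hA
    refine (measureReal_biUnion_finset_le _ _).trans ((Finset.sum_le_card_nsmul _ _ _ fun T hT =>
      s.real_nearMax_inter_le hM hA hT).trans ?_)
    rw [s.card_Nb A hA, nsmul_eq_mul, ← mul_assoc]
    exact mul_le_mul_of_nonneg_left (by linarith [hE A hA]) (by positivity)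
  refine (measureReal_mono (s.spike_subset R M)).trans
    ((measureReal_union_le _ _).trans (add_le_add (s.real_large_le R) ?_))
  calc P.real (⋃ A ∈ s.𝒜, ⋃ T ∈ s.Nb A, s.nearMax A 0 ∩ {ξ | M < ξ T ∧ |ξ T| ≤ R})
      ≤ ∑ A ∈ s.𝒜, s.m * D.real (Ioi M) *
          (Real.exp 1 * P.real (s.strictMax A) + (E + tail)) :=
        (measureReal_biUnion_finset_le _ _).trans (Finset.sum_le_sum hcandidate)
    _ = s.m * D.real (Ioi M) * (Real.exp 1 * ∑ A ∈ s.𝒜, P.real (s.strictMax A) +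
          s.𝒜.card * (E + tail)) := by
        rw [← Finset.mul_sum, Finset.sum_add_distrib, ← Finset.mul_sum, Finset.sum_const,
          nsmul_eq_mul]
    _ ≤ s.m * D.real (Ioi M) * (Real.exp 1 + s.𝒜.card * (E + tail)) := by
        gcongr
        exact mul_le_of_le_one_right (Real.exp_pos 1).le s.sum_real_strictMax_le

theorem real_spike_eq_zero {M : ℝ} (hM : D.real (Ioi M) = 0) :
    (Measure.pi fun _ : ι => D).real (s.spike M) = 0 := by
  have hsub : s.spike M ⊆ {ξ | ∃ T ∈ s.𝒯, ξ T ∈ Ioi M} := fun ξ ⟨A, hA, _, T, hT, hMT⟩ =>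
    ⟨T, s.Nb_subset A hA hT, hMT⟩
  have hle := (measureReal_mono hsub).trans (pi_real_exists_mem_le D measurableSet_Ioi s.𝒯)
  rw [hM, mul_zero] at hle
  exact le_antisymm hle measureReal_nonneg

theorem real_badSelection_le {μ η R M M' σ : ℝ} (hμ : 0 < μ) (hη : 0 < η) (hη1 : η ≤ 1 / 16)
    (hR : 0 < R) (hμR : |∫ x in Icc (-R) R, x ∂D - μ| ≤ η * μ / 2)
    (hM : 0 < M) (hMM' : (1 - η) * M' ≤ M)
    (hσ : (Measure.pi fun _ : ι => D).real (s.spike M') ≤ σ) :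
    (Measure.pi fun _ : ι => D).real
      (badSelection s.𝒜 s.Nb s.w (s.W - 2 * s.v - 6 * η * s.W)) ≤
    s.deviationBound D (η * μ) R + σ +
      s.𝒜.card * Real.exp (-(D.real (Ioi M) * (s.m / 2))) := by
  set θ := s.W - 2 * (s.v + 2 * η * s.W)
  refine (measureReal_mono (s.badSelection_subset hμ hη hη1 hM hMM')).trans
    ((measureReal_union_le _ _).trans (add_le_add ((measureReal_union_le _ _).trans
      (add_le_add (s.real_deviation_le hμ hη hR hμR) hσ)) ?_))
  have hlow : ∀ A ∈ s.𝒜.filter fun A => (s.m : ℝ) ≤ 2 * (s.heavy A θ).card,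
      (Measure.pi fun _ : ι => D).real {ξ | ∀ T ∈ s.heavy A θ, ξ T ∉ Ioi M} ≤
        Real.exp (-(D.real (Ioi M) * (s.m / 2))) := fun A hA => by
    refine (pi_real_forall_notMem_le D measurableSet_Ioi _).trans (Real.exp_le_exp.2 ?_)
    gcongr
    linarith [(Finset.mem_filter.1 hA).2]
  refine (measureReal_biUnion_finset_le _ _).trans ((Finset.sum_le_card_nsmul _ _ _ hlow).trans ?_)
  rw [nsmul_eq_mul]
  gcongr
  exact Finset.filter_subset _ _

end SelectionSystem

end Selection

section Tail

open scoped ENNReal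

variable {D : Measure ℝ}

theorem lintegral_Ioi_mul_left {r : ℝ} (hr : 0 < r) (x : ℝ) (F : ℝ → ℝ≥0∞) :
    ∫⁻ z in Ioi (r * x), F z = ENNReal.ofReal r * ∫⁻ y in Ioi x, F (r * y) := by
  have hchange := lintegral_image_eq_lintegral_abs_deriv_mul (s := Ioi x) (f := fun y => r * y)
    (f' := fun _ => r) measurableSet_Ioi
    (fun y _ => by simpa using ((hasDerivAt_id y).const_mul r).hasDerivWithinAt)
    (fun y _ z _ h => mul_left_cancel₀ hr.ne' h) F
  rw [image_mul_left_Ioi hr] at hchange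
  rw [hchange, lintegral_const_mul' _ _ ENNReal.ofReal_ne_top, abs_of_pos hr]

theorem measure_eq_lintegral_of_restrict_eq {S s : Set ℝ} {F : ℝ → ℝ≥0∞}
    (h : D.restrict S = (volume.restrict S).withDensity F) (hs : MeasurableSet s) (hsS : s ⊆ S) :
    D s = ∫⁻ x in s, F x := by
  rw [← Measure.restrict_eq_self D hsS, h, withDensity_apply _ hs, Measure.restrict_restrict hs,
    inter_eq_left.2 hsS]

theorem mul_sub_le_real_Ioc_of_le_density [IsFiniteMeasure D] {S : Set ℝ} {p : ℝ → ℝ}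
    (h : D.restrict S = (volume.restrict S).withDensity fun x => ENNReal.ofReal (p x))
    {x y m : ℝ} (hS : Ioc x y ⊆ S) (hm : 0 ≤ m) (hp : ∀ z ∈ Ioc x y, m ≤ p z) :
    m * (y - x) ≤ D.real (Ioc x y) := by
  refine (ENNReal.ofReal_le_iff_le_toReal (measure_ne_top _ _)).1 ?_
  rw [measure_eq_lintegral_of_restrict_eq h measurableSet_Ioc hS]
  calc ENNReal.ofReal (m * (y - x)) = ∫⁻ _ in Ioc x y, ENNReal.ofReal m := by
        rw [setLIntegral_const, Real.volume_Ioc, ENNReal.ofReal_mul hm]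
    _ ≤ ∫⁻ z in Ioc x y, ENNReal.ofReal (p z) :=
        setLIntegral_mono' measurableSet_Ioc fun z hz => ENNReal.ofReal_le_ofReal (hp z hz)

theorem real_Ioi_mul_le_of_density [IsFiniteMeasure D] {x₀ x r B : ℝ} {g : ℝ → ℝ}
    (hD : D.restrict (Ioi x₀) =
      (volume.restrict (Ioi x₀)).withDensity fun y => ENNReal.ofReal (Real.exp (-g y)))
    (hr : 0 < r) (hx : x₀ ≤ x) (hrx : x₀ ≤ r * x) (hg : ∀ y > x, B + g y ≤ g (r * y)) :
    D.real (Ioi (r * x)) ≤ r * Real.exp (-B) * D.real (Ioi x) := by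
  have hscale : D (Ioi (r * x)) ≤ ENNReal.ofReal (r * Real.exp (-B)) * D (Ioi x) := by
    rw [measure_eq_lintegral_of_restrict_eq hD measurableSet_Ioi (Ioi_subset_Ioi hrx),
      measure_eq_lintegral_of_restrict_eq hD measurableSet_Ioi (Ioi_subset_Ioi hx),
      lintegral_Ioi_mul_left hr, ENNReal.ofReal_mul hr.le, mul_assoc,
      ← lintegral_const_mul' (ENNReal.ofReal (Real.exp (-B))) _ ENNReal.ofReal_ne_top]
    refine mul_le_mul' le_rfl ?_
    refine setLIntegral_mono' measurableSet_Ioi fun y hy => ?_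
    rw [← ENNReal.ofReal_mul (Real.exp_pos _).le, ← Real.exp_add]
    exact ENNReal.ofReal_le_ofReal (Real.exp_le_exp.2 (by linarith [hg y hy]))
  have hreal := ENNReal.toReal_mono (by finiteness) hscale
  rwa [ENNReal.toReal_mul, ENNReal.toReal_ofReal (by positivity)] at hreal

theorem exists_abs_sub_leading_le {x₀ : ℝ} {a α : ℕ → ℝ} {g : ℝ → ℝ} (hα : Antitone α)
    (hg : ∀ x > x₀, HasSum (fun i => a i * x ^ α i) (g x)) :
    ∃ x₁ K : ℝ, x₀ < x₁ ∧ 1 ≤ x₁ ∧ 0 ≤ K ∧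
      ∀ x ≥ x₁, |g x - a 0 * x ^ α 0| ≤ K * x ^ α 1 := by
  set x₁ := max (x₀ + 1) 1
  have hx₁1 : 1 ≤ x₁ := le_max_right _ _
  have hx₁0 : 0 < x₁ := by linarith
  have hx₀x₁ : x₀ < x₁ := by linarith [le_max_left (x₀ + 1) 1]
  have hsum : Summable fun i => |a (i + 1) * x₁ ^ α (i + 1)| :=
    (summable_nat_add_iff (f := fun i => |a i * x₁ ^ α i|) 1).2 (hg x₁ hx₀x₁).summable.abs
  set K' := ∑' i, |a (i + 1) * x₁ ^ α (i + 1)|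
  have : 0 ≤ K' := tsum_nonneg fun i => abs_nonneg _
  refine ⟨x₁, K' / x₁ ^ α 1, hx₀x₁, hx₁1, by positivity, fun x hx => ?_⟩
  have hx0 : 0 < x := by linarith
  have htail := (hasSum_nat_add_iff' (f := fun i => a i * x ^ α i) 1).2 (hg x (by linarith))
  rw [Finset.sum_range_one] at htail
  have hterm : ∀ i, |a (i + 1) * x ^ α (i + 1)| ≤
      |a (i + 1) * x₁ ^ α (i + 1)| * (x / x₁) ^ α 1 := by
    intro i
    have hrescale : x ^ α (i + 1) = x₁ ^ α (i + 1) * (x / x₁) ^ α (i + 1) := by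
      rw [← Real.mul_rpow hx₁0.le (by positivity), mul_div_cancel₀ _ hx₁0.ne']
    rw [hrescale, ← mul_assoc, abs_mul, abs_of_pos (a := (x / x₁) ^ α (i + 1)) (by positivity)]
    exact mul_le_mul_of_nonneg_left
      (Real.rpow_le_rpow_of_exponent_le ((one_le_div hx₁0).2 hx) (hα (by lia))) (abs_nonneg _)
  have hsumx : Summable fun i => |a (i + 1) * x ^ α (i + 1)| :=
    Summable.of_nonneg_of_le (fun i => abs_nonneg _) hterm (hsum.mul_right _)
  rw [← htail.tsum_eq]
  calc |∑' i, a (i + 1) * x ^ α (i + 1)| ≤ ∑' i, |a (i + 1) * x ^ α (i + 1)| := by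
        simpa only [Real.norm_eq_abs] using
          norm_tsum_le_tsum_norm (f := fun i => a (i + 1) * x ^ α (i + 1)) hsumx
    _ ≤ ∑' i, |a (i + 1) * x₁ ^ α (i + 1)| * (x / x₁) ^ α 1 :=
        hsumx.tsum_le_tsum hterm (hsum.mul_right _)
    _ = K' * (x / x₁) ^ α 1 := tsum_mul_right
    _ = K' / x₁ ^ α 1 * x ^ α 1 := by
        rw [Real.div_rpow hx0.le hx₁0.le]
        ring

theorem le_of_abs_sub_rpow_le {a K A A' x₁ : ℝ} {g : ℝ → ℝ} (ha : 0 ≤ a) (hK : 0 ≤ K)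
    (hA : 0 ≤ A) (hAA' : A' ≤ A) (hx₁ : 1 ≤ x₁) (hg : ∀ y ≥ x₁, |g y - a * y ^ A| ≤ K * y ^ A')
    {x y : ℝ} (hx : x₁ ≤ x) (hy : y ∈ Ioc x (x + 1)) : g y ≤ (a + K) * 2 ^ A * x ^ A := by
  have hyx : x₁ ≤ y := hx.trans hy.1.le
  have hpow : y ^ A ≤ 2 ^ A * x ^ A := by
    rw [← Real.mul_rpow (by norm_num) (by linarith)]
    exact Real.rpow_le_rpow (by linarith) (by linarith [hy.2]) hA
  calc g y ≤ a * y ^ A + K * y ^ A' := by linarith [(abs_le.1 (hg y hyx)).2]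
    _ ≤ a * y ^ A + K * y ^ A := by
        gcongr
        exact hx₁.trans hyx
    _ = (a + K) * y ^ A := by ring
    _ ≤ (a + K) * (2 ^ A * x ^ A) := mul_le_mul_of_nonneg_left hpow (by positivity)
    _ = (a + K) * 2 ^ A * x ^ A := by ring

/-- Convexity of `x ^ A` makes the leading term of `g ((1 + h) * y) - g y` at least `a * h * y ^ A`;
the lower bound on `h` lets half of it absorb the error terms. -/
theorem add_le_of_abs_sub_rpow_le {a K A A' x₁ : ℝ} {g : ℝ → ℝ} (ha : 0 < a) (hK : 0 ≤ K)
    (hA : 1 ≤ A) (hAA' : A' ≤ A) (hx₁ : 0 < x₁) (hg : ∀ y ≥ x₁, |g y - a * y ^ A| ≤ K * y ^ A')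
    {x y h : ℝ} (hx : x₁ ≤ x) (hxy : x ≤ y) (hh0 : 0 ≤ h) (hh1 : h ≤ 1)
    (hhx : 2 * (K * (2 ^ |A'| + 1)) / a ≤ h * x ^ (A - A')) :
    a / 2 * h * x ^ A + g y ≤ g ((1 + h) * y) := by
  have hx0 : 0 < x := hx₁.trans_le hx
  have hy0 : 0 < y := hx0.trans_le hxy
  have hpow : 1 + h ≤ (1 + h) ^ A := Real.self_le_rpow_of_one_le (by linarith) hA
  have hpow' : (1 + h) ^ A' ≤ 2 ^ |A'| :=
    (Real.rpow_le_rpow_of_exponent_le (by linarith) (le_abs_self _)).trans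
      (Real.rpow_le_rpow (by linarith) (by linarith) (abs_nonneg _))
  have hlower : a * (1 + h) * y ^ A - K * 2 ^ |A'| * y ^ A' ≤ g ((1 + h) * y) := by
    have hclose := (abs_le.1 (hg ((1 + h) * y) (by nlinarith))).1
    rw [Real.mul_rpow (by linarith) hy0.le, Real.mul_rpow (by linarith) hy0.le] at hclose
    have hleading : a * (1 + h) * y ^ A ≤ a * ((1 + h) ^ A * y ^ A) := by
      rw [mul_assoc]
      gcongr
    have herror : K * ((1 + h) ^ A' * y ^ A') ≤ K * 2 ^ |A'| * y ^ A' := by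
      rw [mul_assoc]
      gcongr
    linarith
  have hupper : g y ≤ a * y ^ A + K * y ^ A' := by linarith [(abs_le.1 (hg y (hx.trans hxy))).2]
  have habsorb : K * (2 ^ |A'| + 1) * y ^ A' ≤ a / 2 * h * y ^ A := by
    calc K * (2 ^ |A'| + 1) * y ^ A' ≤ a / 2 * (h * x ^ (A - A')) * y ^ A' := by
          rw [div_le_iff₀ ha] at hhx
          exact mul_le_mul_of_nonneg_right (by linarith) (by positivity)
      _ ≤ a / 2 * (h * y ^ (A - A')) * y ^ A' := by gcongr
      _ = a / 2 * h * (y ^ (A - A') * y ^ A') := by ring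
      _ = a / 2 * h * y ^ A := by rw [← Real.rpow_add hy0, sub_add_cancel]
  have hmono : a / 2 * h * x ^ A ≤ a / 2 * h * y ^ A := by gcongr
  linarith

/-- The upper tail of `D` decays like `exp (-x ^ A)`: from `x₁` on it is at least
`exp (-(C * x ^ A))`, and it drops by a factor of order `exp (-(b * h * x ^ A))` from `x` to
`(1 + h) * x`, unless `h` is so small (at most of order `x ^ (-γ)`) that lower-order terms of the
exponent interfere. -/
structure HasPowerTail (D : Measure ℝ) (x₁ A K b C γ : ℝ) : Prop where
  start_pos : 0 < x₁
  exponent_pos : 0 < A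
  rate_pos : 0 < b
  const_pos : 0 < C
  gap_pos : 0 < γ
  exp_neg_le : ∀ x ≥ x₁, Real.exp (-(C * x ^ A)) ≤ D.real (Ioi x)
  real_mul_le : ∀ x ≥ x₁, ∀ h : ℝ, 0 < h → h ≤ 1 → K ≤ h * x ^ γ →
    D.real (Ioi ((1 + h) * x)) ≤ 2 * Real.exp (-(b * h * x ^ A)) * D.real (Ioi x)

theorem exists_hasPowerTail [IsFiniteMeasure D] {x₀ : ℝ} {a α : ℕ → ℝ} {g : ℝ → ℝ}
    (hα : Antitone α) (hα0 : 1 ≤ α 0) (ha : 0 < a 0) (hα1 : α 1 < α 0)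
    (hg : ∀ x > x₀, HasSum (fun i => a i * x ^ α i) (g x))
    (hD : D.restrict (Ioi x₀) =
      (volume.restrict (Ioi x₀)).withDensity fun x => ENNReal.ofReal (Real.exp (-g x))) :
    ∃ x₁ A K b C γ : ℝ, HasPowerTail D x₁ A K b C γ := by
  obtain ⟨x₁, K, hx₀₁, hx₁, hK, hgK⟩ := exists_abs_sub_leading_le hα hg
  refine ⟨x₁, α 0, 2 * (K * (2 ^ |α 1| + 1)) / a 0, a 0 / 2, (a 0 + K) * 2 ^ α 0, α 0 - α 1,
    by linarith, by linarith, by linarith, by positivity, by linarith, fun x hx => ?_,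
    fun x hx h hh0 hh1 hhx => ?_⟩
  · have hmass := mul_sub_le_real_Ioc_of_le_density hD (x := x) (y := x + 1)
      (fun y hy => mem_Ioi.2 (by linarith [hy.1])) (Real.exp_pos _).le fun y hy =>
        Real.exp_le_exp.2 (neg_le_neg (le_of_abs_sub_rpow_le ha.le hK (by linarith) hα1.le hx₁ hgK
          hx hy))
    rw [add_sub_cancel_left, mul_one] at hmass
    exact hmass.trans (measureReal_mono Ioc_subset_Ioi_self)
  · have hxh : x ≤ (1 + h) * x := by nlinarith
    refine (real_Ioi_mul_le_of_density hD (by linarith) (by linarith) (by linarith) fun y hy =>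
      add_le_of_abs_sub_rpow_le ha hK hα0 hα1.le (by linarith) hgK hx hy.le hh0.le hh1 hhx).trans ?_
    gcongr
    linarith

end Tail

section Thresholds

open Filter Topology Asymptotics

theorem eventually_mul_le_mul_of_isLittleO {u v : ℝ → ℝ} (huv : u =o[atTop] v)
    (hv : ∀ᶠ x in atTop, 0 ≤ v x) {c : ℝ} (hc : 0 < c) (C : ℝ) :
    ∀ᶠ x in atTop, C * u x ≤ c * v x := by
  filter_upwards [(huv.const_mul_left C).def hc, hv] with x hle hvx
  rw [Real.norm_of_nonneg hvx] at hle
  exact (Real.le_norm_self _).trans hle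

theorem eventually_mul_log_pow_le_mul_rpow {c : ℝ} (hc : 0 < c) (k : ℕ) {r : ℝ} (hr : 0 < r)
    (C : ℝ) : ∀ᶠ x : ℝ in atTop, C * Real.log x ^ k ≤ c * x ^ r := by
  simpa only [Real.rpow_natCast] using eventually_mul_le_mul_of_isLittleO
    (isLittleO_log_rpow_rpow_atTop k hr)
    ((eventually_ge_atTop 0).mono fun x hx => Real.rpow_nonneg hx r) hc C

theorem eventually_mul_log_pow_le_mul {c : ℝ} (hc : 0 < c) (k : ℕ) (C : ℝ) :
    ∀ᶠ x : ℝ in atTop, C * Real.log x ^ k ≤ c * x :=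
  eventually_mul_le_mul_of_isLittleO Real.isLittleO_pow_log_id_atTop (eventually_ge_atTop 0) hc C

theorem eventually_pow_mul_exp_neg_le {c : ℝ} (hc : 0 < c) (k : ℕ) :
    ∀ᶠ x : ℝ in atTop, x ^ k * Real.exp (-x) ≤ c :=
  (Real.tendsto_pow_mul_exp_neg_atTop_nhds_zero k).eventually (ge_mem_nhds hc)

theorem two_mul_exp_neg_le_one_div_pow {L X : ℝ} (hL : 0 < L) (k : ℕ)
    (hX : k * Real.log L + 1 ≤ X) : 2 * Real.exp (-X) ≤ 1 / L ^ k := by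
  calc 2 * Real.exp (-X) ≤ 2 * (Real.exp (-1) * Real.exp (-(k * Real.log L))) := by
        rw [← Real.exp_add]
        gcongr
        linarith
    _ = 2 * Real.exp (-1) * (1 / L ^ k) := by
        rw [Real.exp_neg (k * _), Real.exp_nat_mul, Real.exp_log hL, one_div, mul_assoc]
    _ ≤ 1 / L ^ k :=
        mul_le_of_le_one_left (by positivity) (by linarith [Real.exp_neg_one_lt_half])

theorem antitone_real_Ioi (D : Measure ℝ) [IsFiniteMeasure D] :
    Antitone fun x => D.real (Ioi x) :=
  fun _ _ h => measureReal_mono (Ioi_subset_Ioi h)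

variable {D : Measure ℝ}

/-- Two values `M` and `M'`, equal up to a factor close to `1`, such that many of about `exp L`
independent draws from `D` exceed `M`. In the applications hardly any of them exceeds `M'`, so that
the largest draws lie between `M` and `M'`. -/
structure IsThresholdPair (D : Measure ℝ) (L M M' : ℝ) : Prop where
  pos : 0 < M
  nonneg : 0 ≤ M'
  mul_le : (1 - 1 / Real.log L ^ 2) * M' ≤ M
  le_real : L ^ 2 * Real.exp (-L) ≤ D.real (Ioi M)

namespace HasPowerTail

variable {x₁ A K b C γ : ℝ}

theorem div_le_rpow_of_real_lt (hD : HasPowerTail D x₁ A K b C γ) {L y : ℝ} (hL : 0 < L)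
    (hlog : 4 * Real.log L ≤ L) (hy : x₁ ≤ y) (hlt : D.real (Ioi y) < L ^ 2 * Real.exp (-L)) :
    L / (2 * C) ≤ y ^ A := by
  have hC := hD.const_pos
  have hlog' := (Real.lt_log_iff_exp_lt (by positivity)).2 ((hD.exp_neg_le y hy).trans_lt hlt)
  rw [Real.log_mul (by positivity) (Real.exp_pos _).ne', Real.log_pow, Real.log_exp] at hlog'
  push_cast at hlog'
  rw [div_le_iff₀ (by positivity)]
  linarith

theorem real_mul_le_div_pow (hD : HasPowerTail D x₁ A K b C γ) {L y : ℝ} (hL : 0 < L)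
    (hlog1 : 1 ≤ Real.log L) (hy : x₁ ≤ y) (hyA : L / (2 * C) ≤ y ^ A)
    (hK : 4 * K * Real.log L ^ 2 ≤ (1 / (2 * C)) ^ (γ / A) * L ^ (γ / A))
    (hlog3 : 48 * C / b * Real.log L ^ 3 ≤ L) :
    D.real (Ioi ((1 + 1 / (4 * Real.log L ^ 2)) * y)) ≤ 1 / L ^ 5 * D.real (Ioi y) := by
  have hA := hD.exponent_pos
  have hb := hD.rate_pos
  have hC := hD.const_pos
  have hγ := hD.gap_pos
  have hy0 : 0 < y := hD.start_pos.trans_le hy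
  set l := Real.log L
  set h := 1 / (4 * l ^ 2) with hh
  have hh1 : h ≤ 1 := (div_le_one (by positivity)).2 (by nlinarith)
  have hyγ : (1 / (2 * C)) ^ (γ / A) * L ^ (γ / A) ≤ y ^ γ := by
    calc (1 / (2 * C)) ^ (γ / A) * L ^ (γ / A) = (L / (2 * C)) ^ (γ / A) := by
          rw [← Real.mul_rpow (by positivity) hL.le, one_div_mul_eq_div]
      _ ≤ (y ^ A) ^ (γ / A) := by gcongr
      _ = y ^ γ := by rw [← Real.rpow_mul hy0.le, mul_div_cancel₀ _ hA.ne']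
  have hKy : K ≤ h * y ^ γ := by
    rw [hh, one_div_mul_eq_div, le_div_iff₀ (by positivity)]
    linarith
  have hexponent : (5 : ℕ) * l + 1 ≤ b * h * y ^ A := by
    calc (5 : ℕ) * l + 1 ≤ 6 * l := by
          push_cast
          linarith
      _ = b * h * (48 * C / b * l ^ 3 / (2 * C)) := by
          rw [hh]
          field_simp
          norm_num
      _ ≤ b * h * y ^ A := by
          have : 0 < h := by positivity
          gcongr
          exact le_trans (by gcongr) hyA
  exact (hD.real_mul_le y hy h (by positivity) hh1 hKy).trans
    (mul_le_mul_of_nonneg_right (two_mul_exp_neg_le_one_div_pow hL 5 hexponent) measureReal_nonneg)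

end HasPowerTail

theorem eventually_isThresholdPair_of_mul_le {χ κ h₀ : ℝ} (hχ : 0 < χ) (hκ : 0 < κ) (hh₀ : 0 < h₀)
    (hmass : ∀ h : ℝ, 0 < h → h ≤ h₀ → κ * h ≤ D.real (Ioi ((1 - h) * χ))) :
    ∀ᶠ L : ℝ in atTop, IsThresholdPair D L ((1 - 1 / Real.log L ^ 2) * χ) χ := by
  filter_upwards [Real.tendsto_log_atTop.eventually (eventually_ge_atTop (1 / h₀ + 2)),
    eventually_pow_mul_exp_neg_le hκ 4, eventually_ge_atTop 1] with L hlog hexp hL1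
  have hL0 : 0 < L := by linarith
  set l := Real.log L
  have hh₀' : 0 < 1 / h₀ := by positivity
  have hl : l ≤ l ^ 2 := by nlinarith
  have hη1 : 1 / l ^ 2 < 1 := (div_lt_one (by nlinarith)).2 (by linarith)
  have hη2 : 1 / l ^ 2 ≤ h₀ := (one_div_le (by nlinarith) hh₀).2 (by linarith)
  have hlL : l ^ 2 ≤ L ^ 2 := pow_le_pow_left₀ (by linarith)
    ((Real.log_le_sub_one_of_pos hL0).trans (by linarith)) 2
  refine ⟨mul_pos (sub_pos.2 hη1) hχ, hχ.le, le_rfl,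
    le_trans ?_ (hmass _ (one_div_pos.2 (by nlinarith)) hη2)⟩
  rw [mul_one_div, le_div_iff₀ (by nlinarith)]
  calc L ^ 2 * Real.exp (-L) * l ^ 2 ≤ L ^ 2 * Real.exp (-L) * L ^ 2 := by gcongr
    _ = L ^ 4 * Real.exp (-L) := by ring
    _ ≤ κ := hexp

variable [IsProbabilityMeasure D]

theorem tendsto_real_Ioi_atTop : Tendsto (fun x => D.real (Ioi x)) atTop (𝓝 0) := by
  have hlim := (ProbabilityTheory.tendsto_cdf_atTop D).const_sub 1
  rw [sub_self] at hlim
  refine hlim.congr fun x => ?_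
  rw [ProbabilityTheory.cdf_eq_real, ← compl_Iic, probReal_compl_eq_one_sub measurableSet_Iic]

theorem exists_upper_quantile {p x₁ : ℝ} (hp : 0 < p) (hx₁ : p ≤ D.real (Ioi x₁)) :
    ∃ s ≥ x₁, (∀ x < s, p ≤ D.real (Ioi x)) ∧ ∀ x > s, D.real (Ioi x) < p := by
  set V := {x | p ≤ D.real (Ioi x)}
  have hne : V.Nonempty := ⟨x₁, hx₁⟩
  have hbdd : BddAbove V := by
    obtain ⟨y, hy⟩ := ((tendsto_real_Ioi_atTop (D := D)).eventually (gt_mem_nhds hp)).exists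
    exact ⟨y, fun x hx => not_lt.1 fun hyx =>
      (hx.trans (antitone_real_Ioi D hyx.le)).not_gt hy⟩
  refine ⟨sSup V, le_csSup hbdd hx₁, fun x hx => ?_, fun x hx => not_le.1 fun hpx =>
    (le_csSup hbdd hpx).not_gt hx⟩
  obtain ⟨y, hy, hxy⟩ := exists_lt_of_lt_csSup hne hx
  exact hy.trans (antitone_real_Ioi D hxy.le)

theorem HasPowerTail.eventually_exists_isThresholdPair {x₁ A K b C γ : ℝ}
    (hD : HasPowerTail D x₁ A K b C γ) :
    ∀ᶠ L : ℝ in atTop, ∃ M M' : ℝ,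
      IsThresholdPair D L M M' ∧ D.real (Ioi M') ≤ Real.exp (-L) / L ^ 3 := by
  have hC := hD.const_pos
  have hstart : 0 < D.real (Ioi x₁) := (Real.exp_pos _).trans_le (hD.exp_neg_le x₁ le_rfl)
  filter_upwards [eventually_pow_mul_exp_neg_le hstart 2,
    eventually_mul_log_pow_le_mul one_pos 1 4,
    eventually_mul_log_pow_le_mul_rpow (c := (1 / (2 * C)) ^ (γ / A)) (by positivity) 2
      (div_pos hD.gap_pos hD.exponent_pos) (4 * K),
    eventually_mul_log_pow_le_mul one_pos 3 (48 * C / b),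
    eventually_ge_atTop (Real.exp 1)] with L hquantile hlog hK hlog3 hLe
  have hL : 0 < L := (Real.exp_pos 1).trans_le hLe
  have hlog1 : 1 ≤ Real.log L := (Real.le_log_iff_exp_le hL).2 hLe
  rw [pow_one, one_mul] at hlog
  rw [one_mul] at hlog3
  obtain ⟨s, hs, hbelow, habove⟩ := exists_upper_quantile (by positivity) hquantile
  have hs0 : 0 < s := hD.start_pos.trans_le hs
  set h := 1 / (4 * Real.log L ^ 2) with hh
  have hh0 : 0 < h := by positivity
  have hh1 : h ≤ 1 / 4 := one_div_le_one_div_of_le (by norm_num) (by nlinarith)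
  set y := (1 + h) * s with hy
  have hsy : s < y := by nlinarith
  have hyA := hD.div_le_rpow_of_real_lt hL hlog (hs.trans hsy.le) (habove y hsy)
  have hdecay := hD.real_mul_le_div_pow hL hlog1 (hs.trans hsy.le) hyA hK hlog3
  refine ⟨(1 - h) * s, (1 + h) * y, ⟨mul_pos (by linarith) hs0, by positivity, ?_,
    hbelow _ (by nlinarith)⟩, ?_⟩
  · have hfactor : 1 / Real.log L ^ 2 = 4 * h := by
      rw [hh]
      field_simp
    rw [hfactor, hy, ← mul_assoc, ← mul_assoc]
    refine mul_le_mul_of_nonneg_right ?_ hs0.le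
    nlinarith [pow_pos hh0 3]
  · calc D.real (Ioi ((1 + h) * y)) ≤ 1 / L ^ 5 * D.real (Ioi y) := hdecay
      _ ≤ 1 / L ^ 5 * (L ^ 2 * Real.exp (-L)) := by
          gcongr
          exact (habove y hsy).le
      _ = Real.exp (-L) / L ^ 3 := by field_simp

theorem exists_mul_le_real_Ioi_of_density {χ y : ℝ} (hχ : 0 < χ) (hy : y < χ) {p : ℝ → ℝ}
    (hD : D.restrict (Ioc y χ) =
      (volume.restrict (Ioc y χ)).withDensity fun x => ENNReal.ofReal (p x))
    (hcont : ContinuousWithinAt p (Iic χ) χ) (hpos : 0 < p χ) :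
    ∃ κ h₀ : ℝ, 0 < κ ∧ 0 < h₀ ∧
      ∀ h : ℝ, 0 < h → h ≤ h₀ → κ * h ≤ D.real (Ioi ((1 - h) * χ)) := by
  have hnear : ∀ᶠ x in 𝓝[≤] χ, p χ / 2 < p x :=
    hcont.eventually (lt_mem_nhds (half_lt_self hpos))
  obtain ⟨z, hz, hzp⟩ := (mem_nhdsLE_iff_exists_Ioc_subset' hy).1 hnear
  refine ⟨p χ / 2 * χ, (χ - max y z) / χ, by positivity,
    div_pos (sub_pos.2 (max_lt hy hz)) hχ, fun h _ hh1 => ?_⟩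
  rw [le_div_iff₀ hχ] at hh1
  have hmax : max y z ≤ (1 - h) * χ := by linarith
  have hmass := mul_sub_le_real_Ioc_of_le_density hD (x := (1 - h) * χ) (m := p χ / 2)
    (Ioc_subset_Ioc_left ((le_max_left _ _).trans hmax)) (by positivity)
    fun x hx => (hzp (Ioc_subset_Ioc_left ((le_max_right _ _).trans hmax) hx)).le
  calc p χ / 2 * χ * h = p χ / 2 * (χ - (1 - h) * χ) := by ring
    _ ≤ D.real (Ioc ((1 - h) * χ) χ) := hmass
    _ ≤ D.real (Ioi ((1 - h) * χ)) := measureReal_mono Ioc_subset_Ioi_self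

theorem pos_of_integral_pos_of_measure_Ioi_eq_zero {χ : ℝ} (hint : Integrable (fun x : ℝ => x) D)
    (hmean : 0 < ∫ x, x ∂D) (hχ : D (Ioi χ) = 0) : 0 < χ := by
  have hle : ∀ᵐ x ∂D, x ≤ χ := by
    rw [ae_iff]
    simp only [not_le]
    exact hχ
  have hmono := integral_mono_ae hint (integrable_const χ) hle
  rw [integral_const, probReal_univ, one_smul] at hmono
  exact hmean.trans_le hmono

theorem HasPowerTail.exists_real_mul_real_pos {x₁ A K b C γ : ℝ}
    (hD : HasPowerTail D x₁ A K b C γ) : ∃ a : ℝ, 0 < D.real (Iic a) * D.real (Ici (a + 1)) := by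
  obtain ⟨a, ha1, hax₁⟩ := (((tendsto_real_Ioi_atTop (D := D)).eventually (gt_mem_nhds one_pos)).and
    (eventually_ge_atTop x₁)).exists
  refine ⟨a, mul_pos ?_ ?_⟩
  · rw [← compl_Ioi, probReal_compl_eq_one_sub measurableSet_Ioi]
    exact sub_pos.2 ha1
  · exact (Real.exp_pos _).trans_le ((hD.exp_neg_le (a + 1) (by linarith)).trans
      (measureReal_mono Ioi_subset_Ici_self))

theorem HasGeneralizedExponentialTail.eventually_exists_isThresholdPair
    (hD : HasGeneralizedExponentialTail D) (hint : Integrable (fun x : ℝ => x) D)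
    (hmean : 0 < ∫ x, x ∂D) :
    (∀ᶠ L : ℝ in atTop, ∃ M M' : ℝ, IsThresholdPair D L M M' ∧ D.real (Ioi M') = 0) ∨
    ((∃ a : ℝ, 0 < D.real (Iic a) * D.real (Ici (a + 1))) ∧
      ∀ᶠ L : ℝ in atTop, ∃ M M' : ℝ,
        IsThresholdPair D L M M' ∧ D.real (Ioi M') ≤ Real.exp (-L) / L ^ 3) := by
  rcases hD with ⟨x₀, a, α, g, -, hα, hα0, ha, hα1, hg, hden⟩ | ⟨b, χ, hbχ, -, hχ⟩
  · obtain ⟨x₁, A, K, b, C, γ, htail⟩ := exists_hasPowerTail hα hα0 ha hα1 hg hden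
    exact Or.inr ⟨htail.exists_real_mul_real_pos, htail.eventually_exists_isThresholdPair⟩
  · have hIoi : D (Ioi χ) = 0 :=
      measure_mono_null (fun x hx h => not_le.2 (mem_Ioi.1 hx) (mem_Icc.1 h).2) hbχ
    have hχ0 := pos_of_integral_pos_of_measure_Ioi_eq_zero hint hmean hIoi
    obtain ⟨κ, h₀, hκ, hh₀, hmass⟩ : ∃ κ h₀ : ℝ, 0 < κ ∧ 0 < h₀ ∧
        ∀ h : ℝ, 0 < h → h ≤ h₀ → κ * h ≤ D.real (Ioi ((1 - h) * χ)) := by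
      rcases hχ with hatom | ⟨y, hy, p, -, hden, hcont, hpos⟩
      · refine ⟨D.real {χ}, 1, ENNReal.toReal_pos hatom.ne' (measure_ne_top _ _), one_pos,
          fun h _ hh1 => (mul_le_of_le_one_right measureReal_nonneg hh1).trans
            (measureReal_mono (singleton_subset_iff.2 (mem_Ioi.2 (by nlinarith))))⟩
      · exact exists_mul_le_real_Ioi_of_density hχ0 hy hden hcont hpos
    refine Or.inl ((eventually_isThresholdPair_of_mul_le hχ0 hκ hh₀ hmass).mono fun L hL =>
      ⟨_, χ, hL, ?_⟩)
    rw [Measure.real, hIoi, ENNReal.toReal_zero]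

end Thresholds

section StepFailure

open Filter Topology

theorem eventually_mul_rpow_le_mul_rpow {c : ℝ} (hc : 0 < c) {r s : ℝ} (hrs : r < s) (C : ℝ) :
    ∀ᶠ x : ℝ in atTop, C * x ^ r ≤ c * x ^ s := by
  filter_upwards [(tendsto_rpow_atTop (sub_pos.2 hrs)).eventually (eventually_ge_atTop (C / c)),
    eventually_gt_atTop 0] with x hx hx0
  rw [div_le_iff₀ hc] at hx
  calc C * x ^ r ≤ x ^ (s - r) * c * x ^ r :=
        mul_le_mul_of_nonneg_right hx (Real.rpow_nonneg hx0.le r)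
    _ = c * (x ^ (s - r) * x ^ r) := by ring
    _ = c * x ^ s := by rw [← Real.rpow_add hx0, sub_add_cancel]

/-- The comparisons between `x`, its logarithms and its powers which make the error terms of a
selection problem with about `x` neighbors and at most `x ^ c` candidates negligible. -/
structure IsLargeScale (D : Measure ℝ) (c : ℕ) (x : ℝ) : Prop where
  two_le : 2 ≤ x
  moment_le : ∫ y, |y| ^ (10 * (2 * c + 2)) ∂D ≤ x
  six_le_log_log : 6 ≤ Real.log (Real.log x)
  le_log : 16 * c + 3 ≤ Real.log x
  log_sq_le : 8 * Real.log x ^ 2 ≤ x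
  log_le_rpow : (4 * c + 2) * Real.log x ≤ x ^ (1 / 10 : ℝ)
  moment_mul_log_sq_le :
    2 * (∫ y, y ^ 2 ∂D) * Real.log x ^ 2 ≤ (∫ y, y ∂D) * x ^ (1 / 10 : ℝ)
  log_pow_le : (2 * c + 2) * Real.log x ^ 5 ≤ (∫ y, y ∂D) ^ 2 * x ^ (4 / 5 : ℝ)
  rpow_le_mean_mul : 32 * x ^ (1 / 10 : ℝ) ≤ (∫ y, y ∂D) * (8 * x)

theorem eventually_isLargeScale {D : Measure ℝ} (hμ : 0 < ∫ x, x ∂D) (c : ℕ) :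
    ∀ᶠ x : ℝ in atTop, IsLargeScale D c x := by
  have hlog := Real.tendsto_log_atTop
  filter_upwards [eventually_ge_atTop 2, eventually_ge_atTop (∫ y, |y| ^ (10 * (2 * c + 2)) ∂D),
    (hlog.comp hlog).eventually (eventually_ge_atTop 6),
    hlog.eventually (eventually_ge_atTop (16 * c + 3 : ℝ)),
    eventually_mul_log_pow_le_mul one_pos 2 8,
    eventually_mul_log_pow_le_mul_rpow one_pos 1 (r := 1 / 10) (by norm_num) (4 * c + 2),
    eventually_mul_log_pow_le_mul_rpow hμ 2 (r := 1 / 10) (by norm_num) (2 * ∫ y, y ^ 2 ∂D),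
    eventually_mul_log_pow_le_mul_rpow (pow_pos hμ 2) 5 (r := 4 / 5) (by norm_num) (2 * c + 2),
    eventually_mul_rpow_le_mul_rpow hμ (r := 1 / 10) (s := 1) (by norm_num) 4]
    with x hx hmoment hloglog hlogx hlogsq hlogrpow hmean hpow hrpow
  rw [one_mul] at hlogsq
  rw [pow_one, one_mul] at hlogrpow
  rw [Real.rpow_one] at hrpow
  exact ⟨hx, hmoment, hloglog, hlogx, hlogsq, hlogrpow, hmean, hpow, by linarith⟩

theorem real_lt_abs_le_div_pow {D : Measure ℝ} [IsFiniteMeasure D] {R : ℝ} (hR : 0 < R) {p : ℕ}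
    (hp : Integrable (fun x : ℝ => |x| ^ p) D) :
    D.real {x | R < |x|} ≤ (∫ x, |x| ^ p ∂D) / R ^ p := by
  have hsub : {x : ℝ | R < |x|} ⊆ {x | R ^ p ≤ |x| ^ p} := fun x (hx : R < |x|) =>
    pow_le_pow_left₀ hR.le hx.le p
  rw [le_div_iff₀' (by positivity)]
  calc R ^ p * D.real {x | R < |x|} ≤ R ^ p * D.real {x | R ^ p ≤ |x| ^ p} :=
        mul_le_mul_of_nonneg_left (measureReal_mono hsub) (by positivity)
    _ ≤ ∫ x, |x| ^ p ∂D :=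
        mul_meas_ge_le_integral_of_nonneg (ae_of_all _ fun x => by positivity) hp (R ^ p)

namespace IsLargeScale

variable {D : Measure ℝ} {c m : ℕ} {x : ℝ}

theorem pos (hx : IsLargeScale D c x) : 0 < x := by linarith [hx.two_le]

theorem three_le_log (hx : IsLargeScale D c x) : 3 ≤ Real.log x := by
  linarith [hx.le_log, c.cast_nonneg (α := ℝ)]

theorem log_log_le (hx : IsLargeScale D c x) : Real.log (Real.log x) ≤ Real.log x :=
  Real.log_le_self (by linarith [hx.three_le_log])

theorem two_mul_exp_le (hx : IsLargeScale D c x) {X : ℝ}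
    (hX : X ≤ -((2 * c + 2) * Real.log x)) : 2 * Real.exp X ≤ 1 / x ^ (2 * c + 1) := by
  rw [← neg_neg X]
  refine two_mul_exp_neg_le_one_div_pow hx.pos _ ?_
  push_cast
  linarith [hx.three_le_log]

theorem real_lt_abs_le [IsFiniteMeasure D] (hx : IsLargeScale D c x)
    (hint : ∀ p : ℕ, Integrable (fun x : ℝ => |x| ^ p) D) :
    D.real {y | x ^ (1 / 10 : ℝ) < |y|} ≤ 1 / x ^ (2 * c + 1) := by
  have hx0 := hx.pos
  have hpow : (x ^ (1 / 10 : ℝ)) ^ (10 * (2 * c + 2)) = x ^ (2 * c + 2) := by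
    rw [pow_mul, one_div, ← Nat.cast_ofNat, Real.rpow_inv_natCast_pow hx0.le (by norm_num)]
  calc D.real {y | x ^ (1 / 10 : ℝ) < |y|}
      ≤ (∫ y, |y| ^ (10 * (2 * c + 2)) ∂D) / (x ^ (1 / 10 : ℝ)) ^ (10 * (2 * c + 2)) :=
        real_lt_abs_le_div_pow (by positivity) (hint _)
    _ ≤ x / x ^ (2 * c + 2) := by
        rw [hpow]
        gcongr
        exact hx.moment_le
    _ = 1 / x ^ (2 * c + 1) := by
        rw [pow_succ x (2 * c + 1)]
        field_simp

theorem abs_setIntegral_sub_le [IsFiniteMeasure D] (hx : IsLargeScale D c x)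
    (hint : Integrable (fun y : ℝ => y) D) (hint2 : Integrable (fun y : ℝ => y ^ 2) D) :
    |∫ y in Icc (-(x ^ (1 / 10 : ℝ))) (x ^ (1 / 10 : ℝ)), y ∂D - ∫ y, y ∂D| ≤
      1 / Real.log (Real.log x) ^ 2 * (∫ y, y ∂D) / 2 := by
  have hR : 0 < x ^ (1 / 10 : ℝ) := Real.rpow_pos_of_pos hx.pos _
  have hll := hx.six_le_log_log
  refine (abs_setIntegral_Icc_sub_integral_le hR hint hint2).trans ?_
  rw [one_div_mul_eq_div, div_div, div_le_div_iff₀ hR (by positivity)]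
  calc (∫ y, y ^ 2 ∂D) * (Real.log (Real.log x) ^ 2 * 2)
      ≤ (∫ y, y ^ 2 ∂D) * (Real.log x ^ 2 * 2) := by
        have := hx.log_log_le
        have : 0 ≤ ∫ y, y ^ 2 ∂D := integral_nonneg fun y => sq_nonneg y
        gcongr
    _ ≤ (∫ y, y ∂D) * x ^ (1 / 10 : ℝ) := by linarith [hx.moment_mul_log_sq_le]

theorem two_mul_exp_neg_deviation_le (hx : IsLargeScale D c x) (hm : 8 * x ≤ m) :
    2 * Real.exp (-((1 / Real.log (Real.log x) ^ 2 * ∫ y, y ∂D) ^ 2 * m /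
      (8 * (x ^ (1 / 10 : ℝ)) ^ 2))) ≤ 1 / x ^ (2 * c + 1) := by
  have hx0 := hx.pos
  have hll := hx.six_le_log_log
  have hL := hx.three_le_log
  set l := Real.log (Real.log x)
  set μ := ∫ y, y ∂D
  set R := x ^ (1 / 10 : ℝ) with hR
  have hR0 : 0 < R := by positivity
  have hsplit : x ^ (4 / 5 : ℝ) * R ^ 2 = x := by
    rw [hR, ← Real.rpow_natCast, ← Real.rpow_mul hx0.le, ← Real.rpow_add hx0]
    norm_num
  have hl4 : (2 * c + 2) * Real.log x * l ^ 4 ≤ μ ^ 2 * x ^ (4 / 5 : ℝ) := by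
    calc (2 * c + 2) * Real.log x * l ^ 4 ≤ (2 * c + 2) * Real.log x * Real.log x ^ 4 := by
          have := hx.log_log_le
          gcongr
      _ = (2 * c + 2) * Real.log x ^ 5 := by ring
      _ ≤ μ ^ 2 * x ^ (4 / 5 : ℝ) := hx.log_pow_le
  refine hx.two_mul_exp_le (neg_le_neg ?_)
  calc (2 * c + 2) * Real.log x ≤ μ ^ 2 * x ^ (4 / 5 : ℝ) / l ^ 4 :=
        (le_div_iff₀ (by positivity)).2 hl4
    _ = (1 / l ^ 2 * μ) ^ 2 * (8 * (x ^ (4 / 5 : ℝ) * R ^ 2)) / (8 * R ^ 2) := by field_simp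
    _ ≤ (1 / l ^ 2 * μ) ^ 2 * m / (8 * R ^ 2) := by
        rw [hsplit]
        gcongr

theorem two_mul_exp_raise_sub_le (hx : IsLargeScale D c x) (hm : m ≤ c * x) :
    2 * Real.exp (((1 + x ^ (1 / 10 : ℝ)) * x ^ (-(3 / 4) : ℝ)) ^ 2 / 2 * m - x ^ (1 / 10 : ℝ)) ≤
      1 / x ^ (2 * c + 1) := by
  have hx0 := hx.pos
  set R := x ^ (1 / 10 : ℝ) with hR
  set ρ := x ^ (-(3 / 4) : ℝ) with hρ
  have hR1 : 1 ≤ R := Real.one_le_rpow (by linarith [hx.two_le]) (by norm_num)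
  have : 0 < ρ := by positivity
  have hRρ : (R * ρ) ^ 2 * x ≤ 1 := by
    calc (R * ρ) ^ 2 * x = x ^ (-(3 / 10) : ℝ) := by
          rw [hR, hρ, ← Real.rpow_add hx0, ← Real.rpow_natCast, ← Real.rpow_mul hx0.le,
            ← Real.rpow_add_one hx0.ne']
          norm_num
      _ ≤ 1 := Real.rpow_le_one_of_one_le_of_nonpos (by linarith [hx.two_le]) (by norm_num)
  have hcost : ((1 + R) * ρ) ^ 2 / 2 * m ≤ 2 * c := by
    calc ((1 + R) * ρ) ^ 2 / 2 * m ≤ ((R + R) * ρ) ^ 2 / 2 * (c * x) := by gcongr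
      _ = 2 * c * ((R * ρ) ^ 2 * x) := by ring
      _ ≤ 2 * c := mul_le_of_le_one_right (by positivity) hRρ
  refine hx.two_mul_exp_le ?_
  have hc : (2 * c : ℝ) ≤ 2 * c * Real.log x :=
    le_mul_of_one_le_right (by positivity) (by linarith [hx.three_le_log])
  linarith [hx.log_le_rpow]

theorem two_mul_exp_sub_raise_le (hx : IsLargeScale D c x) {q : ℝ} (hq : 0 ≤ q)
    (hqx : 5 * x ^ (1 / 10 : ℝ) ≤ q * x ^ (1 / 4 : ℝ)) (hm : 8 * x ≤ m) :
    2 * Real.exp (4 * x ^ (1 / 10 : ℝ) - x ^ (-(3 / 4) : ℝ) * q / 2 * (m / 4)) ≤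
      1 / x ^ (2 * c + 1) := by
  have hx0 := hx.pos
  have hgain : q * x ^ (1 / 4 : ℝ) ≤ x ^ (-(3 / 4) : ℝ) * q / 2 * (m / 4) := by
    calc q * x ^ (1 / 4 : ℝ) = q * (x ^ (-(3 / 4) : ℝ) * x) := by
          rw [← Real.rpow_add_one hx0.ne']
          norm_num
      _ = x ^ (-(3 / 4) : ℝ) * q / 2 * (8 * x / 4) := by ring
      _ ≤ x ^ (-(3 / 4) : ℝ) * q / 2 * (m / 4) := by gcongr
  have hc : 0 ≤ 2 * c * Real.log x :=
    mul_nonneg (by positivity) (by linarith [hx.three_le_log])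
  refine hx.two_mul_exp_le ?_
  linarith [hx.log_le_rpow]

theorem two_mul_exp_neg_hits_le (hx : IsLargeScale D c x) {p : ℝ}
    (hp : Real.log x ^ 2 * Real.exp (-Real.log x) ≤ p) (hm : 8 * x ≤ m) :
    2 * Real.exp (-(p * (m / 2))) ≤ 1 / x ^ (2 * c + 1) := by
  have hx0 := hx.pos
  have hL := hx.three_le_log
  have hp0 : 0 ≤ p := hp.trans' (by positivity)
  refine hx.two_mul_exp_le (neg_le_neg ?_)
  calc (2 * c + 2) * Real.log x ≤ 4 * Real.log x * Real.log x := by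
        gcongr
        linarith [hx.le_log]
    _ = Real.log x ^ 2 * Real.exp (-Real.log x) * (8 * x / 2) := by
        rw [Real.exp_neg, Real.exp_log hx0]
        field_simp
        norm_num
    _ ≤ p * (m / 2) := by gcongr

theorem pow_mul_one_div_pow (hx : IsLargeScale D c x) :
    x ^ c * (1 / x ^ (2 * c + 1)) = 1 / x ^ (c + 1) := by
  have hx0 := hx.pos
  rw [show 2 * c + 1 = c + (c + 1) by ring, pow_add]
  field_simp

theorem one_div_pow_le (hx : IsLargeScale D c x) : 1 / x ^ (2 * c + 1) ≤ 1 / x ^ (c + 1) :=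
  one_div_pow_le_one_div_pow_of_le (by linarith [hx.two_le]) (by lia)

theorem pow_mul_one_div_pow_succ_le (hx : IsLargeScale D c x) :
    x ^ c * (1 / x ^ (c + 1)) ≤ 1 / 2 := by
  have hx0 := hx.pos
  calc x ^ c * (1 / x ^ (c + 1)) = 1 / x := by
        rw [pow_succ]
        field_simp
    _ ≤ 1 / 2 := one_div_le_one_div_of_le two_pos hx.two_le

theorem one_div_pow_succ_le (hx : IsLargeScale D c x) :
    4 * (1 / x ^ (c + 1)) ≤ 1 / 2 * (1 / Real.log x ^ 2) := by
  have hx0 := hx.pos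
  have hL := hx.three_le_log
  calc 4 * (1 / x ^ (c + 1)) ≤ 4 * (1 / x) := by
        gcongr
        exact le_self_pow₀ (by linarith [hx.two_le]) (by lia)
    _ ≤ 1 / 2 * (1 / Real.log x ^ 2) := by
        rw [mul_one_div, mul_one_div, div_le_div_iff₀ hx0 (by positivity)]
        linarith [hx.log_sq_le]

end IsLargeScale

namespace SelectionSystem

variable {ι β : Type*} [DecidableEq ι] (s : SelectionSystem ι β)

/-- The size of the selection problem of an iteration with bundles of size `c`, for `x` the size of
the ground set. -/
structure HasSize (c : ℕ) (x : ℝ) : Prop where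
  le_m : 8 * x ≤ s.m
  m_le : s.m ≤ c * x
  card_𝒜_le : s.𝒜.card ≤ x ^ c
  card_𝒯_le : s.𝒯.card ≤ x ^ c

variable {s} {c : ℕ} {x : ℝ} {D : Measure ℝ} [IsProbabilityMeasure D]

theorem HasSize.deviationBound_le (hs : s.HasSize c x) (hx : IsLargeScale D c x)
    (hint : ∀ p : ℕ, Integrable (fun x : ℝ => |x| ^ p) D) :
    s.deviationBound D (1 / Real.log (Real.log x) ^ 2 * ∫ y, y ∂D) (x ^ (1 / 10 : ℝ)) ≤
      2 * (1 / x ^ (c + 1)) := by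
  have hx0 := hx.pos
  rw [deviationBound, ← hx.pow_mul_one_div_pow, two_mul (x ^ c * _)]
  exact add_le_add
    (mul_le_mul hs.card_𝒯_le (hx.real_lt_abs_le hint) measureReal_nonneg (by positivity))
    (mul_le_mul hs.card_𝒜_le (hx.two_mul_exp_neg_deviation_le hs.le_m) (by positivity)
      (by positivity))

variable [Fintype ι]

theorem HasSize.real_nearMax_le (hs : s.HasSize c x) (hx : IsLargeScale D c x)
    (hμ : 0 < ∫ y, y ∂D) (hint : ∀ p : ℕ, Integrable (fun x : ℝ => |x| ^ p) D)
    (hμR : |∫ y in Icc (-(x ^ (1 / 10 : ℝ))) (x ^ (1 / 10 : ℝ)), y ∂D - ∫ y, y ∂D| ≤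
      1 / Real.log (Real.log x) ^ 2 * (∫ y, y ∂D) / 2) {a : ℝ}
    (ha : 5 * x ^ (1 / 10 : ℝ) ≤ D.real (Iic a) * D.real (Ici (a + 1)) * x ^ (1 / 4 : ℝ))
    {A : β} (hA : A ∈ s.𝒜) :
    (Measure.pi fun _ : ι => D).real (s.nearMax A (2 * s.W * x ^ (1 / 10 : ℝ))) ≤
      Real.exp 1 * (Measure.pi fun _ : ι => D).real (s.strictMax A) + 3 * (1 / x ^ (c + 1)) := by
  have hx0 := hx.pos
  have hη : 1 / Real.log (Real.log x) ^ 2 ≤ 1 / 32 :=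
    one_div_le_one_div_of_le (by norm_num) (by nlinarith [hx.six_le_log_log])
  have hη0 : 0 < 1 / Real.log (Real.log x) ^ 2 := by
    have := hx.six_le_log_log
    positivity
  have hnear := s.real_nearMax_le (D := D) (a := a) (ρ := x ^ (-(3 / 4) : ℝ))
    (l := x ^ (1 / 10 : ℝ)) hμ hη0 hη (by positivity) hμR
    (hx.rpow_le_mean_mul.trans (mul_le_mul_of_nonneg_left hs.le_m hμ.le)) (by positivity)
    (Real.rpow_le_one_of_one_le_of_nonpos (by linarith [hx.two_le]) (by norm_num))
    (by positivity) hA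
  have hcost := (hx.two_mul_exp_raise_sub_le hs.m_le).trans hx.one_div_pow_le
  have hgain := mul_le_mul hs.card_𝒜_le (hx.two_mul_exp_sub_raise_le (by positivity) ha hs.le_m)
    (by positivity) (by positivity)
  rw [hx.pow_mul_one_div_pow] at hgain
  linarith [hs.deviationBound_le hx hint]

theorem HasSize.real_spike_le (hs : s.HasSize c x) (hx : IsLargeScale D c x)
    (hint : ∀ p : ℕ, Integrable (fun x : ℝ => |x| ^ p) D)
    (hnear : ∀ A ∈ s.𝒜,
      (Measure.pi fun _ : ι => D).real (s.nearMax A (2 * s.W * x ^ (1 / 10 : ℝ))) ≤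
      Real.exp 1 * (Measure.pi fun _ : ι => D).real (s.strictMax A) + 3 * (1 / x ^ (c + 1)))
    {M : ℝ} (hM : 0 ≤ M) (hDM : D.real (Ioi M) ≤ Real.exp (-Real.log x) / Real.log x ^ 3) :
    (Measure.pi fun _ : ι => D).real (s.spike M) ≤
      1 / x ^ (c + 1) + 1 / 2 * (1 / Real.log x ^ 2) := by
  have hx0 := hx.pos
  have hL := hx.three_le_log
  have htail := hx.real_lt_abs_le hint
  have hmean : (s.m : ℝ) * D.real (Ioi M) ≤ c / Real.log x ^ 3 := by
    calc (s.m : ℝ) * D.real (Ioi M) ≤ c * x * (Real.exp (-Real.log x) / Real.log x ^ 3) :=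
          mul_le_mul hs.m_le hDM measureReal_nonneg (by positivity)
      _ = c / Real.log x ^ 3 := by
          rw [Real.exp_neg, Real.exp_log hx0]
          field_simp
  have hfactor : Real.exp 1 + s.𝒜.card * (3 * (1 / x ^ (c + 1)) +
      D.real {y | x ^ (1 / 10 : ℝ) < |y|}) ≤ 8 := by
    calc Real.exp 1 + s.𝒜.card * (3 * (1 / x ^ (c + 1)) + D.real {y | x ^ (1 / 10 : ℝ) < |y|})
        ≤ Real.exp 1 + x ^ c * (3 * (1 / x ^ (c + 1)) + 1 / x ^ (c + 1)) := by
          gcongr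
          · exact hs.card_𝒜_le
          · exact htail.trans hx.one_div_pow_le
      _ ≤ 8 := by linarith [hx.pow_mul_one_div_pow_succ_le, Real.exp_one_lt_three]
  calc (Measure.pi fun _ : ι => D).real (s.spike M)
      ≤ s.𝒯.card * D.real {y | x ^ (1 / 10 : ℝ) < |y|} + s.m * D.real (Ioi M) *
        (Real.exp 1 + s.𝒜.card * (3 * (1 / x ^ (c + 1)) +
          D.real {y | x ^ (1 / 10 : ℝ) < |y|})) := s.real_spike_le hM hnear
    _ ≤ x ^ c * (1 / x ^ (2 * c + 1)) + c / Real.log x ^ 3 * 8 := by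
        gcongr
        exact hs.card_𝒯_le
    _ ≤ 1 / x ^ (c + 1) + 1 / 2 * (1 / Real.log x ^ 2) := by
        rw [hx.pow_mul_one_div_pow]
        refine add_le_add le_rfl ?_
        rw [div_mul_eq_mul_div, mul_one_div, div_le_div_iff₀ (by positivity) (by positivity),
          pow_succ (Real.log x) 2]
        nlinarith [mul_le_mul_of_nonneg_right hx.le_log (sq_nonneg (Real.log x))]

theorem HasSize.real_badSelection_le (hs : s.HasSize c x) (hx : IsLargeScale D c x)
    (hμ : 0 < ∫ y, y ∂D) (hint : ∀ p : ℕ, Integrable (fun x : ℝ => |x| ^ p) D)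
    (hμR : |∫ y in Icc (-(x ^ (1 / 10 : ℝ))) (x ^ (1 / 10 : ℝ)), y ∂D - ∫ y, y ∂D| ≤
      1 / Real.log (Real.log x) ^ 2 * (∫ y, y ∂D) / 2)
    {M M' : ℝ} (hM : IsThresholdPair D (Real.log x) M M')
    (hspike : (Measure.pi fun _ : ι => D).real (s.spike M') ≤
      1 / x ^ (c + 1) + 1 / 2 * (1 / Real.log x ^ 2)) :
    (Measure.pi fun _ : ι => D).real (badSelection s.𝒜 s.Nb s.w
      (s.W - 2 * s.v - 6 * (1 / Real.log (Real.log x) ^ 2) * s.W)) ≤ 1 / Real.log x ^ 2 := by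
  have hx0 := hx.pos
  have hll := hx.six_le_log_log
  have hbad := s.real_badSelection_le (D := D) hμ (by positivity)
    (one_div_le_one_div_of_le (by norm_num) (by nlinarith)) (by positivity) hμR hM.pos hM.mul_le
    hspike
  have hhits := mul_le_mul hs.card_𝒜_le (hx.two_mul_exp_neg_hits_le hM.le_real hs.le_m)
    (by positivity) (by positivity)
  rw [hx.pow_mul_one_div_pow] at hhits
  have : 0 ≤ 1 / x ^ (c + 1) := by positivity
  linarith [hs.deviationBound_le hx hint, hx.one_div_pow_succ_le]

end SelectionSystem

variable {n : ℕ}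

/-- The selection problem which an iteration of SM-Greedy starting from `S` solves. The value `v`
lost by a swap is, by submodularity, at most the average contribution of an element of the best
bundle. -/
noncomputable def stepSystem {f : Finset (Fin n) → ℝ} (hm : Monotone f) (hf : Submodular f)
    (h0 : 0 ≤ f ∅) {c : ℕ} (hc : 8 ≤ c) {S : Finset (Fin n)} (hS : 2 * (S.card + c) ≤ n)
    (hW : 0 < bundleMax f c S) : SelectionSystem (Finset (Fin n)) (Finset (Fin n)) where
  𝒜 := bundles c S
  Nb := neighbors S
  w := f
  m := c * (n - (S.card + c))
  W := bundleMax f c S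
  v := (bundleMax f c S - f S) / c
  𝒯 := (bundles c S).image (S ∪ ·)
  card_Nb _ hA := card_neighbors hA
  card_inter A hA B hB hAB := by
    have hcard := card_neighbors_inter_le hA hB hAB
    have hcm : 8 * (n - (S.card + c)) ≤ c * (n - (S.card + c)) := Nat.mul_le_mul_right _ hc
    lia
  Nb_subset _ hA := neighbors_subset_image_bundles hA
  m_pos := Nat.mul_pos (by lia) (by lia)
  w_nonneg T := h0.trans (hm (Finset.empty_subset T))
  w_le A hA T hT := by
    obtain ⟨B, hB, rfl⟩ := Finset.mem_image.1 (neighbors_subset_image_bundles hA hT)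
    exact le_bundleMax f hB
  W_pos := hW
  v_nonneg := by
    obtain ⟨A, -, hA⟩ := exists_bundleMax_eq f (S := S) (c := c) (by lia)
    rw [hA]
    exact div_nonneg (sub_nonneg.2 (hm Finset.subset_union_left)) c.cast_nonneg
  v_le := by
    have hfS : 0 ≤ f S := h0.trans (hm (Finset.empty_subset S))
    have hc' : (8 : ℝ) ≤ c := by exact_mod_cast hc
    gcongr
    linarith
  exists_le_sum := by
    obtain ⟨A, hA, hAmax⟩ := exists_bundleMax_eq f (S := S) (c := c) (by lia)
    refine ⟨A, hA, (le_of_eq ?_).trans (hf.le_sum_neighbors hm hA)⟩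
    have hc' : (c : ℝ) ≠ 0 := Nat.cast_ne_zero.2 (by lia)
    rw [hAmax]
    push_cast
    field_simp

theorem hasSize_stepSystem {f : Finset (Fin n) → ℝ} (hm : Monotone f) (hf : Submodular f)
    (h0 : 0 ≤ f ∅) {c : ℕ} (hc : 16 ≤ c) {S : Finset (Fin n)} (hS : 2 * (S.card + c) ≤ n)
    (hW : 0 < bundleMax f c S) :
    (stepSystem hm hf h0 (le_trans (by norm_num) hc) hS hW).HasSize c n := by
  have h𝒜 : ((bundles c S).card : ℝ) ≤ (n : ℝ) ^ c := by exact_mod_cast card_bundles_le_pow c S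
  refine ⟨?_, ?_, h𝒜, le_trans ?_ h𝒜⟩
  · have hm : 8 * n ≤ c * (n - (S.card + c)) := by
      calc 8 * n ≤ 16 * (n - (S.card + c)) := by lia
        _ ≤ c * (n - (S.card + c)) := Nat.mul_le_mul_right _ hc
    exact_mod_cast hm
  · exact_mod_cast Nat.mul_le_mul_left c (Nat.sub_le n (S.card + c))
  · exact_mod_cast Finset.card_image_le

/-- Noise vectors for which an iteration of SM-Greedy starting from `S` may, under some tie-breaking
rule, end up with less than `stepValue f c η S`. -/
def stepFailure (f : Finset (Fin n) → ℝ) (c : ℕ) (η : ℝ) (S : Finset (Fin n)) :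
    Set (Finset (Fin n) → ℝ) :=
  badSelection (bundles c S) (neighbors S) f (stepValue f c η S)

theorem stepFailure_eq_empty {f : Finset (Fin n) → ℝ} (hm : Monotone f) (h0 : 0 ≤ f ∅)
    {c : ℕ} {S : Finset (Fin n)} (hS : S.card + c ≤ n) (hW : bundleMax f c S ≤ 0) (η : ℝ) :
    stepFailure f c η S = ∅ := by
  obtain ⟨A, -, hA⟩ := exists_bundleMax_eq f hS
  have hfS : 0 ≤ f S := h0.trans (hm (Finset.empty_subset S))
  have hfSA : f S ≤ bundleMax f c S := hA ▸ hm Finset.subset_union_left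
  have hstep : stepValue f c η S = 0 := by
    rw [stepValue, le_antisymm hW (hfS.trans hfSA), le_antisymm (hfSA.trans hW) hfS]
    simp
  refine eq_empty_of_forall_notMem fun ξ ⟨_, _, _, T, _, _, hT⟩ => ?_
  rw [hstep] at hT
  exact hT.not_ge (h0.trans (hm (Finset.empty_subset T)))

theorem HasGeneralizedExponentialTail.eventually_real_badSelection_le {D : Measure ℝ}
    [IsProbabilityMeasure D] (hD : HasGeneralizedExponentialTail D)
    (hint : ∀ p : ℕ, Integrable (fun x : ℝ => |x| ^ p) D) (hμ : 0 < ∫ x, x ∂D) (c : ℕ) :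
    ∀ᶠ x : ℝ in atTop, ∀ {ι β : Type} [Fintype ι] [DecidableEq ι] (s : SelectionSystem ι β),
      s.HasSize c x → (Measure.pi fun _ : ι => D).real (badSelection s.𝒜 s.Nb s.w
        (s.W - 2 * s.v - 6 * (1 / Real.log (Real.log x) ^ 2) * s.W)) ≤ 1 / Real.log x ^ 2 := by
  have hint1 : Integrable (fun y : ℝ => y) D :=
    (integrable_norm_iff aestronglyMeasurable_id).1
      (by simpa only [pow_one, Real.norm_eq_abs, id] using hint 1)
  have hint2 : Integrable (fun y : ℝ => y ^ 2) D := by simpa only [sq_abs] using hint 2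
  rcases hD.eventually_exists_isThresholdPair hint1 hμ with hbounded | ⟨⟨a, ha⟩, hunbounded⟩
  · filter_upwards [eventually_isLargeScale hμ c, Real.tendsto_log_atTop.eventually hbounded]
      with x hx ⟨M, M', hM, hM'⟩ ι β _ _ s hs
    have hx0 := hx.pos
    refine hs.real_badSelection_le hx hμ hint (hx.abs_setIntegral_sub_le hint1 hint2) hM ?_
    rw [s.real_spike_eq_zero hM']
    positivity
  · filter_upwards [eventually_isLargeScale hμ c, Real.tendsto_log_atTop.eventually hunbounded,
      eventually_mul_rpow_le_mul_rpow ha (r := 1 / 10) (s := 1 / 4) (by norm_num) 5]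
      with x hx ⟨M, M', hM, hM'⟩ hax ι β _ _ s hs
    have hμR := hx.abs_setIntegral_sub_le hint1 hint2
    exact hs.real_badSelection_le hx hμ hint hμR hM (hs.real_spike_le hx hint
      (fun A hA => hs.real_nearMax_le hx hμ hint hμR hax hA) hM.nonneg hM')

instance isProbabilityMeasure_noiseLaw (D : Measure ℝ) [IsProbabilityMeasure D] (n : ℕ) :
    IsProbabilityMeasure (noiseLaw D n) :=
  inferInstanceAs (IsProbabilityMeasure (Measure.pi fun _ => D))

theorem HasGeneralizedExponentialTail.eventually_real_stepFailure_le {D : Measure ℝ}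
    [IsProbabilityMeasure D] (hD : HasGeneralizedExponentialTail D)
    (hint : ∀ p : ℕ, Integrable (fun x : ℝ => |x| ^ p) D) (hμ : 0 < ∫ x, x ∂D)
    {c : ℕ} (hc : 16 ≤ c) :
    ∀ᶠ n : ℕ in atTop, ∀ f : Finset (Fin n) → ℝ, Monotone f → Submodular f → 0 ≤ f ∅ →
      ∀ S : Finset (Fin n), 2 * (S.card + c) ≤ n →
        (noiseLaw D n).real (stepFailure f c (1 / Real.log (Real.log n) ^ 2) S) ≤
          1 / Real.log n ^ 2 := by
  filter_upwards [tendsto_natCast_atTop_atTop.eventually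
    (hD.eventually_real_badSelection_le hint hμ c)] with n hn f hm hf h0 S hS
  rcases le_or_gt (bundleMax f c S) 0 with hW | hW
  · rw [stepFailure_eq_empty hm h0 (by lia) hW, measureReal_empty]
    positivity
  · exact hn (stepSystem hm hf h0 (by lia) hS hW) (hasSize_stepSystem hm hf h0 hc hS hW)

end StepFailure

section Failure

theorem real_setOf_mem_comp_le {Ω α : Type*} [MeasurableSpace Ω] {P : Measure Ω}
    [IsProbabilityMeasure P] {s : Finset α} {X : Ω → α}
    (hX : ∀ a ∈ s, MeasurableSet {ω | X ω = a}) (hXs : ∀ ω, X ω ∈ s) {Y : α → Set Ω} {δ : ℝ}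
    (hδ : 0 ≤ δ) (hXY : ∀ a ∈ s, P.real ({ω | X ω = a} ∩ Y a) ≤ P.real {ω | X ω = a} * δ) :
    P.real {ω | ω ∈ Y (X ω)} ≤ δ := by
  have hcover : {ω | ω ∈ Y (X ω)} ⊆ ⋃ a ∈ s, {ω | X ω = a} ∩ Y a := fun ω hω =>
    mem_iUnion₂.2 ⟨X ω, hXs ω, rfl, hω⟩
  calc P.real {ω | ω ∈ Y (X ω)} ≤ ∑ a ∈ s, P.real ({ω | X ω = a} ∩ Y a) :=
        (measureReal_mono hcover (measure_ne_top P _)).trans (measureReal_biUnion_finset_le _ _)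
    _ ≤ ∑ a ∈ s, P.real (X ⁻¹' {a}) * δ := Finset.sum_le_sum hXY
    _ = P.real (X ⁻¹' s) * δ := by
        rw [← Finset.sum_mul, sum_measureReal_preimage_singleton s hX]
    _ ≤ δ := mul_le_of_le_one_left hδ measureReal_le_one

/-- Noise vectors for which, with the starting point which SM-Greedy has reached after `t`
iterations, the next iteration may fail. -/
def iterationFailure {n : ℕ} (τ : TieBreak n) (f : Finset (Fin n) → ℝ) (c : ℕ) (η : ℝ) (t : ℕ) :
    Set (Finset (Fin n) → ℝ) :=
  {ξ | ξ ∈ stepFailure f c η ((stepSol τ (noisyOracle f ξ) c)^[t] ∅)}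

variable {n : ℕ} {D : Measure ℝ} [IsProbabilityMeasure D] (τ : TieBreak n)
  {f : Finset (Fin n) → ℝ} {c k : ℕ} {η δ β : ℝ}

/-- The solution after `t` iterations depends only on the noise of sets of size at most `t * c`,
and the failure of the next iteration only on the noise of larger sets. -/
theorem real_iterationFailure_le (hc : 0 < c) (hδ : 0 ≤ δ) {t : ℕ} (ht : t * c < n)
    (hfail : ∀ S : Finset (Fin n), S.card = t * c →
      (noiseLaw D n).real (stepFailure f c η S) ≤ δ) :
    (noiseLaw D n).real (iterationFailure τ f c η t) ≤ δ := by
  have hnoise : ∀ T, Measurable fun ξ : Finset (Fin n) → ℝ => noisyOracle f ξ T := fun T => by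
    unfold noisyOracle
    fun_prop
  have hmeas := measurableSet_iterate_stepSol_eq τ hnoise c t
  let U : Finset (Finset (Fin n)) := {T | T.card ≤ t * c}
  refine real_setOf_mem_comp_le (s := {S | S.card = t * c}) (fun S _ => hmeas S)
    (fun ξ => Finset.mem_filter_univ _ |>.2 (card_iterate_stepSol τ _ hc ht)) hδ fun S hS => ?_
  have hScard : S.card = t * c := (Finset.mem_filter_univ S).1 hS
  refine (pi_real_inter_eq_mul (fun _ => D) U (hmeas S)
    (measurableSet_badSelection _ _ _ _) (fun ξ ξ' h => ?_) fun ξ ξ' h => ?_).trans_le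
    (mul_le_mul_of_nonneg_left (hfail S hScard) measureReal_nonneg)
  · have hsol : (stepSol τ (noisyOracle f ξ) c)^[t] ∅ = (stepSol τ (noisyOracle f ξ') c)^[t] ∅ :=
      iterate_stepSol_congr τ hc ht fun T hT => by
        rw [noisyOracle, noisyOracle, h T ((Finset.mem_filter_univ T).2 hT)]
    simp only [mem_ofPred_eq, hsol]
  · have heq : ∀ A ∈ bundles c S, ∀ T ∈ neighbors S A, ξ T = ξ' T := fun A hA T hT => by
      have hT' := card_of_mem_neighbors hA hT
      refine h T (Finset.mem_coe.2 (Finset.mem_compl.2 fun hTU => ?_))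
      have := (Finset.mem_filter_univ T).1 hTU
      lia
    exact propext ⟨badSelection_congr heq, badSelection_congr fun A hA T hT => (heq A hA T hT).symm⟩

theorem Submodular.mul_optValue_le_smGreedy (hf : Submodular f) (hm : Monotone f) (h0 : 0 ≤ f ∅)
    (hc : 2 ≤ c) (hk : k < n) (hη : 0 ≤ η)
    (hβ : (1 - ((c : ℝ) - 2) / k) ^ (k / c) + 6 * η * (k / c : ℕ) ≤ β) {ξ : Finset (Fin n) → ℝ}
    (hξ : ∀ t < k / c, ξ ∉ iterationFailure τ f c η t) :
    (1 - β) * optValue f k ≤ f (smGreedy τ (noisyOracle f ξ) c k).sol := by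
  have hr : k / c * c ≤ k := Nat.div_mul_le_self k c
  have hcard : ∀ t ≤ k / c, ((stepSol τ (noisyOracle f ξ) c)^[t] ∅).card = t * c := fun t ht =>
    card_iterate_stepSol τ _ (by lia) ((Nat.mul_le_mul_right c ht).trans_lt (by lia))
  have hvalue : ∀ t < k / c, stepValue f c η ((stepSol τ (noisyOracle f ξ) c)^[t] ∅) ≤
      f ((stepSol τ (noisyOracle f ξ) c)^[t + 1] ∅) := fun t ht => by
    have hct : (t + 1) * c ≤ k / c * c := Nat.mul_le_mul_right c ht
    rw [Function.iterate_succ_apply']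
    have hξt := hξ t ht
    rw [iterationFailure, mem_ofPred_eq] at hξt
    refine le_stepSol_of_notMem_badSelection τ (by lia) ?_ hξt
    rw [hcard t ht.le, ← Nat.succ_mul]
    lia
  have hgap := hf.optValue_sub_le_of_forall_stepValue_le hm h0 hc hr hk.le hη hcard hvalue
  rw [sol_smGreedy]
  linarith [mul_le_mul_of_nonneg_right hβ (optValue_nonneg h0 k)]

theorem Submodular.one_sub_le_real_mul_optValue_le_smGreedy (hf : Submodular f) (hm : Monotone f)
    (h0 : 0 ≤ f ∅) (hc : 2 ≤ c) (hk : 2 * k ≤ n) (hn : 0 < n) (hη : 0 ≤ η) (hδ : 0 ≤ δ)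
    (hβ : (1 - ((c : ℝ) - 2) / k) ^ (k / c) + 6 * η * (k / c : ℕ) ≤ β)
    (hfail : ∀ S : Finset (Fin n), 2 * (S.card + c) ≤ n →
      (noiseLaw D n).real (stepFailure f c η S) ≤ δ) :
    1 - k * δ ≤ (noiseLaw D n).real {ξ : Finset (Fin n) → ℝ |
      (1 - β) * optValue f k ≤ f (smGreedy τ (noisyOracle f ξ) c k).sol} := by
  set G := {ξ | (1 - β) * optValue f k ≤ f (smGreedy τ (noisyOracle f ξ) c k).sol}
  set F := ⋃ t ∈ Finset.range (k / c), iterationFailure τ f c η t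
  have hF : (noiseLaw D n).real F ≤ k * δ := by
    calc (noiseLaw D n).real F ≤ (Finset.range (k / c)).card • δ := by
          refine (measureReal_biUnion_finset_le _ _).trans
            (Finset.sum_le_card_nsmul _ _ _ fun t ht => ?_)
          have hct : (t + 1) * c ≤ k / c * c :=
            Nat.mul_le_mul_right c (Finset.mem_range.1 ht)
          rw [Nat.succ_mul] at hct
          have hr : k / c * c ≤ k := Nat.div_mul_le_self k c
          exact real_iterationFailure_le τ (by lia) hδ (by lia) fun S hS =>
            hfail S (by lia)
      _ ≤ k * δ := by
          rw [Finset.card_range, nsmul_eq_mul]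
          exact mul_le_mul_of_nonneg_right (by exact_mod_cast Nat.div_le_self k c) hδ
  have hGF : univ ⊆ G ∪ F := fun ξ _ => or_iff_not_imp_right.2 fun hξ => by
    simp only [F, mem_iUnion, Finset.mem_range, exists_prop, not_exists, not_and] at hξ
    exact hf.mul_optValue_le_smGreedy τ hm h0 hc (by lia) hη hβ hξ
  have hone : 1 ≤ (noiseLaw D n).real (G ∪ F) :=
    (probReal_univ (μ := noiseLaw D n)).symm.le.trans (measureReal_mono hGF)
  linarith [measureReal_union_le (μ := noiseLaw D n) G F]

end Failure

section Guarantee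

open Filter

variable {ε : ℝ}

theorem one_sub_bundleSize_pow_add_le (hε : 0 < ε) (hε1 : ε ≤ 1) {k : ℕ} (hk : 16 / ε ≤ k) {l : ℝ}
    (hkl : 12 * k ≤ ε * l ^ 2) :
    (1 - ((bundleSize ε k : ℝ) - 2) / k) ^ (k / bundleSize ε k) +
      6 * (1 / l ^ 2) * (k / bundleSize ε k : ℕ) ≤ 1 / Real.exp 1 + ε := by
  have hdiv : ((k / bundleSize ε k : ℕ) : ℝ) ≤ k := by exact_mod_cast Nat.div_le_self k _
  have herror : 6 * (1 / l ^ 2) * (k / bundleSize ε k : ℕ) ≤ ε / 2 := by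
    calc 6 * (1 / l ^ 2) * (k / bundleSize ε k : ℕ) ≤ 6 * (1 / l ^ 2) * k := by gcongr
      _ = 6 * k / l ^ 2 := by ring
      _ ≤ ε / 2 := div_le_of_le_mul₀ (sq_nonneg l) (by positivity) (by linarith)
  linarith [one_sub_bundleSize_pow_le hε hε1 hk]

theorem eventually_forall_le_mul_log_log (hε : 0 < ε) (C : ℝ) :
    ∀ᶠ n : ℕ in atTop, ∀ k : ℕ, (k : ℝ) ≤ C * Real.log (Real.log n) →
      12 * k ≤ ε * Real.log (Real.log n) ^ 2 ∧ (k : ℝ) ≤ Real.log n ∧ 2 * k ≤ n := by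
  have hlog : Tendsto (fun n : ℕ => Real.log n) atTop atTop :=
    Real.tendsto_log_atTop.comp tendsto_natCast_atTop_atTop
  have hloglog := Real.tendsto_log_atTop.comp hlog
  filter_upwards [hloglog.eventually (eventually_ge_atTop (12 * C / ε)),
    hloglog.eventually (eventually_ge_atTop 0),
    hlog.eventually (eventually_mul_log_pow_le_mul one_pos 1 C),
    tendsto_natCast_atTop_atTop.eventually (eventually_mul_log_pow_le_mul one_pos 1 2)]
    with n hC hl hlog_log hlogn k hk
  rw [Function.comp_apply, div_le_iff₀ hε] at hC
  rw [pow_one, one_mul] at hlog_log hlogn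
  have hkL := hk.trans hlog_log
  refine ⟨?_, hkL, by exact_mod_cast (by linarith : (2 : ℝ) * k ≤ n)⟩
  calc 12 * (k : ℝ) ≤ 12 * C * Real.log (Real.log n) := by linarith
    _ ≤ Real.log (Real.log n) * ε * Real.log (Real.log n) := mul_le_mul_of_nonneg_right hC hl
    _ = ε * Real.log (Real.log n) ^ 2 := by ring

theorem HasGeneralizedExponentialTail.eventually_forall_real_stepFailure_le {D : Measure ℝ}
    [IsProbabilityMeasure D] (hD : HasGeneralizedExponentialTail D)
    (hint : ∀ p : ℕ, Integrable (fun x : ℝ => |x| ^ p) D) (hμ : 0 < ∫ x, x ∂D) (C : ℕ) :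
    ∀ᶠ n : ℕ in atTop, ∀ c ∈ Finset.Icc 16 C, ∀ f : Finset (Fin n) → ℝ, Monotone f →
      Submodular f → 0 ≤ f ∅ → ∀ S : Finset (Fin n), 2 * (S.card + c) ≤ n →
        (noiseLaw D n).real (stepFailure f c (1 / Real.log (Real.log n) ^ 2) S) ≤
          1 / Real.log n ^ 2 :=
  (eventually_all_finset _).2 fun _ hc =>
    hD.eventually_real_stepFailure_le hint hμ (Finset.mem_Icc.1 hc).1

theorem one_sub_four_div_logb_le {n k : ℕ} (hn : 2 ≤ n) (hk : (k : ℝ) ≤ Real.log n) :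
    1 - 4 / Real.logb 2 n ≤ 1 - k * (1 / Real.log n ^ 2) := by
  have hL : 0 < Real.log n := Real.log_pos (by exact_mod_cast hn)
  have hlog2 : 1 ≤ 4 * Real.log 2 := by linarith [Real.log_two_gt_d9]
  refine sub_le_sub_left ?_ 1
  calc k * (1 / Real.log n ^ 2) ≤ Real.log n * (1 / Real.log n ^ 2) := by gcongr
    _ = 1 / Real.log n := by field_simp
    _ ≤ 4 * Real.log 2 / Real.log n := by gcongr
    _ = 4 / Real.logb 2 n := by rw [Real.logb, div_div_eq_mul_div]

theorem mul_optValue_le_of_nonpos {n : ℕ} {f : Finset (Fin n) → ℝ} (hm : Monotone f) (h0 : 0 ≤ f ∅)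
    {a : ℝ} (ha : a ≤ 0) (k : ℕ) (S : Finset (Fin n)) : a * optValue f k ≤ f S :=
  (mul_nonpos_of_nonpos_of_nonneg ha (optValue_nonneg h0 k)).trans
    (h0.trans (hm (Finset.empty_subset S)))

theorem Submodular.one_sub_le_real_smGreedy_bundleSize {n k : ℕ} {f : Finset (Fin n) → ℝ}
    (hf : Submodular f) (hm : Monotone f) (h0 : 0 ≤ f ∅) {D : Measure ℝ} [IsProbabilityMeasure D]
    (τ : TieBreak n) (hε : 0 < ε) (hn : 2 ≤ n) (hk : 16 / ε ≤ k)
    (hkl : 12 * k ≤ ε * Real.log (Real.log n) ^ 2) (hkL : (k : ℝ) ≤ Real.log n) (hkn : 2 * k ≤ n)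
    (hfail : 16 ≤ bundleSize ε k → ∀ S : Finset (Fin n), 2 * (S.card + bundleSize ε k) ≤ n →
      (noiseLaw D n).real (stepFailure f (bundleSize ε k) (1 / Real.log (Real.log n) ^ 2) S) ≤
        1 / Real.log n ^ 2) :
    1 - 4 / Real.logb 2 n ≤ (noiseLaw D n).real {ξ : Finset (Fin n) → ℝ |
      (1 - 1 / Real.exp 1 - ε) * optValue f k ≤
        f (smGreedy τ (noisyOracle f ξ) (bundleSize ε k) k).sol} := by
  refine (one_sub_four_div_logb_le hn hkL).trans ?_
  rw [sub_sub]
  rcases le_or_gt ε 1 with hε1 | hε1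
  · have h16 := sixteen_le_bundleSize hε hε1 hk
    exact hf.one_sub_le_real_mul_optValue_le_smGreedy τ hm h0 (by lia) hkn (by lia) (by positivity)
      (by positivity) (one_sub_bundleSize_pow_add_le hε hε1 hk hkl) (hfail h16)
  · have hfactor : 1 - (1 / Real.exp 1 + ε) ≤ 0 := by linarith [one_div_pos.2 (Real.exp_pos 1)]
    rw [eq_univ_of_forall fun ξ : Finset (Fin n) → ℝ =>
      mem_ofPred.2 (mul_optValue_le_of_nonpos hm h0 hfactor k _), probReal_univ]
    exact sub_le_self 1 (by positivity)

end Guarantee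

theorem mainTheorem2 :
    ∃ C₁ : ℝ, 0 < C₁ ∧
      ∀ ε : ℝ, 0 < ε →
        ∃ d : ℕ,
          ∀ (C₂ : ℝ) (D : MeasureTheory.Measure ℝ) [MeasureTheory.IsProbabilityMeasure D],
            HasGeneralizedExponentialTail D →
            (∀ p : ℕ, MeasureTheory.Integrable (fun x : ℝ => |x| ^ p) D) →
            0 < ∫ x, x ∂D →
            ∃ n₀ : ℕ, ∀ n : ℕ, n₀ ≤ n → ∀ k : ℕ,
              C₁ / ε ≤ (k : ℝ) → (k : ℝ) ≤ C₂ * Real.log (Real.log n) →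
              ∀ τ : TieBreak n,
                (∀ g : Finset (Fin n) → ℝ,
                  (smGreedy τ g (bundleSize ε k) k).sol.card ≤ k ∧
                  (smGreedy τ g (bundleSize ε k) k).evals ≤ n ^ d) ∧
                ∀ f : Finset (Fin n) → ℝ, Monotone f → Submodular f → 0 ≤ f ∅ →
                  ENNReal.ofReal (1 - 4 / Real.logb 2 n) ≤
                    noiseLaw D n {ξ : Finset (Fin n) → ℝ |
                      (1 - 1 / Real.exp 1 - ε) * optValue f k ≤
                        f (smGreedy τ (noisyOracle f ξ) (bundleSize ε k) k).sol} := by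
  refine ⟨16, by norm_num, fun ε hε => ?_⟩
  set C := ⌈400 / ε ^ 2⌉₊ + ⌈80 / ε⌉₊
  refine ⟨C + 4, fun C₂ D _ hD hint hμ => ?_⟩
  obtain ⟨n₀, hn₀⟩ := Filter.eventually_atTop.1
    ((hD.eventually_forall_real_stepFailure_le hint hμ C).and
      ((eventually_forall_le_mul_log_log hε C₂).and (Filter.eventually_ge_atTop 2)))
  refine ⟨n₀, fun n hn k hk hkC₂ τ => ?_⟩
  obtain ⟨hfail, hbounds, hn2⟩ := hn₀ n hn
  obtain ⟨hkl, hkL, hkn⟩ := hbounds k hkC₂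
  have hk0 : 0 < k := Nat.cast_pos.1 (lt_of_lt_of_le (by positivity) hk)
  have hcC : bundleSize ε k ≤ C := bundleSize_le ε k
  refine ⟨fun g => ⟨card_sol_smGreedy_le τ g (bundleSize_pos hε hk0) (by lia), ?_⟩,
    fun f hm hf h0 => ?_⟩
  · calc (smGreedy τ g (bundleSize ε k) k).evals ≤ n ^ (bundleSize ε k + 4) :=
          evals_smGreedy_le τ g _ hn2 (by lia)
      _ ≤ n ^ (C + 4) := Nat.pow_le_pow_right (by lia) (by lia)
  · rw [← ofReal_measureReal]
    exact ENNReal.ofReal_le_ofReal (hf.one_sub_le_real_smGreedy_bundleSize hm h0 τ hε hn2 hk hkl hkL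
      hkn fun h16 => hfail _ (Finset.mem_Icc.2 ⟨h16, hcC⟩) f hm hf h0)
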